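/- There is an algorithm that, given a finite simple graph $G$ with $n$ vertices together with a path decomposition of $G$ with $L$ bags and width $\mathrm{pw}$, computes the number of forests of $G$, that is, the number of edge sets $X \subseteq E(G)$ for which $(V(G),X)$ is acyclic, in time at most $C \cdot 4^{\mathrm{pw}} (n+L)^{k}$, where $C$ and $k$ are absolute constants. In particular, the time is $4^{\mathrm{pw}} n^{O(1)}$ for path decompositions with $n^{O(1)}$ bags. Here a path decomposition of $G$ is a sequence of $L \ge 1$ vertex sets (bags) $B_1,\dots,B_L$ such that every vertex lies in some bag, both ends of every edge lie in a common bag, and for every vertex $v$ the indices $i$ with $v \in B_i$ are consecutive. Its width is $\max_i |B_i| - 1$ (taken to be $0$ if $G$ has no vertices). An algorithm is a single program for a random access machine with the instructions constant, addition, truncated subtraction, multiplication, integer division, indirect load and store, and conditional jump on natural numbers. Its time is the logarithmic cost: each instruction costs one plus the binary lengths of the numbers and memory addresses it works with. In particular, the number of executed instructions obeys the same bound. The graph has vertex set $\{0,\dots,n-1\}$, and the input consists of $n$, $L$, the adjacency matrix of $G$ and the indicator vectors of the bags. -/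

import Mathlib

namespace ForestCounting

/-! ### Graphs: forests and path decompositions -/

/-- The number of forests of `G = (V, E)`: the number of edge sets `X ⊆ E` such that `(V, X)` is
acyclic. -/
noncomputable def numForests {V : Type*} (G : SimpleGraph V) : ℕ :=
  {X : Set (Sym2 V) | X ⊆ G.edgeSet ∧ (SimpleGraph.fromEdgeSet X).IsAcyclic}.ncard

/-- A path decomposition of `G`: bags `bag 0, …, bag (length - 1)` placed along a (non-empty) path,
such that every vertex and every edge lies in some bag, and such that the bags containing a given
vertex form a subpath. -/
structure PathDecomposition {V : Type*} (G : SimpleGraph V) where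
  /-- the number of nodes of the path -/
  length : ℕ
  length_pos : 0 < length
  bag : Fin length → Finset V
  vertex_covered : ∀ v : V, ∃ i, v ∈ bag i
  edge_covered : ∀ u v : V, G.Adj u v → ∃ i, u ∈ bag i ∧ v ∈ bag i
  interval : ∀ (v : V) (i j k : Fin length), i ≤ j → j ≤ k → v ∈ bag i → v ∈ bag k → v ∈ bag j

/-- The width of a path decomposition: the maximal size of a bag, minus one.
(For the graph without vertices this is `0`.) -/
def PathDecomposition.width {V : Type*} {G : SimpleGraph V} (D : PathDecomposition G) : ℕ :=
  (Finset.univ.sup fun i => (D.bag i).card) - 1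

/-! ### The machine model: random access machines with logarithmic cost -/

/-- The instructions of a random access machine with registers `R[0], R[1], …` and a memory
`M[0], M[1], …`, all of which hold natural numbers. -/
inductive Instr where
  /-- `R[d] := k` -/
  | const (d k : ℕ)
  /-- `R[d] := R[a] + R[b]` -/
  | add (d a b : ℕ)
  /-- `R[d] := max (R[a] - R[b]) 0` -/
  | sub (d a b : ℕ)
  /-- `R[d] := R[a] * R[b]` -/
  | mul (d a b : ℕ)
  /-- `R[d] := ⌊R[a] / R[b]⌋`, and `0` if `R[b] = 0` -/
  | div (d a b : ℕ)
  /-- `R[d] := M[R[a]]` -/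
  | load (d a : ℕ)
  /-- `M[R[a]] := R[s]` -/
  | store (a s : ℕ)
  /-- if `R[a] = 0`, jump to instruction number `l` -/
  | jz (a l : ℕ)

/-- A program is a finite list of instructions, numbered from `0`. -/
abbrev Program := List Instr

/-- A configuration: the program counter, the registers and the memory. -/
structure Config where
  pc : ℕ
  reg : ℕ → ℕ
  mem : ℕ → ℕ

/-- Write `x` to register `d` and go on to the next instruction. -/
def Config.setReg (c : Config) (d x : ℕ) : Config :=
  { pc := c.pc + 1, reg := Function.update c.reg d x, mem := c.mem }

/-- The effect of an instruction. -/
def Instr.exec (c : Config) : Instr → Config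
  | .const d k => c.setReg d k
  | .add d a b => c.setReg d (c.reg a + c.reg b)
  | .sub d a b => c.setReg d (c.reg a - c.reg b)
  | .mul d a b => c.setReg d (c.reg a * c.reg b)
  | .div d a b => c.setReg d (c.reg a / c.reg b)
  | .load d a => c.setReg d (c.mem (c.reg a))
  | .store a s => { c with pc := c.pc + 1, mem := Function.update c.mem (c.reg a) (c.reg s) }
  | .jz a l => { c with pc := if c.reg a = 0 then l else c.pc + 1 }

/-- The time taken by an instruction: one, plus the lengths in binary of all the numbers and all
the memory addresses it works with. (The register names in an instruction are constants of the
program and contribute a constant factor only, so they are not charged.) -/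
def Instr.cost (c : Config) : Instr → ℕ
  | .const _ k => 1 + k.size
  | .add _ a b => 1 + (c.reg a).size + (c.reg b).size
  | .sub _ a b => 1 + (c.reg a).size + (c.reg b).size
  | .mul _ a b => 1 + (c.reg a).size + (c.reg b).size
  | .div _ a b => 1 + (c.reg a).size + (c.reg b).size
  | .load _ a => 1 + (c.reg a).size + (c.mem (c.reg a)).size
  | .store a s => 1 + (c.reg a).size + (c.reg s).size
  | .jz a _ => 1 + (c.reg a).size

/-- `HaltsIn P c c' t`: started in `c`, the program `P` halts in configuration `c'` after total
time `t`. It halts when the program counter leaves the program. -/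
inductive HaltsIn (P : Program) : Config → Config → ℕ → Prop
  | halt {c : Config} (h : P[c.pc]? = none) : HaltsIn P c c 0
  | step {c c' : Config} {i : Instr} {t : ℕ} (h : P[c.pc]? = some i)
      (hrest : HaltsIn P (i.exec c) c' t) : HaltsIn P c c' (i.cost c + t)

/-- The initial configuration: the input word is in the memory cells `0, 1, 2, …`; everything else
is zero. -/
def initConfig (input : List ℕ) : Config where
  pc := 0
  reg := fun _ => 0
  mem := fun i => input.getD i 0

/-- On the given input, `P` halts after time exactly `t` with the given output in register `0`. -/
def Program.Computes (P : Program) (input : List ℕ) (output t : ℕ) : Prop :=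
  ∃ c, HaltsIn P (initConfig input) c t ∧ c.reg 0 = output

/-! ### The encoding of the input -/

open Classical in
/-- The input word for a graph on the vertices `0, …, n - 1` with a path decomposition: `n`, the
number of bags, the rows of the adjacency matrix, and the indicator vector of each bag. -/
noncomputable def encodeInput {n : ℕ} (G : SimpleGraph (Fin n)) (D : PathDecomposition G) :
    List ℕ :=
  [n, D.length] ++
    ((List.finRange n).flatMap fun u =>
      (List.finRange n).map fun v => if G.Adj u v then 1 else 0) ++
    ((List.finRange D.length).flatMap fun i =>
      (List.finRange n).map fun v => if v ∈ D.bag i then 1 else 0)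

end ForestCounting

namespace ForestCounting

/-! ### Fermionic creation operators -/

section Fermions

variable {R : Type*} [CommRing R]

/-! The number of forests is a Berezin integral. Give each vertex `v` two anticommuting variables
ψ̄_v, ψ_v (the modes `2 * v` and `2 * v + 1`) and each edge the even element f_uv = (ψ̄_u -
ψ̄_v)(ψ_u - ψ_v) - ψ̄_u ψ_u ψ̄_v ψ_v. These elements commute, f_uu = 0, and f_uv ψ_u = f_uv ψ_v,
likewise with bars: multiplication by f_uv identifies u with v. Hence f_uv f_uw = f_uv f_vw
(`edgeOp_mul_edgeOp`), so the product over an edge set with a cycle can be rewritten with a factor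
f_vv and vanishes (`prod_eq_zero_of_not_isAcyclic`). Integrating out u against exp(ψ̄_u ψ_u) sends
f_uv a to a if a does not involve u (`FreeOf.forget_edgeOp`), so stripping leaves shows that an
acyclic edge set has integral 1 (`integral_prod_of_isAcyclic`). Expanding ∏ (1 + f_e) therefore
counts the forests (`integral_edgesProd`).

The product is applied to the vacuum bag by bag along the path. Integration over v commutes with f_e
when v is not an end of e (`edgesProd_forget`), so v is integrated out at its last bag, when none of
its edges remain. The vector then involves only modes of the current bag, two per vertex, which
gives at most 4 ^ (width + 1) coefficients. A new vertex needs no work; an edge or a forgotten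
vertex changes each coefficient by a formula in boundedly many others. Coefficients are kept modulo
`2 ^ (n * n + 1)`: this accommodates the signs, and the modulus exceeds the number of forests, so
the residue determines the answer.

For the machine, a small language with bounded loops is compiled to instructions. If all assigned
values are below `2 ^ W`, the logarithmic cost is at most a constant times `W + 1` times the number
of executed commands (`Cmd.compile_computes`). With m = n + L, words of O(m²) bits suffice (`fits`),
and O(4 ^ width * m⁴) commands are executed (`forestCmd_ok`, `forestTime_le`), which gives exponent
6. -/

variable (R) in
/-- Vectors indexed by the finite sets of fermionic modes. Vertex `v` has the two modes `2 * v` and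
`2 * v + 1`. -/
abbrev Fock : Type _ := Finset ℕ → R

variable (R) in
/-- The operator that creates the mode `p`. -/
def create (p : ℕ) : Module.End R (Fock R) where
  toFun a S := if p ∈ S then (-1) ^ (S.filter (· < p)).card * a (S.erase p) else 0
  map_add' a b := by
    ext S
    by_cases h : p ∈ S <;> simp [h, mul_add]
  map_smul' r a := by
    ext S
    by_cases h : p ∈ S <;> simp [h, mul_left_comm]

theorem create_apply (p : ℕ) (a : Fock R) (S : Finset ℕ) :
    create R p a S = if p ∈ S then (-1) ^ (S.filter (· < p)).card * a (S.erase p) else 0 := rfl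

theorem create_mul_self (p : ℕ) : create R p * create R p = 0 := by
  ext a S
  simp [create_apply]

/-- The sign of `q` is read off after `p` has been erased, so its count is one smaller than in the
other order. This single unit is the anticommutation. -/
theorem create_mul_create_of_lt {p q : ℕ} (h : p < q) (a : Fock R) (S : Finset ℕ) :
    (create R p * create R q) a S =
      if p ∈ S ∧ q ∈ S then
        (-1) ^ (S.filter (· < p)).card * ((-1) ^ ((S.filter (· < q)).card - 1) *
          a ((S.erase p).erase q))
      else 0 := by
  simp only [Module.End.mul_apply, create_apply]
  by_cases hp : p ∈ S <;> by_cases hq : q ∈ S <;> simp [hp, hq, h.ne']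
  rw [Finset.filter_erase, Finset.card_erase_of_mem (by simp [hp, h])]

theorem create_mul_create_of_gt {p q : ℕ} (h : p < q) (a : Fock R) (S : Finset ℕ) :
    (create R q * create R p) a S =
      if p ∈ S ∧ q ∈ S then
        (-1) ^ (S.filter (· < p)).card * ((-1) ^ (S.filter (· < q)).card *
          a ((S.erase p).erase q))
      else 0 := by
  simp only [Module.End.mul_apply, create_apply]
  by_cases hp : p ∈ S <;> by_cases hq : q ∈ S <;> simp [hp, hq, h.ne]
  rw [Finset.filter_erase, Finset.erase_eq_of_notMem (by simp [h.le]), Finset.erase_right_comm]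
  ring

theorem create_anticomm (p q : ℕ) : create R p * create R q = -(create R q * create R p) := by
  have key : ∀ {p q : ℕ}, p < q → create R p * create R q = -(create R q * create R p) := by
    intro p q h
    ext a S
    rw [create_mul_create_of_lt h, LinearMap.neg_apply, Pi.neg_apply, create_mul_create_of_gt h]
    by_cases hS : p ∈ S ∧ q ∈ S
    · have : 1 ≤ (S.filter (· < q)).card :=
        Finset.card_pos.mpr ⟨p, by simp [hS.1, h]⟩
      obtain ⟨k, hk⟩ := Nat.exists_eq_add_of_le' this
      simp only [hS, and_self, if_true, hk, Nat.add_sub_cancel, pow_succ]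
      ring
    · simp [hS]
  rcases lt_trichotomy p q with h | rfl | h
  · exact key h
  · simp [create_mul_self]
  · rw [key h, neg_neg]

/-- An element anticommuting with two others commutes with their product. -/
theorem commute_mul_of_anticomm {A : Type*} [Ring A] {x y z : A} (hx : x * z = -(z * x))
    (hy : y * z = -(z * y)) : Commute (x * y) z := by
  rw [commute_iff_eq, mul_assoc, hy, mul_neg, ← mul_assoc, hx, neg_mul, neg_neg, mul_assoc]

theorem mul_mul_mul_self_eq_zero {A : Type*} [Ring A] {x y : A} (h : x * y = -(y * x))
    (hx : x * x = 0) : x * y * (x * y) = 0 := by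
  have : x * y * (x * y) = x * (y * x) * y := by noncomm_ring
  rw [this, eq_neg_iff_add_eq_zero.mp h |> eq_neg_of_add_eq_zero_right, mul_neg, ← mul_assoc, hx]
  simp

theorem sub_mul_sub_symm {A : Type*} [Ring A] (x y x' y' : A) :
    (x - y) * (x' - y') = (y - x) * (y' - x') := by noncomm_ring

/-- The cubic relations between the creation operators of two vertices. -/
theorem edge_relation_even {A : Type*} [Ring A] {x y x' y' : A} (hxx : x * x = 0) (hyy : y * y = 0)
    (hyx : y * x = -(x * y)) (hxx' : x' * x = -(x * x')) (hyx' : y' * x = -(x * y'))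
    (hxy' : x' * y = -(y * x')) (hyy' : y' * y = -(y * y')) :
    ((x - y) * (x' - y') - x * x' * (y * y')) * (x - y) = 0 := by
  -- The factor `x' - y'` anticommutes past `x - y`, whose square vanishes. The quartic term already
  -- contains both `x` and `y`.
  have e1 : (x - y) * (x' - y') * (x - y) = 0 := by
    have : (x' - y') * (x - y) = -((x - y) * (x' - y')) := by
      simp only [sub_mul, mul_sub, hxx', hyx', hxy', hyy']; noncomm_ring
    rw [mul_assoc, this, mul_neg, ← mul_assoc]
    simp [sub_mul, mul_sub, hxx, hyy, hyx]
  have e2 : x * x' * (y * y') * x = 0 := by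
    have h : Commute (y * y') x := commute_mul_of_anticomm hyx hyx'
    rw [mul_assoc, h.eq, mul_assoc, ← mul_assoc x', hxx', neg_mul, mul_neg, mul_assoc,
      ← mul_assoc x, hxx]
    simp
  have e3 : x * x' * (y * y') * y = 0 := by
    rw [mul_assoc, mul_assoc y, hyy', mul_neg, ← mul_assoc y, hyy]; simp
  rw [sub_mul, e1, mul_sub, e2, e3]; simp

theorem edge_relation_odd {A : Type*} [Ring A] {x y x' y' : A} (hxx : x' * x' = 0)
    (hyy : y' * y' = 0) (hyx : y' * x' = -(x' * y')) (hyx' : y * x' = -(x' * y)) :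
    ((x - y) * (x' - y') - x * x' * (y * y')) * (x' - y') = 0 := by
  have e1 : (x - y) * (x' - y') * (x' - y') = 0 := by
    rw [mul_assoc]
    simp [sub_mul, mul_sub, hxx, hyy, hyx]
  have e2 : x * x' * (y * y') * x' = 0 := by
    have h : Commute (y * y') x' := commute_mul_of_anticomm hyx' hyx
    rw [mul_assoc, h.eq, mul_assoc, ← mul_assoc x', hxx]; simp
  have e3 : x * x' * (y * y') * y' = 0 := by
    rw [mul_assoc, mul_assoc y, hyy]; simp
  rw [sub_mul, e1, mul_sub, e2, e3]; simp

/-! ### Edge operators and the contraction relation -/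

variable (R) in
/-- The fermionic operator of the edge `{u, v}`. -/
def edgeOp (u v : ℕ) : Module.End R (Fock R) :=
  (create R (2 * u) - create R (2 * v)) * (create R (2 * u + 1) - create R (2 * v + 1)) -
    create R (2 * u) * create R (2 * u + 1) * (create R (2 * v) * create R (2 * v + 1))

theorem sub_anticomm {A : Type*} [Ring A] {x y z : A} (hx : x * z = -(z * x))
    (hy : y * z = -(z * y)) : (x - y) * z = -(z * (x - y)) := by
  rw [sub_mul, hx, hy]; noncomm_ring

/-- Every term of an edge operator is a product of an even number of creation operators, and the
signs of moving past them cancel in pairs. -/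
theorem commute_edgeOp_create (u v p : ℕ) : Commute (edgeOp R u v) (create R p) := by
  have h := fun q => create_anticomm (R := R) q p
  exact (commute_mul_of_anticomm (sub_anticomm (h _) (h _)) (sub_anticomm (h _) (h _))).sub_left
    ((commute_mul_of_anticomm (h _) (h _)).mul_left (commute_mul_of_anticomm (h _) (h _)))

theorem commute_edgeOp_edgeOp (u v x y : ℕ) : Commute (edgeOp R u v) (edgeOp R x y) := by
  have h := fun q => commute_edgeOp_create (R := R) u v q
  exact (((h _).sub_right (h _)).mul_right ((h _).sub_right (h _))).sub_right
    (((h _).mul_right (h _)).mul_right ((h _).mul_right (h _)))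

theorem edgeOp_self (u : ℕ) : edgeOp R u u = 0 := by
  have : create R (2 * u) * create R (2 * u + 1) * (create R (2 * u) * create R (2 * u + 1)) = 0 := by
    exact mul_mul_mul_self_eq_zero (create_anticomm _ _) (create_mul_self _)
  rw [edgeOp, this]; simp

theorem edgeOp_symm (u v : ℕ) : edgeOp R u v = edgeOp R v u := by
  have h := fun q r => create_anticomm (R := R) q r
  have : Commute (create R (2 * u) * create R (2 * u + 1))
      (create R (2 * v) * create R (2 * v + 1)) :=
    (commute_mul_of_anticomm (h _ _) (h _ _)).mul_right (commute_mul_of_anticomm (h _ _) (h _ _))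
  rw [edgeOp, edgeOp, this.eq, sub_mul_sub_symm]

/-- In the presence of the edge operator the modes of its two ends are interchangeable:
algebraically, the edge is contracted. -/
theorem edgeOp_mul_create_even (u v : ℕ) :
    edgeOp R u v * create R (2 * u) = edgeOp R u v * create R (2 * v) := by
  rw [← sub_eq_zero, ← mul_sub]
  exact edge_relation_even (create_mul_self _) (create_mul_self _) (create_anticomm _ _)
    (create_anticomm _ _) (create_anticomm _ _) (create_anticomm _ _) (create_anticomm _ _)

theorem edgeOp_mul_create_odd (u v : ℕ) :
    edgeOp R u v * create R (2 * u + 1) = edgeOp R u v * create R (2 * v + 1) := by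
  rw [← sub_eq_zero, ← mul_sub]
  exact edge_relation_odd (create_mul_self _) (create_mul_self _) (create_anticomm _ _)
    (create_anticomm _ _)

/-- The operator of `{u, w}` is a polynomial in the modes of `u` and `w`. Each mode of `u` is
exchanged for one of `v`, carrying the commuting factor `edgeOp R u v` along. -/
theorem edgeOp_mul_edgeOp (u v w : ℕ) :
    edgeOp R u v * edgeOp R u w = edgeOp R u v * edgeOp R v w := by
  have c0 := fun p => (commute_edgeOp_create (R := R) u v p).eq
  have h0 := edgeOp_mul_create_even (R := R) u v
  have h1 := edgeOp_mul_create_odd (R := R) u v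
  have key : ∀ (a b : Module.End R (Fock R)) (A B : Module.End R (Fock R)),
      edgeOp R u v * a = edgeOp R u v * b → Commute (edgeOp R u v) b →
      edgeOp R u v * A = edgeOp R u v * B → edgeOp R u v * (a * A) = edgeOp R u v * (b * B) := by
    intro a b A B h hc h'
    rw [← mul_assoc, h, hc.eq, mul_assoc, h', ← mul_assoc, ← hc.eq, mul_assoc]
  have c := fun p => commute_edgeOp_create (R := R) u v p
  have s0 : edgeOp R u v * (create R (2 * u) - create R (2 * w)) =
      edgeOp R u v * (create R (2 * v) - create R (2 * w)) := by rw [mul_sub, mul_sub, h0]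
  have s1 : edgeOp R u v * (create R (2 * u + 1) - create R (2 * w + 1)) =
      edgeOp R u v * (create R (2 * v + 1) - create R (2 * w + 1)) := by rw [mul_sub, mul_sub, h1]
  rw [edgeOp.eq_1 R u w, edgeOp.eq_1 R v w, mul_sub, mul_sub (edgeOp R u v),
    key _ _ _ _ s0 ((c _).sub_right (c _)) s1,
    key _ _ _ _ (key _ _ _ _ h0 (c _) h1) ((c _).mul_right (c _)) rfl]

/-! ### Integrating out a vertex -/

variable (R) in
/-- Berezin integration of the two modes of `v` against `exp (ψ̄_v ψ_v)`. -/
def forget (v : ℕ) : Module.End R (Fock R) where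
  toFun a S := if 2 * v ∈ S ∨ 2 * v + 1 ∈ S then 0 else
    a S + a (insert (2 * v) (insert (2 * v + 1) S))
  map_add' a b := by
    ext S
    by_cases h : 2 * v ∈ S ∨ 2 * v + 1 ∈ S <;> simp [h]; ring
  map_smul' r a := by
    ext S
    by_cases h : 2 * v ∈ S ∨ 2 * v + 1 ∈ S <;> simp [h, mul_add]

theorem forget_apply (v : ℕ) (a : Fock R) (S : Finset ℕ) :
    forget R v a S = if 2 * v ∈ S ∨ 2 * v + 1 ∈ S then 0 else
      a S + a (insert (2 * v) (insert (2 * v + 1) S)) := rfl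

theorem forget_mul_self (v : ℕ) : forget R v * forget R v = forget R v := by
  ext a S
  simp only [Module.End.mul_apply, forget_apply]
  by_cases h : 2 * v ∈ S ∨ 2 * v + 1 ∈ S <;> simp [h]

theorem commute_forget_forget (u v : ℕ) : Commute (forget R u) (forget R v) := by
  by_cases huv : u = v
  · subst huv; exact Commute.refl _
  ext a S
  have h1 : (2 * u = 2 * v) = False := by simp; omega
  have h2 : (2 * u = 2 * v + 1) = False := by simp; omega
  have h3 : (2 * u + 1 = 2 * v) = False := by simp; omega
  have h4 : (2 * u + 1 = 2 * v + 1) = False := by simp; omega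
  have h5 : (2 * v = 2 * u) = False := by simp; omega
  have h6 : (2 * v = 2 * u + 1) = False := by simp; omega
  have h7 : (2 * v + 1 = 2 * u) = False := by simp; omega
  have h8 : (2 * v + 1 = 2 * u + 1) = False := by simp; omega
  simp only [Module.End.mul_apply, forget_apply, Finset.mem_insert, h1, h2, h3, h4, h5, h6, h7, h8,
    false_or]
  have : insert (2 * v) (insert (2 * v + 1) (insert (2 * u) (insert (2 * u + 1) S))) =
    insert (2 * u) (insert (2 * u + 1) (insert (2 * v) (insert (2 * v + 1) S))) := by
    ext x; simp only [Finset.mem_insert]; tauto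
  rw [this]
  by_cases h : 2 * u ∈ S ∨ 2 * u + 1 ∈ S <;> by_cases h' : 2 * v ∈ S ∨ 2 * v + 1 ∈ S <;>
    simp only [h, h', if_true, if_false, add_zero]
  ring

/-- The modes of `v` are adjacent, so both or neither lie below `p`, and inserting the pair leaves
the sign unchanged. -/
theorem commute_forget_create {v p : ℕ} (h0 : p ≠ 2 * v) (h1 : p ≠ 2 * v + 1) :
    Commute (forget R v) (create R p) := by
  ext a S
  simp only [Module.End.mul_apply, forget_apply, create_apply, Finset.mem_insert, Finset.mem_erase,
    h0, h1, h0.symm, h1.symm, ne_eq, not_false_eq_true, true_and, false_or]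
  by_cases h : 2 * v ∈ S ∨ 2 * v + 1 ∈ S
  · simp [h]
  by_cases hp : p ∈ S
  · simp only [h, hp, if_false, if_true, mul_add]
    push Not at h
    have e : (insert (2 * v) (insert (2 * v + 1) S)).erase p =
        insert (2 * v) (insert (2 * v + 1) (S.erase p)) := by
      rw [Finset.erase_insert_of_ne h0.symm, Finset.erase_insert_of_ne h1.symm]
    rw [e]
    congr 2
    by_cases hlt : 2 * v < p
    · have hlt' : 2 * v + 1 < p := by omega
      rw [Finset.filter_insert, if_pos hlt, Finset.filter_insert, if_pos hlt',
        Finset.card_insert_of_notMem (by simp [h]), Finset.card_insert_of_notMem (by simp [h]),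
        pow_add, pow_add]
      simp
    · have hlt' : ¬ 2 * v + 1 < p := by omega
      rw [Finset.filter_insert, if_neg hlt, Finset.filter_insert, if_neg hlt']
  · simp [h, hp]

theorem commute_forget_edgeOp {u v w : ℕ} (hu : u ≠ w) (hv : v ≠ w) :
    Commute (forget R w) (edgeOp R u v) := by
  have h : ∀ x, x ≠ w → ∀ i, i ≤ 1 → Commute (forget R w) (create R (2 * x + i)) :=
    fun x hx i hi => commute_forget_create (by omega) (by omega)
  have a0 := h u hu 0 (by simp)
  have a1 := h u hu 1 le_rfl
  have b0 := h v hv 0 (by simp)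
  have b1 := h v hv 1 le_rfl
  exact ((a0.sub_right b0).mul_right (a1.sub_right b1)).sub_right
    ((a0.mul_right a1).mul_right (b0.mul_right b1))

/-- The vector `a` does not involve the vertex `v`. -/
def FreeOf (v : ℕ) (a : Fock R) : Prop := ∀ S, (2 * v ∈ S ∨ 2 * v + 1 ∈ S) → a S = 0

theorem FreeOf.create {v p : ℕ} {a : Fock R} (h : FreeOf v a) (h0 : p ≠ 2 * v)
    (h1 : p ≠ 2 * v + 1) : FreeOf v (create R p a) := by
  intro S hS
  rw [create_apply, h _ (by simpa [h0.symm, h1.symm] using hS)]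
  simp

theorem FreeOf.forget_eq {v : ℕ} {a : Fock R} (h : FreeOf v a) : forget R v a = a := by
  ext S
  rw [forget_apply, h (insert _ _) (by simp)]
  split_ifs with hS
  · rw [h S hS]
  · simp

theorem FreeOf.forget_create_even {v : ℕ} {a : Fock R} (h : FreeOf v a) :
    forget R v (ForestCounting.create R (2 * v) a) = 0 := by
  ext S
  simp only [forget_apply, create_apply]
  split_ifs with h1 h2 h3 h3 <;> simp_all
  rw [h _ (by simp)]

theorem FreeOf.forget_create_odd {v : ℕ} {a : Fock R} (h : FreeOf v a) :
    forget R v (ForestCounting.create R (2 * v + 1) a) = 0 := by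
  ext S
  simp only [forget_apply, create_apply]
  split_ifs with h1 h2 h3 h3 <;> simp_all
  rw [h _ (by simp)]

theorem FreeOf.forget_create_create {v : ℕ} {a : Fock R} (h : FreeOf v a) :
    forget R v ((ForestCounting.create R (2 * v) * ForestCounting.create R (2 * v + 1)) a) = a := by
  ext S
  rw [forget_apply]
  split_ifs with hS
  · rw [h S hS]
  · push Not at hS
    rw [create_mul_create_of_lt (by simp), create_mul_create_of_lt (by simp), if_neg (by simp [hS])]
    have e : ((insert (2 * v) (insert (2 * v + 1) S)).erase (2 * v)).erase (2 * v + 1) = S := by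
      rw [Finset.erase_insert (by simp [hS]), Finset.erase_insert (by simp [hS])]
    have c : (Finset.filter (· < 2 * v + 1) (insert (2 * v) (insert (2 * v + 1) S))).card - 1 =
        (Finset.filter (· < 2 * v) (insert (2 * v) (insert (2 * v + 1) S))).card := by
      rw [Finset.filter_insert, if_pos (by simp), Finset.filter_insert, if_neg (by simp),
        Finset.card_insert_of_notMem (by simp [hS]), Nat.add_sub_cancel,
        Finset.filter_insert, if_neg (by simp), Finset.filter_insert, if_neg (by simp)]
      congr 1
      ext x
      simp only [Finset.mem_filter]
      constructor
      · rintro ⟨hx, hlt⟩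
        exact ⟨hx, lt_of_le_of_ne (by omega) (by rintro rfl; exact hS.1 hx)⟩
      · rintro ⟨hx, hlt⟩
        exact ⟨hx, by omega⟩
    rw [if_pos (by simp), e, c, ← mul_assoc, ← pow_add, Even.neg_one_pow ⟨_, rfl⟩]
    simp

/-- The mixed terms contain a single mode of `u` and integrate to zero; ψ̄_u ψ_u a gives a; and ψ̄_v
ψ_v a cancels against the quartic term, which is there for this purpose. -/
theorem FreeOf.forget_edgeOp {u v : ℕ} {a : Fock R} (h : FreeOf u a) (huv : u ≠ v) :
    forget R u (edgeOp R u v a) = a := by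
  have hy : Commute (forget R u) (ForestCounting.create R (2 * v)) :=
    commute_forget_create (by omega) (by omega)
  have hy' : Commute (forget R u) (ForestCounting.create R (2 * v + 1)) :=
    commute_forget_create (by omega) (by omega)
  have fy := h.create (p := 2 * v) (by omega) (by omega)
  have fy' := h.create (p := 2 * v + 1) (by omega) (by omega)
  have fyy' := fy'.create (p := 2 * v) (by omega) (by omega)
  have t1 := h.forget_create_create
  have t2 := fyy'.forget_eq
  have t3 := fy'.forget_create_even
  have t4 : forget R u (ForestCounting.create R (2 * v) (ForestCounting.create R (2 * u + 1) a)) = 0 := by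
    have := DFunLike.congr_fun hy.eq (ForestCounting.create R (2 * u + 1) a)
    simp only [Module.End.mul_apply] at this
    rw [this, h.forget_create_odd, map_zero]
  have t5 := fyy'.forget_create_create
  simp only [Module.End.mul_apply] at t1 t5
  simp only [edgeOp, LinearMap.sub_apply, Module.End.mul_apply, map_sub, t1, t2, t3, t4, t5]
  simp

/-! ### The full Berezin integral -/

/-- Integration over the vertices `0, …, n - 1`. -/
def integral : ℕ → Fock R → R
  | 0, a => a ∅
  | n + 1, a => integral n (forget R n a)

/-- Integrations over single vertices are commuting idempotents, so a vertex may be integrated out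
early without changing the total. -/
theorem integral_forget {n v : ℕ} (hv : v < n) (a : Fock R) :
    integral n (forget R v a) = integral n a := by
  induction n generalizing a with
  | zero => omega
  | succ n ih =>
    rw [integral, integral]
    by_cases h : v = n
    · subst h
      rw [← Module.End.mul_apply, forget_mul_self]
    · rw [← Module.End.mul_apply, (commute_forget_forget n v).eq, Module.End.mul_apply,
        ih (by omega)]

theorem integral_edgeOp_of_freeOf {n u v : ℕ} {a : Fock R} (hu : u < n) (h : FreeOf u a)
    (huv : u ≠ v) : integral n (edgeOp R u v a) = integral n a := by
  rw [← integral_forget hu, h.forget_edgeOp huv]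

theorem integral_add (n : ℕ) (a b : Fock R) : integral n (a + b) = integral n a + integral n b := by
  induction n generalizing a b with
  | zero => rfl
  | succ n ih => rw [integral, map_add, ih]; rfl

theorem integral_zero (n : ℕ) : integral n (0 : Fock R) = 0 := by
  induction n with
  | zero => rfl
  | succ n ih => rw [integral, map_zero, ih]

theorem integral_sum (n : ℕ) {ι : Type*} (s : Finset ι) (a : ι → Fock R) :
    integral n (∑ i ∈ s, a i) = ∑ i ∈ s, integral n (a i) := by
  classical
  induction s using Finset.induction_on with
  | empty => simp [integral_zero]
  | insert i s hi ih => rw [Finset.sum_insert hi, Finset.sum_insert hi, integral_add, ih]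

theorem integral_of_support {n : ℕ} {a : Fock R} (h : ∀ S, S ≠ ∅ → a S = 0) :
    integral n a = a ∅ := by
  induction n with
  | zero => rfl
  | succ n ih =>
    rw [integral, FreeOf.forget_eq, ih]
    intro S hS
    apply h
    rintro rfl
    simp at hS

variable (R) in
/-- The vacuum vector. -/
def vacuum : Fock R := fun S => if S = ∅ then 1 else 0

theorem integral_vacuum (n : ℕ) : integral n (vacuum R) = 1 := by
  rw [integral_of_support (by intro S hS; simp [vacuum, hS])]; simp [vacuum]

theorem freeOf_vacuum (v : ℕ) : FreeOf v (vacuum R) := by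
  intro S hS
  have : S ≠ ∅ := by rintro rfl; simp at hS
  simp [vacuum, this]

/-! ### The commutative algebra of the edge operators -/

variable (R) in
/-- The algebra generated by the edge operators. -/
abbrev EdgeAlg : Subalgebra R (Module.End R (Fock R)) :=
  Algebra.adjoin R (Set.range fun e : ℕ × ℕ => edgeOp R e.1 e.2)

/-- Commutativity of this subalgebra is what permits unordered products over finite sets of edges.
-/
instance : IsMulCommutative (EdgeAlg R) := by
  apply Algebra.isMulCommutative_adjoin
  rintro _ ⟨⟨u, v⟩, rfl⟩ _ ⟨⟨x, y⟩, rfl⟩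
  exact commute_edgeOp_edgeOp u v x y

open scoped IsMulCommutative in
instance : CommRing (EdgeAlg R) := inferInstance

variable (R) in
/-- The edge operator as an element of the commutative algebra. -/
def edgeElt (u v : ℕ) : EdgeAlg R := ⟨edgeOp R u v, Algebra.subset_adjoin ⟨(u, v), rfl⟩⟩

theorem edgeElt_self (u : ℕ) : edgeElt R u u = 0 := Subtype.ext (edgeOp_self u)

theorem edgeElt_symm (u v : ℕ) : edgeElt R u v = edgeElt R v u := Subtype.ext (edgeOp_symm u v)

theorem edgeElt_mul (u v w : ℕ) :
    edgeElt R u v * edgeElt R u w = edgeElt R u v * edgeElt R v w :=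
  Subtype.ext (edgeOp_mul_edgeOp u v w)

variable (R) in
/-- The element of the commutative algebra for an edge given as an unordered pair. -/
def symElt {n : ℕ} : Sym2 (Fin n) → EdgeAlg R :=
  Sym2.lift ⟨fun u v => edgeElt R u v, fun _ _ => edgeElt_symm _ _⟩

@[simp] theorem symElt_mk {n : ℕ} (u v : Fin n) : symElt R s(u, v) = edgeElt R u v := rfl

theorem freeOf_smul_mul {v : ℕ} {x y : EdgeAlg R}
    (hx : ∀ a : Fock R, FreeOf v a → FreeOf v (x.1 a))
    (hy : ∀ a : Fock R, FreeOf v a → FreeOf v (y.1 a)) :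
    ∀ a : Fock R, FreeOf v a → FreeOf v ((x * y).1 a) :=
  fun a ha => hx _ (hy a ha)

theorem FreeOf.sub {v : ℕ} {a b : Fock R} (ha : FreeOf v a) (hb : FreeOf v b) :
    FreeOf v (a - b) := fun S hS => by rw [Pi.sub_apply, ha S hS, hb S hS, sub_zero]

theorem FreeOf.edgeOp {u v w : ℕ} {a : Fock R} (ha : FreeOf w a) (hu : u ≠ w) (hv : v ≠ w) :
    FreeOf w (edgeOp R u v a) := by
  have h : ∀ x, x ≠ w → ∀ i, i ≤ 1 → ∀ a : Fock R, FreeOf w a →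
      FreeOf w (ForestCounting.create R (2 * x + i) a) :=
    fun x hx i hi a ha => ha.create (by omega) (by omega)
  have a0 := h u hu 0 (by simp)
  have a1 := h u hu 1 le_rfl
  have b0 := h v hv 0 (by simp)
  have b1 := h v hv 1 le_rfl
  simp only [ForestCounting.edgeOp, LinearMap.sub_apply, Module.End.mul_apply, map_sub]
  exact (((a0 _ (a1 _ ha)).sub (b0 _ (a1 _ ha))).sub
    ((a0 _ (b1 _ ha)).sub (b0 _ (b1 _ ha)))).sub (a0 _ (a1 _ (b0 _ (b1 _ ha))))

theorem freeOf_prod {n : ℕ} {w : Fin n} {X : Finset (Sym2 (Fin n))} (hX : ∀ e ∈ X, w ∉ e) :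
    ∀ a : Fock R, FreeOf (w : ℕ) a → FreeOf (w : ℕ) ((∏ e ∈ X, symElt R e).1 a) := by
  classical
  induction X using Finset.induction_on with
  | empty => intro a ha; simpa using ha
  | insert e X he ih =>
    rw [Finset.prod_insert he]
    refine freeOf_smul_mul (fun a ha => ?_) (ih fun e' he' => hX e' (Finset.mem_insert_of_mem he'))
    have hw := hX e (Finset.mem_insert_self _ _)
    induction e with
    | h u v =>
      simp only [Sym2.mem_iff, not_or] at hw
      exact ha.edgeOp (fun h => hw.1 (Fin.ext h.symm)) (fun h => hw.2 (Fin.ext h.symm))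

/-! ### Forests -/

/-- Slide the end `u` along a walk in `X`: each edge of the walk is a factor of the product, and the
contraction relation applies to that factor. -/
theorem mul_edgeElt_of_reachable {n : ℕ} {X : Finset (Sym2 (Fin n))} {u v : Fin n}
    (h : (SimpleGraph.fromEdgeSet (X : Set (Sym2 (Fin n)))).Reachable u v) (x : Fin n) :
    (∏ e ∈ X, symElt R e) * edgeElt R u x = (∏ e ∈ X, symElt R e) * edgeElt R v x := by
  classical
  obtain ⟨p⟩ := h
  induction p with
  | nil => rfl
  | cons hadj p ih =>
    rename_i a b c
    rw [← ih]
    have hm : s(a, b) ∈ X := by simpa using ((SimpleGraph.fromEdgeSet_adj _).mp hadj).1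
    rw [← Finset.mul_prod_erase _ _ hm, symElt_mk, mul_right_comm, edgeElt_mul, mul_right_comm]

/-- Take the first vertex of a longest path. Any neighbour other than the second vertex would extend
the path or close a cycle. -/
theorem exists_leaf {V : Type*} [Finite V] {G : SimpleGraph V} (hG : G.IsAcyclic) (hne : G ≠ ⊥) :
    ∃ u v, G.Adj u v ∧ ∀ w, G.Adj u w → w = v := by
  obtain ⟨a, b, hab⟩ := SimpleGraph.ne_bot_iff_exists_adj.mp hne
  have : Nonempty V := ⟨a⟩
  have hfin : Finite G.edgeSet := inferInstance
  obtain ⟨u, v, p, hp, hmax⟩ := SimpleGraph.Walk.exists_isPath_forall_isPath_length_le_length G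
  have hlen := hmax _ _ _ (SimpleGraph.Walk.IsPath.of_adj hab)
  have hnil : ¬p.Nil := by
    intro h
    rw [← SimpleGraph.Walk.length_eq_zero_iff] at h
    simp [h] at hlen
  refine ⟨u, _, p.adj_snd hnil, fun w hadj => ?_⟩
  apply hG.eq_snd_of_adj_start hp hadj
  have : ¬(p.cons hadj.symm).IsPath := by grind [SimpleGraph.Walk.length_cons]
  grind [hp.cons]

/-- Strip a leaf: no other edge meets it, so integrating it out first removes its factor, and the
remaining edge set is still acyclic. -/
theorem integral_prod_of_isAcyclic {n : ℕ} (X : Finset (Sym2 (Fin n)))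
    (hX : ∀ e ∈ X, ¬ e.IsDiag)
    (h : (SimpleGraph.fromEdgeSet (X : Set (Sym2 (Fin n)))).IsAcyclic) :
    integral n ((∏ e ∈ X, symElt R e).1 (vacuum R)) = 1 := by
  classical
  induction X using Finset.strongInduction with
  | H X ih =>
    by_cases hb : SimpleGraph.fromEdgeSet (X : Set (Sym2 (Fin n))) = ⊥
    · have : X = ∅ := by
        rw [Finset.eq_empty_iff_forall_notMem]
        intro e he
        induction e with
        | h u v =>
          have : (SimpleGraph.fromEdgeSet (X : Set (Sym2 (Fin n)))).Adj u v := by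
            simpa using ⟨he, hX _ he⟩
          simp [hb] at this
      subst this
      simp [integral_vacuum]
    · obtain ⟨u, v, huv, hleaf⟩ := exists_leaf h hb
      have hm : s(u, v) ∈ X := by simpa using ((SimpleGraph.fromEdgeSet_adj _).mp huv).1
      have hfree := freeOf_prod (R := R) (w := u) (X := X.erase s(u, v)) (by
        intro e he hu
        obtain ⟨w, rfl⟩ := Sym2.mem_iff_exists.mp hu
        have hmem := Finset.mem_of_mem_erase he
        have := hleaf w (by simpa using ⟨hmem, hX _ hmem⟩)
        subst this
        simp at he) _ (freeOf_vacuum _)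
      rw [← Finset.mul_prod_erase _ _ hm]
      have : integral n (edgeOp R u v ((∏ e ∈ X.erase s(u, v), symElt R e).1 (vacuum R))) = 1 := by
        rw [integral_edgeOp_of_freeOf u.2 hfree (fun h => huv.ne (Fin.ext h))]
        refine ih _ (Finset.erase_ssubset hm) (fun e he => hX e (Finset.mem_of_mem_erase he)) ?_
        exact h.anti (SimpleGraph.fromEdgeSet_mono (by simp))
      exact this

/-- Some edge `{u, v}` is not a bridge. The other edges connect `u` to `v`, so its factor can be
replaced by the one of a loop, which is zero. -/
theorem prod_eq_zero_of_not_isAcyclic {n : ℕ} (X : Finset (Sym2 (Fin n)))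
    (h : ¬ (SimpleGraph.fromEdgeSet (X : Set (Sym2 (Fin n)))).IsAcyclic) :
    ∏ e ∈ X, symElt R e = 0 := by
  classical
  rw [SimpleGraph.isAcyclic_iff_forall_adj_isBridge] at h
  push Not at h
  obtain ⟨u, v, hadj, hbr⟩ := h
  rw [SimpleGraph.isBridge_iff, not_not] at hbr
  have hm : s(u, v) ∈ X := by simpa using ((SimpleGraph.fromEdgeSet_adj _).mp hadj).1
  have hr : (SimpleGraph.fromEdgeSet ((X.erase s(u, v) : Finset _) : Set (Sym2 (Fin n)))).Reachable
      u v := by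
    refine hbr.mono ?_
    intro a b hab
    simp only [SimpleGraph.deleteEdges_adj, SimpleGraph.fromEdgeSet_adj] at hab
    simp only [SimpleGraph.fromEdgeSet_adj, Finset.coe_erase]
    exact ⟨⟨hab.1.1, hab.2⟩, hab.1.2⟩
  rw [← Finset.prod_erase_mul _ _ hm, symElt_mk, mul_edgeElt_of_reachable hr, edgeElt_self, mul_zero]

/-! ### The generating function of forests -/

variable (R) in
/-- The operator `∏ (1 + f_e)` over a set of edges. -/
def edgesProd {n : ℕ} (E : Finset (Sym2 (Fin n))) : Module.End R (Fock R) :=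
  (∏ e ∈ E, (1 + symElt R e)).1

theorem integral_edgesProd {n : ℕ} (G : SimpleGraph (Fin n)) [Fintype G.edgeSet] :
    integral n (edgesProd R G.edgeFinset (vacuum R)) = numForests G := by
  classical
  rw [edgesProd, Finset.prod_one_add]
  have : ((∑ X ∈ G.edgeFinset.powerset, ∏ e ∈ X, symElt R e : EdgeAlg R)).1 (vacuum R) =
      ∑ X ∈ G.edgeFinset.powerset, (∏ e ∈ X, symElt R e).1 (vacuum R) := by
    rw [AddSubmonoidClass.coe_finsetSum, LinearMap.sum_apply]
  rw [this, integral_sum]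
  have hterm : ∀ X ∈ G.edgeFinset.powerset,
      integral n ((∏ e ∈ X, symElt R e).1 (vacuum R)) =
        if (SimpleGraph.fromEdgeSet (X : Set (Sym2 (Fin n)))).IsAcyclic then 1 else 0 := by
    intro X hX
    split_ifs with h
    · refine integral_prod_of_isAcyclic X (fun e he => ?_) h
      exact G.not_isDiag_of_mem_edgeSet (by simpa using Finset.mem_powerset.mp hX he)
    · rw [prod_eq_zero_of_not_isAcyclic X h]
      exact integral_zero n
  rw [Finset.sum_congr rfl hterm, Finset.sum_boole, numForests]
  congr 1
  rw [← Set.ncard_coe_finset, ← Set.ncard_image_of_injective _ Finset.coe_injective]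
  congr 1
  ext Y
  simp only [Set.mem_image, Finset.coe_filter, Finset.mem_powerset, Set.mem_ofPred_eq]
  constructor
  · rintro ⟨X, ⟨hX, hac⟩, rfl⟩
    refine ⟨?_, hac⟩
    intro e he
    simpa using hX he
  · rintro ⟨hY, hac⟩
    refine ⟨(Set.toFinite Y).toFinset, ⟨?_, by simpa using hac⟩, by simp⟩
    intro e he
    simpa using hY (by simpa using he)

theorem edgesProd_insert {n : ℕ} {E : Finset (Sym2 (Fin n))} {u v : Fin n} (h : s(u, v) ∉ E)
    (a : Fock R) :
    edgesProd R (insert s(u, v) E) a = edgesProd R E (a + edgeOp R u v a) := by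
  classical
  rw [edgesProd, Finset.prod_insert h, mul_comm]
  rfl

/-- This is what makes dynamic programming possible: once no remaining edge meets `w`, integrating
it out commutes with all the work still to be done. -/
theorem edgesProd_forget {n : ℕ} {E : Finset (Sym2 (Fin n))} {w : Fin n} (h : ∀ e ∈ E, w ∉ e)
    (a : Fock R) :
    integral n (edgesProd R E (forget R w a)) = integral n (edgesProd R E a) := by
  classical
  have : Commute (forget R (w : ℕ)) (edgesProd R E) := by
    induction E using Finset.induction_on with
    | empty => simp [edgesProd]
    | insert e X he ih =>
      have hX := ih fun e' he' => h e' (Finset.mem_insert_of_mem he')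
      have hw := h e (Finset.mem_insert_self _ _)
      induction e with
      | h u v =>
        simp only [Sym2.mem_iff, not_or] at hw
        rw [edgesProd, Finset.prod_insert he]
        exact ((Commute.one_right _).add_right (commute_forget_edgeOp
          (fun h => hw.1 (Fin.ext h.symm)) (fun h => hw.2 (Fin.ext h.symm)))).mul_right hX
  rw [← Module.End.mul_apply, ← this.eq, Module.End.mul_apply, integral_forget w.2]

end Fermions

end ForestCounting
namespace ForestCounting

/-! ### A structured programming language with bounded loops -/

/-- The variables of structured programs. -/
inductive Var where
  | out | n | L | st | N | t | i | bag | q | w | a | b | v | flag | pa | pb | c | s | z | par | r | bit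
  deriving DecidableEq

/-- The register that holds a variable. -/
def Var.idx : Var → ℕ
  | .out => 0 | .n => 1 | .L => 2 | .st => 3 | .N => 4 | .t => 5 | .i => 6 | .bag => 7 | .q => 8
  | .w => 9 | .a => 10 | .b => 11 | .v => 12 | .flag => 13 | .pa => 14 | .pb => 15 | .c => 16
  | .s => 17 | .z => 18 | .par => 19 | .r => 20 | .bit => 21

theorem Var.idx_injective : Function.Injective Var.idx := by
  intro x y h
  cases x <;> cases y <;> first | rfl | (simp [Var.idx] at h)

/-- The registers from 32 on are scratch space for evaluating expressions and never collide with a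
variable. -/
theorem Var.idx_lt (x : Var) : x.idx < 32 := by
  cases x <;> simp [Var.idx]

/-- The states of structured programs. -/
@[ext] structure PState where
  reg : Var → ℕ
  mem : ℕ → ℕ

/-- Assign a value to a variable. -/
def PState.set (σ : PState) (x : Var) (k : ℕ) : PState := ⟨Function.update σ.reg x k, σ.mem⟩

/-- Write a value to a memory cell. -/
def PState.write (σ : PState) (a k : ℕ) : PState := ⟨σ.reg, Function.update σ.mem a k⟩

@[simp] theorem PState.set_mem (σ : PState) (x : Var) (k : ℕ) : (σ.set x k).mem = σ.mem := rfl

@[simp] theorem PState.write_reg (σ : PState) (a k : ℕ) : (σ.write a k).reg = σ.reg := rfl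

@[simp] theorem PState.set_reg (σ : PState) (x y : Var) (k : ℕ) :
    (σ.set x k).reg y = if y = x then k else σ.reg y := by
  simp [PState.set, Function.update_apply]

@[simp] theorem PState.write_mem (σ : PState) (a b k : ℕ) :
    (σ.write a k).mem b = if b = a then k else σ.mem b := by
  simp [PState.write, Function.update_apply]

/-- Arithmetic expressions. -/
inductive Expr where
  | lit (k : ℕ)
  | var (x : Var)
  | add (e f : Expr)
  | sub (e f : Expr)
  | mul (e f : Expr)
  | div (e f : Expr)
  | load (e : Expr)

instance : Add Expr := ⟨Expr.add⟩
instance : Sub Expr := ⟨Expr.sub⟩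
instance : Mul Expr := ⟨Expr.mul⟩
instance : Div Expr := ⟨Expr.div⟩
instance : Mod Expr := ⟨fun e f => e - f * (e / f)⟩
instance (k : ℕ) : OfNat Expr k := ⟨Expr.lit k⟩
instance : Coe Var Expr := ⟨Expr.var⟩

/-- The value of an expression. -/
def Expr.eval (σ : PState) : Expr → ℕ
  | lit k => k
  | var x => σ.reg x
  | add e f => e.eval σ + f.eval σ
  | sub e f => e.eval σ - f.eval σ
  | mul e f => e.eval σ * f.eval σ
  | div e f => e.eval σ / f.eval σ
  | load e => σ.mem (e.eval σ)

section
variable (σ : PState) (e f : Expr)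
@[simp] theorem Expr.eval_ofNat (k : ℕ) : Expr.eval σ ofNat(k) = k := rfl
@[simp] theorem Expr.eval_var (x : Var) : Expr.eval σ (.var x) = σ.reg x := rfl
@[simp] theorem Expr.eval_add : (e + f).eval σ = e.eval σ + f.eval σ := rfl
@[simp] theorem Expr.eval_sub : (e - f).eval σ = e.eval σ - f.eval σ := rfl
@[simp] theorem Expr.eval_mul : (e * f).eval σ = e.eval σ * f.eval σ := rfl
@[simp] theorem Expr.eval_div : (e / f).eval σ = e.eval σ / f.eval σ := rfl
@[simp] theorem Expr.eval_load : (Expr.load e).eval σ = σ.mem (e.eval σ) := rfl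
@[simp] theorem Expr.eval_mod : (e % f).eval σ = e.eval σ % f.eval σ :=
  (Nat.mod_def _ _).symm
end

/-- A bound for the length of the value of an expression, in units of the length of its inputs. -/
def Expr.mass : Expr → ℕ
  | lit k => k + 1
  | var _ => 1
  | add e f => e.mass + f.mass + 1
  | sub e f => e.mass + f.mass + 1
  | mul e f => e.mass + f.mass + 1
  | div e f => e.mass + f.mass + 1
  | load e => e.mass + 1

/-- A bound for the time needed to evaluate an expression. -/
def Expr.weight : Expr → ℕ
  | lit k => k + 1
  | var _ => 4
  | add e f => e.weight + f.weight + (1 + e.mass + f.mass)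
  | sub e f => e.weight + f.weight + (1 + e.mass + f.mass)
  | mul e f => e.weight + f.weight + (1 + e.mass + f.mass)
  | div e f => e.weight + f.weight + (1 + e.mass + f.mass)
  | load e => e.weight + (e.mass + 2)

/-- Structured programs. A loop over `x` runs its body with `x = k - 1, …, 1, 0` where `k` is the
initial value of `x`. -/
inductive Cmd where
  | assign (x : Var) (e : Expr)
  | store (e f : Expr)
  | seq (p p' : Cmd)
  | loop (x : Var) (p : Cmd)

/-- Iterate a program body over a decreasing loop variable. -/
def iterate (x : Var) (f : PState → PState) : ℕ → PState → PState
  | 0, σ => σ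
  | k + 1, σ => iterate x f k (f (σ.set x k))

/-- The final state of a program. -/
def Cmd.run : Cmd → PState → PState
  | assign x e, σ => σ.set x (e.eval σ)
  | store e f, σ => σ.write (e.eval σ) (f.eval σ)
  | seq p p', σ => p'.run (p.run σ)
  | loop x p, σ => iterate x p.run (σ.reg x) σ

/-- Sum a cost over the iterations of a loop. -/
def iterSteps (x : Var) (f : PState → PState) (g : PState → ℕ) : ℕ → PState → ℕ
  | 0, _ => 1
  | k + 1, σ => 1 + g (σ.set x k) + iterSteps x f g k (f (σ.set x k))

/-- The number of executed commands. -/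
def Cmd.steps : Cmd → PState → ℕ
  | assign _ _, _ => 1
  | store _ _, _ => 1
  | seq p p', σ => p.steps σ + p'.steps (p.run σ)
  | loop x p, σ => iterSteps x p.run p.steps (σ.reg x) σ

/-- A property of the states of a loop holds in all iterations. -/
def iterSafe (x : Var) (f : PState → PState) (g : PState → Prop) : ℕ → PState → Prop
  | 0, _ => True
  | k + 1, σ => g (σ.set x k) ∧ iterSafe x f g k (f (σ.set x k))

/-- All values assigned during the run are below `2 ^ W`. -/
def Cmd.Safe (W : ℕ) : Cmd → PState → Prop
  | assign _ e, σ => e.eval σ < 2 ^ W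
  | store _ f, σ => f.eval σ < 2 ^ W
  | seq p p', σ => p.Safe W σ ∧ p'.Safe W (p.run σ)
  | loop x p, σ => iterSafe x p.run (p.Safe W) (σ.reg x) σ

/-- The program may change the variable. -/
def Cmd.writes : Cmd → List Var
  | assign x _ => [x]
  | store _ _ => []
  | seq p p' => p.writes ++ p'.writes
  | loop x p => x :: p.writes

/-- No loop body changes its loop variable. -/
def Cmd.WellFormed : Cmd → Prop
  | assign _ _ => True
  | store _ _ => True
  | seq p p' => p.WellFormed ∧ p'.WellFormed
  | loop x p => x ∉ p.writes ∧ p.WellFormed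

theorem Cmd.run_reg_of_notMem_writes {p : Cmd} {σ : PState} {y : Var} (h : y ∉ p.writes) :
    (p.run σ).reg y = σ.reg y := by
  induction p generalizing σ with
  | assign x e => simp_all [writes, run]
  | store e f => simp [run]
  | seq p p' ih ih' =>
    simp only [writes, List.mem_append, not_or] at h
    rw [run, ih' h.2, ih h.1]
  | loop x p ih =>
    simp only [writes, List.mem_cons, not_or] at h
    rw [run]
    generalize σ.reg x = k
    induction k generalizing σ with
    | zero => rfl
    | succ k ihk => rw [iterate, ihk, ih h.2]; simp [h.1]

/-! ### Compilation -/

/-- The code evaluating an expression into register `d`, using the registers from `d` on. -/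
def Expr.code : ℕ → Expr → List Instr
  | d, lit k => [.const d k]
  | d, var x => [.const d 0, .add d d x.idx]
  | d, add e f => e.code d ++ f.code (d + 1) ++ [.add d d (d + 1)]
  | d, sub e f => e.code d ++ f.code (d + 1) ++ [.sub d d (d + 1)]
  | d, mul e f => e.code d ++ f.code (d + 1) ++ [.mul d d (d + 1)]
  | d, div e f => e.code d ++ f.code (d + 1) ++ [.div d d (d + 1)]
  | d, load e => e.code d ++ [.load d d]

/-- The length of the code of a program. -/
def Cmd.codeLength : Cmd → ℕ
  | assign _ e => (e.code 32).length + 2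
  | store e f => (e.code 32).length + (f.code 33).length + 1
  | seq p p' => p.codeLength + p'.codeLength
  | loop _ p => p.codeLength + 5

/-- The code of a program, starting at the address `l`. -/
def Cmd.code : ℕ → Cmd → List Instr
  | _, assign x e => e.code 32 ++ [.const 33 0, .add x.idx 32 33]
  | _, store e f => e.code 32 ++ f.code 33 ++ [.store 32 33]
  | l, seq p p' => p.code l ++ p'.code (l + p.codeLength)
  | l, loop x p => [.jz x.idx (l + p.codeLength + 5), .const 32 1, .sub x.idx x.idx 32] ++
      p.code (l + 3) ++ [.const 32 0, .jz 32 l]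

theorem Cmd.length_code (p : Cmd) (l : ℕ) : (p.code l).length = p.codeLength := by
  induction p generalizing l with
  | assign x e => simp [code, codeLength]
  | store e f => simp [code, codeLength, add_assoc]
  | seq p p' ih ih' => simp [code, codeLength, ih, ih']
  | loop x p ih => simp [code, codeLength, ih]

/-- `Reaches P c c' t`: started in `c`, the program `P` arrives at `c'` after time `t`. -/
inductive Reaches (P : Program) : Config → Config → ℕ → Prop
  | refl (c : Config) : Reaches P c c 0
  | step {c c' : Config} {i : Instr} {t : ℕ} (h : P[c.pc]? = some i)
      (hrest : Reaches P (i.exec c) c' t) : Reaches P c c' (i.cost c + t)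

theorem Reaches.trans {P : Program} {c c' c'' : Config} {t t' : ℕ} (h : Reaches P c c' t)
    (h' : Reaches P c' c'' t') : Reaches P c c'' (t + t') := by
  induction h with
  | refl => simpa using h'
  | step hi _ ih => rw [add_assoc]; exact .step hi (ih h')

theorem Reaches.single {P : Program} {c : Config} {i : Instr} (h : P[c.pc]? = some i) :
    Reaches P c (i.exec c) (i.cost c) := .step h (.refl _)

theorem Reaches.haltsIn {P : Program} {c c' : Config} {t : ℕ} (h : Reaches P c c' t)
    (h' : P[c'.pc]? = none) : HaltsIn P c c' t := by
  induction h with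
  | refl => exact .halt h'
  | step hi _ ih => exact .step hi (ih h')

/-- The code `l` stands in the program `P` at address `k`. -/
def CodeAt (P : Program) (k : ℕ) (l : List Instr) : Prop :=
  ∀ j (h : j < l.length), P[k + j]? = some l[j]

theorem CodeAt.left {P : Program} {k : ℕ} {l l' : List Instr} (h : CodeAt P k (l ++ l')) :
    CodeAt P k l := by
  intro j hj
  rw [h j (by simp; omega), List.getElem_append_left hj]

theorem CodeAt.right {P : Program} {k : ℕ} {l l' : List Instr} (h : CodeAt P k (l ++ l')) :
    CodeAt P (k + l.length) l' := by
  intro j hj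
  rw [add_assoc, h (l.length + j) (by simp; omega), List.getElem_append_right (by simp)]
  simp

theorem CodeAt.head {P : Program} {k : ℕ} {i : Instr} {l : List Instr} (h : CodeAt P k (i :: l)) :
    P[k]? = some i := h 0 (by simp)

theorem CodeAt.tail {P : Program} {k : ℕ} {i : Instr} {l : List Instr} (h : CodeAt P k (i :: l)) :
    CodeAt P (k + 1) l := CodeAt.right (l := [i]) h

/-- All values in the state are below `2 ^ W`. -/
def PState.Bounded (W : ℕ) (σ : PState) : Prop := (∀ x, σ.reg x < 2 ^ W) ∧ ∀ a, σ.mem a < 2 ^ W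

/-- Intermediate values may exceed `2 ^ W`, but an operation at most adds the lengths of its
operands and a carry bit. The length thus stays within a syntactic constant times `W + 1`. -/
theorem Expr.size_eval_le {W : ℕ} {σ : PState} (h : σ.Bounded W) (e : Expr) :
    (e.eval σ).size ≤ e.mass * (W + 1) := by
  have hadd : ∀ a b m m' : ℕ, a.size ≤ m * (W + 1) → b.size ≤ m' * (W + 1) →
      (a + b).size ≤ (m + m' + 1) * (W + 1) := by
    intro a b m m' ha hb
    rw [Nat.size_le] at *
    have h1 : 2 ^ (m * (W + 1)) ≤ 2 ^ ((m + m') * (W + 1)) :=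
      Nat.pow_le_pow_right (by simp) (Nat.mul_le_mul_right _ (by omega))
    have h2 : 2 ^ (m' * (W + 1)) ≤ 2 ^ ((m + m') * (W + 1)) :=
      Nat.pow_le_pow_right (by simp) (Nat.mul_le_mul_right _ (by omega))
    calc a + b < 2 ^ ((m + m') * (W + 1) + 1) := by rw [pow_succ]; omega
      _ ≤ _ := Nat.pow_le_pow_right (by simp) (by rw [add_mul (m + m')]; omega)
  have hle : ∀ a b m : ℕ, a ≤ b → b.size ≤ m → a.size ≤ m := fun a b m hab hb =>
    (Nat.size_le_size hab).trans hb
  have hmono : ∀ a m m' : ℕ, m ≤ m' → a ≤ m * (W + 1) → a ≤ m' * (W + 1) := fun a m m' h ha =>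
    ha.trans (Nat.mul_le_mul_right _ h)
  induction e with
  | lit k =>
    have : k.size ≤ k := Nat.size_le.mpr Nat.lt_two_pow_self
    calc k.size ≤ (k + 1) * 1 := by omega
      _ ≤ _ := Nat.mul_le_mul_left _ (by omega)
  | var x =>
    have := Nat.size_le.mpr (h.1 x)
    simp only [eval, mass]; omega
  | add e f ihe ihf => exact hadd _ _ _ _ ihe ihf
  | sub e f ihe ihf =>
    exact hle _ _ _ (Nat.sub_le _ _) (hmono _ _ _ (by simp only [mass]; omega) ihe)
  | mul e f ihe ihf =>
    refine hmono _ (e.mass + f.mass) _ (by simp only [mass]; omega) ?_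
    rw [Nat.size_le] at *
    rw [add_mul, pow_add]
    exact Nat.mul_lt_mul'' ihe ihf
  | div e f ihe ihf =>
    exact hle _ _ _ (Nat.div_le_self _ _) (hmono _ _ _ (by simp only [mass]; omega) ihe)
  | load e ih =>
    have := Nat.size_le.mpr (h.2 (e.eval σ))
    simp only [eval, mass, add_mul]; omega

/-- A configuration of the machine represents a state of a structured program. -/
def Represents (c : Config) (σ : PState) : Prop := (∀ x : Var, c.reg x.idx = σ.reg x) ∧ c.mem = σ.mem

/-- Induction on the expression. Registers below `d` are preserved, so the variables and a left
operand held in `d` survive the evaluation of the right operand from `d + 1` on. -/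
theorem Expr.code_reaches {W : ℕ} {σ : PState} (hσ : σ.Bounded W) {P : Program} (e : Expr)
    {d : ℕ} (hd : 32 ≤ d) {c : Config} (hc : Represents c σ) (hP : CodeAt P c.pc (e.code d)) :
    ∃ c' t, Reaches P c c' t ∧ t ≤ e.weight * (W + 1) ∧ c'.pc = c.pc + (e.code d).length ∧
      c'.mem = c.mem ∧ c'.reg d = e.eval σ ∧ ∀ y < d, c'.reg y = c.reg y := by
  have hbin : ∀ (op : ℕ → ℕ → ℕ → Instr) (g : ℕ → ℕ → ℕ) (e f : Expr) (d : ℕ) (c : Config),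
      (∀ c d a b, (op d a b).exec c = c.setReg d (g (c.reg a) (c.reg b))) →
      (∀ c d a b, (op d a b).cost c = 1 + (c.reg a).size + (c.reg b).size) →
      (∀ {d : ℕ}, 32 ≤ d → ∀ {c : Config}, Represents c σ → CodeAt P c.pc (e.code d) →
        ∃ c' t, Reaches P c c' t ∧ t ≤ e.weight * (W + 1) ∧ c'.pc = c.pc + (e.code d).length ∧
        c'.mem = c.mem ∧ c'.reg d = e.eval σ ∧ ∀ y < d, c'.reg y = c.reg y) →
      (∀ {d : ℕ}, 32 ≤ d → ∀ {c : Config}, Represents c σ → CodeAt P c.pc (f.code d) →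
        ∃ c' t, Reaches P c c' t ∧ t ≤ f.weight * (W + 1) ∧ c'.pc = c.pc + (f.code d).length ∧
        c'.mem = c.mem ∧ c'.reg d = f.eval σ ∧ ∀ y < d, c'.reg y = c.reg y) →
      32 ≤ d → Represents c σ →
      CodeAt P c.pc (e.code d ++ f.code (d + 1) ++ [op d d (d + 1)]) →
      ∃ c' t, Reaches P c c' t ∧
        t ≤ (e.weight + f.weight + (1 + e.mass + f.mass)) * (W + 1) ∧
        c'.pc = c.pc + (e.code d ++ f.code (d + 1) ++ [op d d (d + 1)]).length ∧
        c'.mem = c.mem ∧ c'.reg d = g (e.eval σ) (f.eval σ) ∧ ∀ y < d, c'.reg y = c.reg y := by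
    intro op g e f d c hexec hcost ihe ihf hd hc hP
    obtain ⟨c1, t1, r1, ht1, pc1, m1, v1, u1⟩ := ihe hd hc hP.left.left
    have hc1 : Represents c1 σ :=
      ⟨fun x => by rw [u1 _ (x.idx_lt.trans_le hd), hc.1], m1.trans hc.2⟩
    obtain ⟨c2, t2, r2, ht2, pc2, m2, v2, u2⟩ := ihf (Nat.le_succ_of_le hd) hc1
      (pc1 ▸ hP.left.right)
    have hi := hP.right.head
    rw [List.length_append, ← add_assoc, ← pc1, ← pc2] at hi
    refine ⟨_, _, (r1.trans r2).trans (.single hi), ?_, ?_, ?_, ?_, ?_⟩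
    · rw [hcost, u2 d (by omega), v1, v2]
      have h1 := e.size_eval_le hσ
      have h2 := f.size_eval_le hσ
      simp only [add_mul] at *
      omega
    · rw [hexec]; simp [Config.setReg, pc2, pc1]; ring
    · rw [hexec]; simp [Config.setReg, m2, m1]
    · rw [hexec]; simp [Config.setReg, u2 d, v1, v2]
    · intro y hy
      rw [hexec]; simp [Config.setReg, hy.ne, u2 y (by omega), u1 y hy]
  induction e generalizing d c with
  | lit k =>
    refine ⟨_, _, .single hP.head, ?_, rfl, rfl, ?_, ?_⟩
    · have : k.size ≤ k := Nat.size_le.mpr Nat.lt_two_pow_self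
      calc 1 + k.size ≤ (k + 1) * 1 := by omega
        _ ≤ _ := Nat.mul_le_mul_left _ (by omega)
    · simp [Instr.exec, Config.setReg, eval]
    · intro y hy
      simp [Instr.exec, Config.setReg, hy.ne]
  | var x =>
    have hx : x.idx ≠ d := (x.idx_lt.trans_le hd).ne
    refine ⟨_, _, (Reaches.single hP.head).trans (.single hP.tail.head), ?_, ?_, ?_, ?_, ?_⟩
    · have := Nat.size_le.mpr (hσ.1 x)
      simp [Instr.cost, Instr.exec, Config.setReg, weight, hx, hc.1]
      omega
    · simp [Instr.exec, Config.setReg, code]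
    · simp [Instr.exec, Config.setReg]
    · simp [Instr.exec, Config.setReg, hx, hc.1, eval]
    · intro y hy
      simp [Instr.exec, Config.setReg, hy.ne]
  | add e f ihe ihf =>
    exact hbin .add (· + ·) e f d c (fun _ _ _ _ => rfl) (fun _ _ _ _ => rfl) ihe ihf hd hc hP
  | sub e f ihe ihf =>
    exact hbin .sub (· - ·) e f d c (fun _ _ _ _ => rfl) (fun _ _ _ _ => rfl) ihe ihf hd hc hP
  | mul e f ihe ihf =>
    exact hbin .mul (· * ·) e f d c (fun _ _ _ _ => rfl) (fun _ _ _ _ => rfl) ihe ihf hd hc hP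
  | div e f ihe ihf =>
    exact hbin .div (· / ·) e f d c (fun _ _ _ _ => rfl) (fun _ _ _ _ => rfl) ihe ihf hd hc hP
  | load e ihe =>
    obtain ⟨c1, t1, r1, ht1, pc1, m1, v1, u1⟩ := ihe hd hc hP.left
    refine ⟨_, _, r1.trans (.single (i := .load d d) (pc1 ▸ hP.right.head)), ?_, ?_, ?_, ?_, ?_⟩
    · have h1 := e.size_eval_le hσ
      have h2 := Nat.size_le.mpr (hσ.2 (e.eval σ))
      rw [← hc.2, ← m1] at h2
      simp only [Instr.cost, v1, weight, add_mul] at *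
      omega
    · simp [Instr.exec, Config.setReg, pc1, code]; ring
    · simp [Instr.exec, Config.setReg, m1]
    · simp [Instr.exec, Config.setReg, v1, m1, hc.2, eval]
    · intro y hy
      simp [Instr.exec, Config.setReg, hy.ne, u1 y hy]

/-! ### Correctness and cost of compiled programs -/

/-- A bound for the time of one step of a program. -/
def Cmd.weight : Cmd → ℕ
  | assign _ e => e.weight + e.mass + 3
  | store e f => e.weight + f.weight + e.mass + f.mass + 1
  | seq p p' => p.weight + p'.weight
  | loop _ p => p.weight + 10

theorem PState.Bounded.set {W : ℕ} {σ : PState} (h : σ.Bounded W) {x : Var} {k : ℕ}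
    (hk : k < 2 ^ W) : (σ.set x k).Bounded W :=
  ⟨fun y => by rw [set_reg]; split_ifs; exacts [hk, h.1 y], h.2⟩

theorem PState.Bounded.write {W : ℕ} {σ : PState} (h : σ.Bounded W) {a k : ℕ}
    (hk : k < 2 ^ W) : (σ.write a k).Bounded W :=
  ⟨h.1, fun y => by rw [write_mem]; split_ifs; exacts [hk, h.2 y]⟩

theorem Represents.setReg {c : Config} {σ : PState} (h : Represents c σ) (x : Var) (k : ℕ) :
    Represents (c.setReg x.idx k) (σ.set x k) := by
  refine ⟨fun y => ?_, h.2⟩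
  simp only [Config.setReg, Function.update_apply, PState.set_reg, Var.idx_injective.eq_iff]
  split_ifs
  exacts [rfl, h.1 y]

theorem Represents.setReg_temp {c : Config} {σ : PState} (h : Represents c σ) {d : ℕ} (hd : 32 ≤ d)
    (k : ℕ) : Represents (c.setReg d k) σ := by
  refine ⟨fun y => ?_, h.2⟩
  simp only [Config.setReg, Function.update_apply, if_neg (y.idx_lt.trans_le hd).ne, h.1 y]

theorem Cmd.code_reaches {W : ℕ} {P : Program} (p : Cmd) (hwf : p.WellFormed) {σ : PState}
    (hσ : σ.Bounded W) (hs : p.Safe W σ) {c : Config} (hc : Represents c σ)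
    (hP : CodeAt P c.pc (p.code c.pc)) :
    ∃ c' t, Reaches P c c' t ∧ t ≤ p.weight * (W + 1) * p.steps σ ∧
      c'.pc = c.pc + p.codeLength ∧ Represents c' (p.run σ) ∧ (p.run σ).Bounded W := by
  induction p generalizing σ c with
  | assign x e =>
    obtain ⟨c1, t1, r1, ht1, pc1, m1, v1, u1⟩ := e.code_reaches hσ le_rfl hc hP.left
    have hc1 : Represents c1 σ := ⟨fun x => by rw [u1 _ x.idx_lt, hc.1], m1.trans hc.2⟩
    have h2 := hP.right
    rw [← pc1] at h2
    refine ⟨_, _, (r1.trans (.single h2.head)).trans (.single h2.tail.head), ?_, ?_, ?_, ?_⟩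
    · have h1 := e.size_eval_le hσ
      simp only [Instr.cost, Instr.exec, Config.setReg, weight, steps, add_mul, mul_one,
        Function.update_self, Nat.size_zero]
      rw [Function.update_of_ne (by simp), v1]
      omega
    · simp [Instr.exec, Config.setReg, pc1, codeLength]; ring
    · have : (Instr.add x.idx 32 33).exec ((Instr.const 33 0).exec c1) =
          ((c1.setReg 33 0).setReg x.idx (e.eval σ)) := by
        simp [Instr.exec, Config.setReg, v1]
      rw [this]
      exact (hc1.setReg_temp (by simp) 0).setReg x _
    · exact hσ.set hs
  | store e f =>
    obtain ⟨c1, t1, r1, ht1, pc1, m1, v1, u1⟩ := e.code_reaches hσ le_rfl hc hP.left.left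
    have hc1 : Represents c1 σ := ⟨fun x => by rw [u1 _ x.idx_lt, hc.1], m1.trans hc.2⟩
    obtain ⟨c2, t2, r2, ht2, pc2, m2, v2, u2⟩ := f.code_reaches hσ (d := 33) (by simp) hc1
      (pc1 ▸ hP.left.right)
    have hi := hP.right.head
    rw [List.length_append, ← add_assoc, ← pc1, ← pc2] at hi
    refine ⟨_, _, (r1.trans r2).trans (.single hi), ?_, ?_, ?_, ?_⟩
    · have h1 := e.size_eval_le hσ
      have h2 := f.size_eval_le hσ
      simp only [Instr.cost, u2 32 (by simp), v1, v2, weight, steps, add_mul, mul_one]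
      omega
    · simp [Instr.exec, pc2, pc1, codeLength]; ring
    · refine ⟨fun x => ?_, ?_⟩
      · simp [Instr.exec, run, u2 _ (x.idx_lt.trans (by simp : 32 < 33)), hc1.1]
      · simp [Instr.exec, run, u2 32 (by simp), v1, v2, m2, hc1.2, PState.write]
    · exact hσ.write hs
  | seq p p' ih ih' =>
    obtain ⟨c1, t1, r1, ht1, pc1, hc1, b1⟩ := ih hwf.1 hσ hs.1 hc hP.left
    have hP' := hP.right
    rw [Cmd.length_code, ← pc1] at hP'
    obtain ⟨c2, t2, r2, ht2, pc2, hc2, b2⟩ := ih' hwf.2 b1 hs.2 hc1 hP'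
    refine ⟨c2, _, r1.trans r2, ?_, ?_, hc2, b2⟩
    · simp only [weight, steps]
      calc t1 + t2 ≤ _ := add_le_add ht1 ht2
        _ ≤ (p.weight + p'.weight) * (W + 1) * p.steps σ +
          (p.weight + p'.weight) * (W + 1) * p'.steps (p.run σ) := by gcongr <;> omega
        _ = _ := by ring
    · rw [pc2, pc1, codeLength]; ring
  | loop x p ih =>
    -- Induction on the number of remaining iterations, always entered at the conditional jump that
    -- starts the loop.
    have key : ∀ (k : ℕ) (σ : PState) (c' : Config), c'.pc = c.pc → σ.reg x = k → σ.Bounded W →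
        iterSafe x p.run (p.Safe W) k σ → Represents c' σ →
        ∃ c'' t, Reaches P c' c'' t ∧
          t ≤ (p.weight + 10) * (W + 1) * iterSteps x p.run p.steps k σ ∧
          c''.pc = c.pc + (p.codeLength + 5) ∧ Represents c'' (iterate x p.run k σ) ∧
          (iterate x p.run k σ).Bounded W := by
      intro k
      induction k with
      | zero =>
        intro σ c' hpc hk hσ hs hc'
        have hi := hP.head
        rw [← hpc] at hi
        have hreg : c'.reg x.idx = 0 := by rw [hc'.1, hk]
        refine ⟨_, _, .single hi, ?_, ?_, ⟨fun y => ?_, ?_⟩, hσ⟩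
        · simp only [Instr.cost, hreg, iterSteps, Nat.size_zero]
          nlinarith [Nat.zero_le p.weight]
        · simp [Instr.exec, hreg, hpc, add_assoc]
        · exact hc'.1 y
        · exact hc'.2
      | succ k ihk =>
        intro σ c' hpc hk hσ hs hc'
        have hreg : c'.reg x.idx = k + 1 := by rw [hc'.1, hk]
        have hP0 : CodeAt P c.pc ([.jz x.idx (c.pc + p.codeLength + 5), .const 32 1,
          .sub x.idx x.idx 32] ++ p.code (c.pc + 3) ++ [.const 32 0, .jz 32 c.pc]) := hP
        have i1 := hP0.left.left.head
        have i2 := hP0.left.left.tail.head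
        have i3 := hP0.left.left.tail.tail.head
        have hx32 : x.idx ≠ 32 := x.idx_lt.ne
        have hkW : k < 2 ^ W := by have := hσ.1 x; omega
        let c1 : Config := ⟨c.pc + 1, c'.reg, c'.mem⟩
        let c2 : Config := c1.setReg 32 1
        let c3 : Config := c2.setReg x.idx k
        have e1 : (Instr.jz x.idx (c.pc + p.codeLength + 5)).exec c' = c1 := by
          simp [Instr.exec, hreg, c1, hpc]
        have e3 : (Instr.sub x.idx x.idx 32).exec c2 = c3 := by
          simp [Instr.exec, c3, c2, c1, Config.setReg, hx32, hreg]
        have r1 := Reaches.single (P := P) (c := c') (i := .jz x.idx (c.pc + p.codeLength + 5)) (by rw [hpc]; exact i1)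
        rw [e1] at r1
        have r2 : Reaches P c1 c2 _ := Reaches.single (c := c1) (i := .const 32 1) i2
        have r3 := Reaches.single (P := P) (c := c2) i3
        rw [e3] at r3
        have hc1 : Represents c1 σ := hc'
        have hc3 : Represents c3 (σ.set x k) := (hc1.setReg_temp (by simp) 1).setReg x k
        have hP3 : CodeAt P c3.pc (p.code c3.pc) := hP0.left.right
        obtain ⟨c4, t4, r4, ht4, pc4, hc4, b4⟩ := ih hwf.2 (hσ.set hkW) hs.1 hc3 hP3
        have hP4 := hP0.right
        rw [List.length_append, Cmd.length_code] at hP4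
        have pc4' : c4.pc = c.pc + (3 + p.codeLength) := by
          rw [pc4]; simp [c3, c2, c1, Config.setReg]; ring
        have i5 := hP4.head
        have i6 := hP4.tail.head
        simp only [List.length_cons, List.length_nil, Nat.reduceAdd, ← pc4'] at i5 i6
        let c5 : Config := c4.setReg 32 0
        have r5 : Reaches P c4 c5 _ := Reaches.single (c := c4) (i := .const 32 0) i5
        have r6 := Reaches.single (P := P) (c := c5) i6
        have hc5 : Represents c5 (p.run (σ.set x k)) := hc4.setReg_temp le_rfl 0
        have hc6 : Represents ((Instr.jz 32 c.pc).exec c5) (p.run (σ.set x k)) := hc5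
        obtain ⟨c7, t7, r7, ht7, pc7, hc7, b7⟩ := ihk _ ((Instr.jz 32 c.pc).exec c5)
          (by simp [Instr.exec, c5, Config.setReg])
          (by rw [Cmd.run_reg_of_notMem_writes hwf.1]; simp) b4 hs.2 hc6
        refine ⟨c7, _, (((((r1.trans r2).trans r3).trans r4).trans r5).trans r6).trans r7, ?_, pc7,
          hc7, b7⟩
        have hsz : (k + 1).size ≤ W := Nat.size_le.mpr (by rw [← hk]; exact hσ.1 x)
        have s1 : (Instr.jz x.idx (c.pc + p.codeLength + 5)).cost c' ≤ W + 1 := by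
          simp only [Instr.cost, hreg]; omega
        have s2 : (Instr.const 32 1).cost c1 = 2 := by simp [Instr.cost]
        have s3 : (Instr.sub x.idx x.idx 32).cost c2 ≤ W + 2 := by
          simp [Instr.cost, c2, c1, Config.setReg, hx32, hreg]; omega
        have s5 : (Instr.const 32 0).cost c4 = 1 := by simp [Instr.cost]
        have s6 : (Instr.jz 32 c.pc).cost c5 = 1 := by
          simp [Instr.cost, c5, Config.setReg]
        have : t4 ≤ (p.weight + 10) * (W + 1) * p.steps (σ.set x k) :=
          ht4.trans (by gcongr; omega)
        rw [s2, s5, s6, iterSteps, mul_add, mul_add, mul_one]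
        -- The test, the decrement and the jump back cost at most `2 * W + 7` per iteration; the
        -- summand 10 in the weight pays for them.
        have : 10 * (W + 1) ≤ (p.weight + 10) * (W + 1) := by gcongr; omega
        omega
    exact key (σ.reg x) σ c rfl rfl hσ hs hc

/-- The machine program of a structured program. -/
def Cmd.compile (p : Cmd) : Program := p.code 0

/-- The code is the whole program, so the simulated run ends just past its last instruction, and
there the machine halts. -/
theorem Cmd.compile_computes {W : ℕ} (p : Cmd) (hwf : p.WellFormed) {input : List ℕ}
    (hin : ∀ k ∈ input, k < 2 ^ W)
    (hs : p.Safe W ⟨fun _ => 0, fun i => input.getD i 0⟩) :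
    ∃ t, p.compile.Computes input ((p.run ⟨fun _ => 0, fun i => input.getD i 0⟩).reg .out) t ∧
      t ≤ p.weight * (W + 1) * p.steps ⟨fun _ => 0, fun i => input.getD i 0⟩ := by
  have hb : PState.Bounded W ⟨fun _ => 0, fun i => input.getD i 0⟩ := by
    refine ⟨fun _ => by simp, fun a => ?_⟩
    simp only [List.getD_eq_getElem?_getD]
    cases h : input[a]? with
    | none => simp
    | some k => exact hin k (List.mem_of_getElem? h)
  obtain ⟨c', t, r, ht, hpc, hc, -⟩ := p.code_reaches (P := p.compile) hwf hb hs
    (c := initConfig input) ⟨fun _ => rfl, rfl⟩ (by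
      intro j hj
      simp only [initConfig, zero_add] at hj ⊢
      exact List.getElem?_eq_getElem hj)
  refine ⟨t, ⟨c', r.haltsIn ?_, hc.1 .out⟩, ht⟩
  rw [hpc, List.getElem?_eq_none]
  simp [compile, Cmd.length_code, initConfig]

/-! ### Reasoning about structured programs -/

/-- Total correctness of a run with bounds for the values and the number of steps. -/
structure Ok (W : ℕ) (p : Cmd) (σ : PState) (T : ℕ) (Q : PState → Prop) : Prop where
  safe : p.Safe W σ
  steps_le : p.steps σ ≤ T
  post : Q (p.run σ)

section

variable {W : ℕ} {p p' : Cmd} {σ : PState} {T T' : ℕ} {Q Q' : PState → Prop}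

theorem Ok.mono (h : Ok W p σ T Q) (hT : T ≤ T') (hQ : ∀ τ, Q τ → Q' τ) : Ok W p σ T' Q' :=
  ⟨h.safe, h.steps_le.trans hT, hQ _ h.post⟩

/-- The postcondition may use that unassigned variables keep their values. -/
theorem Ok.frame (h : Ok W p σ T Q)
    (hQ : ∀ τ, Q τ → (∀ y, y ∉ p.writes → τ.reg y = σ.reg y) → Q' τ) : Ok W p σ T Q' :=
  ⟨h.safe, h.steps_le, hQ _ h.post fun _ hy => Cmd.run_reg_of_notMem_writes hy⟩

theorem Ok.assign {x : Var} {e : Expr} (he : e.eval σ < 2 ^ W) (hQ : Q (σ.set x (e.eval σ))) :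
    Ok W (.assign x e) σ 1 Q := ⟨he, le_rfl, hQ⟩

theorem Ok.store {e f : Expr} (he : f.eval σ < 2 ^ W) (hQ : Q (σ.write (e.eval σ) (f.eval σ))) :
    Ok W (.store e f) σ 1 Q := ⟨he, le_rfl, hQ⟩

theorem Ok.seq (h : Ok W p σ T fun τ => Ok W p' τ T' Q) : Ok W (.seq p p') σ (T + T') Q :=
  ⟨⟨h.safe, h.post.safe⟩, add_le_add h.steps_le h.post.steps_le, h.post.post⟩

/-- `Inv j` describes the state with `j` iterations still to come, so an iteration with loop value
`k` leads from `Inv (k + 1)` to `Inv k`. The frame condition is available in every iteration. -/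
theorem Ok.loop {x : Var} (Inv : ℕ → PState → Prop) (h0 : Inv (σ.reg x) σ)
    (hstep : ∀ k < σ.reg x, ∀ τ, Inv (k + 1) τ → (∀ y, y ∉ x :: p.writes → τ.reg y = σ.reg y) →
      Ok W p (τ.set x k) T (Inv k))
    (hT : 1 + σ.reg x * (1 + T) ≤ T')
    (hQ : ∀ τ, Inv 0 τ → (∀ y, y ∉ x :: p.writes → τ.reg y = σ.reg y) → Q τ) :
    Ok W (.loop x p) σ T' Q := by
  have key : ∀ k ≤ σ.reg x, ∀ τ, Inv k τ → (∀ y, y ∉ x :: p.writes → τ.reg y = σ.reg y) →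
      iterSafe x p.run (p.Safe W) k τ ∧ iterSteps x p.run p.steps k τ ≤ 1 + k * (1 + T) ∧
        Q (iterate x p.run k τ) := by
    intro k
    induction k with
    | zero => exact fun _ τ hτ hy => ⟨trivial, by simp [iterSteps], hQ τ hτ hy⟩
    | succ k ih =>
      intro hk τ hτ hy
      have hb := hstep k hk τ hτ hy
      obtain ⟨h1, h2, h3⟩ := ih (by omega) _ hb.post (fun y hn => by
        have hn' := hn
        simp only [List.mem_cons, not_or] at hn'
        rw [Cmd.run_reg_of_notMem_writes hn'.2, PState.set_reg, if_neg hn'.1, hy y hn])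
      refine ⟨⟨hb.safe, h1⟩, ?_, h3⟩
      rw [iterSteps]
      have := hb.steps_le
      linarith
  obtain ⟨h1, h2, h3⟩ := key _ le_rfl σ h0 fun _ _ => rfl
  exact ⟨h1, h2.trans hT, h3⟩

end

end ForestCounting
namespace ForestCounting

/-! ### Numbers encoding sets of modes -/

/-- The number whose binary digits indicate a finite set. -/
def enc (S : Finset ℕ) : ℕ := ∑ p ∈ S, 2 ^ p

theorem enc_lt {S : Finset ℕ} {m : ℕ} (h : ∀ p ∈ S, p < m) : enc S < 2 ^ m :=
  Nat.geomSum_lt le_rfl h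

theorem enc_erase {S : Finset ℕ} {p : ℕ} (h : p ∈ S) : enc (S.erase p) = enc S - 2 ^ p := by
  have := Finset.add_sum_erase S (fun p => 2 ^ p) h
  simp only [enc] at *
  omega

theorem enc_insert {S : Finset ℕ} {p : ℕ} (h : p ∉ S) : enc (insert p S) = enc S + 2 ^ p := by
  rw [enc, Finset.sum_insert h, add_comm]; rfl

theorem enc_injective : Function.Injective enc := fun S T h => by
  rw [← Finset.toFinset_bitIndices_sum_two_pow S, ← Finset.toFinset_bitIndices_sum_two_pow T]
  exact congrArg (fun m => (Nat.bitIndices m).toFinset) h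

theorem enc_div_mod_two (S : Finset ℕ) (p : ℕ) :
    enc S / 2 ^ p % 2 = if p ∈ S then 1 else 0 := by
  have h1 : enc S = enc (S.filter (· < p)) + 2 ^ p * ∑ i ∈ S.filter (¬ · < p), 2 ^ (i - p) := by
    rw [enc, ← Finset.sum_filter_add_sum_filter_not S (· < p), enc, Finset.mul_sum]
    congr 1
    refine Finset.sum_congr rfl fun i hi => ?_
    rw [← pow_add]
    congr 1
    have := (Finset.mem_filter.mp hi).2
    omega
  have h2 : enc (S.filter (· < p)) < 2 ^ p := enc_lt (by simp)
  rw [h1, Nat.add_mul_div_left _ _ (by positivity), Nat.div_eq_of_lt h2, zero_add,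
    Finset.sum_nat_mod]
  have h3 : ∀ i ∈ S.filter (¬ · < p), 2 ^ (i - p) % 2 = if i = p then 1 else 0 := by
    intro i hi
    have := (Finset.mem_filter.mp hi).2
    split_ifs with h
    · simp [h]
    · obtain ⟨k, hk⟩ := Nat.exists_eq_add_of_lt (by omega : p < i)
      rw [hk, show p + k + 1 - p = k + 1 by omega, pow_succ]
      omega
  rw [Finset.sum_congr rfl h3, Finset.sum_ite_eq']
  simp only [Finset.mem_filter, lt_self_iff_false, not_false_eq_true, and_true]
  split_ifs <;> rfl

/-- Spread the base-4 digits of `z` over the positions in `B` below `j`, in front of the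
digits `s`. -/
def spread (B : Finset ℕ) : ℕ → ℕ → ℕ → ℕ
  | 0, s, _ => s
  | j + 1, s, z => if j ∈ B then spread B j (4 * s + z % 4) (z / 4) else spread B j (4 * s) z

/-- The prefix only grows, so a bound on the final value also bounds all intermediate values of a
decoding loop. -/
theorem le_spread (B : Finset ℕ) (j s z : ℕ) : s ≤ spread B j s z := by
  induction j generalizing s z with
  | zero => exact le_rfl
  | succ j ih =>
    rw [spread]
    split_ifs
    · exact le_trans (by omega) (ih _ _)
    · exact le_trans (by omega) (ih _ _)

theorem spread_lt (B : Finset ℕ) (j s z : ℕ) : spread B j s z < 4 ^ j * (s + 1) := by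
  induction j generalizing s z with
  | zero => simp [spread]
  | succ j ih =>
    have h : ∀ d < 4, ∀ z, spread B j (4 * s + d) z < 4 ^ (j + 1) * (s + 1) := by
      intro d hd z
      calc _ < 4 ^ j * (4 * s + d + 1) := ih _ _
        _ ≤ 4 ^ j * (4 * (s + 1)) := Nat.mul_le_mul_left _ (by omega)
        _ = _ := by ring
    rw [spread]
    split_ifs
    · exact h _ (Nat.mod_lt _ (by simp)) _
    · exact h 0 (by simp) _

/-- Surjectivity of the enumeration: the sets of modes over a bag are indexed sparsely by numbers up
to `4 ^ n`, yet they are all reached from only `4 ^ B.card` codes. -/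
theorem exists_spread_eq (B : Finset ℕ) (j : ℕ) {S : Finset ℕ}
    (h : ∀ p ∈ S, p / 2 ∈ B ∧ p / 2 < j) :
    ∃ z < 4 ^ (B.filter (· < j)).card, ∀ s, spread B j s z = 4 ^ j * s + enc S := by
  induction j generalizing S with
  | zero =>
    have : S = ∅ := Finset.eq_empty_of_forall_notMem fun p hp => by simpa using (h p hp).2
    exact ⟨0, by simp, fun s => by simp [spread, this, enc]⟩
  | succ j ih =>
    by_cases hj : j ∈ B
    · obtain ⟨z, hz, hs⟩ := ih (S := (S.erase (2 * j)).erase (2 * j + 1)) (by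
        intro p hp
        simp only [Finset.mem_erase] at hp
        obtain ⟨h1, h2⟩ := h p hp.2.2
        exact ⟨h1, by omega⟩)
      obtain ⟨d, hd, he⟩ : ∃ d < 4, enc S = 4 ^ j * d + enc ((S.erase (2 * j)).erase (2 * j + 1)) := by
        have e : ∀ (T : Finset ℕ) p, ∃ d < 2, enc T = 2 ^ p * d + enc (T.erase p) := by
          intro T p
          by_cases hp : p ∈ T
          · exact ⟨1, by simp, by rw [mul_one]; exact (Finset.add_sum_erase T _ hp).symm⟩
          · exact ⟨0, by simp, by rw [Finset.erase_eq_of_notMem hp]; simp⟩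
        obtain ⟨d, hd, h1⟩ := e S (2 * j)
        obtain ⟨d', hd', h2⟩ := e (S.erase (2 * j)) (2 * j + 1)
        refine ⟨d + 2 * d', by omega, ?_⟩
        rw [h1, h2, pow_succ, pow_mul]; norm_num; ring
      -- The lowest digit of the code is consumed first, at the highest position, so the digit `d`
      -- of vertex `j` is appended at the low end.
      refine ⟨4 * z + d, ?_, fun s => ?_⟩
      · have : B.filter (· < j + 1) = insert j (B.filter (· < j)) := by
          ext x
          simp only [Finset.mem_filter, Finset.mem_insert]
          constructor
          · rintro ⟨h1, h2⟩
            by_cases hx : x = j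
            · exact .inl hx
            · exact .inr ⟨h1, by omega⟩
          · rintro (rfl | ⟨h1, h2⟩)
            · exact ⟨hj, by omega⟩
            · exact ⟨h1, by omega⟩
        rw [this, Finset.card_insert_of_notMem (by simp), pow_succ]
        omega
      · rw [spread, if_pos hj, show (4 * z + d) % 4 = d by omega, show (4 * z + d) / 4 = z by omega,
          hs, he]
        ring
    · obtain ⟨z, hz, hs⟩ := ih (S := S) (by
        intro p hp
        obtain ⟨h1, h2⟩ := h p hp
        exact ⟨h1, lt_of_le_of_ne (by omega) (by rintro h3; exact hj (h3 ▸ h1))⟩)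
      refine ⟨z, hz.trans_le (Nat.pow_le_pow_right (by simp) (Finset.card_le_card ?_)), fun s => ?_⟩
      · intro x hx
        simp only [Finset.mem_filter] at *
        exact ⟨hx.1, by omega⟩
      · rw [spread, if_neg hj, hs]; ring

/-! ### Explicit form of the operators -/

section Explicit

variable {R : Type*} [CommRing R]

/-- The sign of the modes strictly between `p` and `q`. -/
def between (S : Finset ℕ) (p q : ℕ) : ℕ := (S.filter fun r => p < r ∧ r < q).card

theorem card_filter_lt_of_mem {S : Finset ℕ} {p q : ℕ} (hp : p ∈ S) (h : p < q) :
    (S.filter (· < q)).card = (S.filter (· < p)).card + between S p q + 1 := by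
  have : S.filter (· < q) = insert p (S.filter (· < p) ∪ S.filter fun r => p < r ∧ r < q) := by
    ext x
    simp only [Finset.mem_filter, Finset.mem_insert, Finset.mem_union]
    constructor
    · rintro ⟨h1, h2⟩
      rcases lt_trichotomy x p with h3 | h3 | h3
      · exact .inr (.inl ⟨h1, h3⟩)
      · exact .inl h3
      · exact .inr (.inr ⟨h1, h3, h2⟩)
    · rintro (rfl | ⟨h1, h2⟩ | ⟨h1, h2, h3⟩)
      · exact ⟨hp, h⟩
      · exact ⟨h1, h2.trans h⟩
      · exact ⟨h1, h3⟩
  rw [this, Finset.card_insert_of_notMem (by simp), Finset.card_union_of_disjoint, between]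
  rw [Finset.disjoint_filter]
  intro x _ h1 h2
  omega

/-- Modes below `p` enter both signs and cancel; only those strictly between `p` and `q` remain. -/
theorem create_create_apply_of_lt {p q : ℕ} (h : p < q) (a : Fock R) (S : Finset ℕ) :
    create R p (create R q a) S =
      if p ∈ S ∧ q ∈ S then (-1) ^ between S p q * a ((S.erase p).erase q) else 0 := by
  have := create_mul_create_of_lt h a S
  rw [Module.End.mul_apply] at this
  rw [this]
  split_ifs with hS
  · rw [card_filter_lt_of_mem hS.1 h, Nat.add_sub_cancel, ← mul_assoc, ← pow_add, ← add_assoc,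
      pow_add, Even.neg_one_pow ⟨_, rfl⟩, one_mul]
  · rfl

theorem create_create_apply_of_gt {p q : ℕ} (h : p < q) (a : Fock R) (S : Finset ℕ) :
    create R q (create R p a) S =
      if p ∈ S ∧ q ∈ S then -(-1) ^ between S p q * a ((S.erase p).erase q) else 0 := by
  have := DFunLike.congr_fun (create_anticomm (R := R) q p) a
  rw [LinearMap.neg_apply, Module.End.mul_apply, Module.End.mul_apply] at this
  rw [this, Pi.neg_apply, create_create_apply_of_lt h]
  split_ifs <;> ring

theorem between_succ (S : Finset ℕ) (p : ℕ) : between S p (p + 1) = 0 := by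
  rw [between, Finset.card_eq_zero, Finset.filter_eq_empty_iff]
  intro x _ h
  omega

/-- Reduces the sign of the outer pair of modes to that of the inner pair, so one parity per state
serves both mixed terms of an edge. -/
theorem between_outer (S : Finset ℕ) {a b : ℕ} (h : a < b) :
    between S (2 * a) (2 * b + 1) = (if 2 * a + 1 ∈ S then 1 else 0) + (if 2 * b ∈ S then 1 else 0) +
      between S (2 * a + 1) (2 * b) := by
  have : S.filter (fun r => 2 * a < r ∧ r < 2 * b + 1) =
      (S.filter (· = 2 * a + 1) ∪ S.filter (· = 2 * b)) ∪
        S.filter fun r => 2 * a + 1 < r ∧ r < 2 * b := by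
    ext x
    simp only [Finset.mem_filter, Finset.mem_union]
    constructor
    · rintro ⟨h1, h2, h3⟩
      rcases Nat.lt_or_ge (2 * a + 1) x with h4 | h4
      · rcases Nat.lt_or_ge x (2 * b) with h5 | h5
        · exact .inr ⟨h1, h4, h5⟩
        · exact .inl (.inr ⟨h1, by omega⟩)
      · exact .inl (.inl ⟨h1, by omega⟩)
    · rintro ((⟨h1, h2⟩ | ⟨h1, h2⟩) | ⟨h1, h2⟩)
      all_goals exact ⟨h1, by omega, by omega⟩
  rw [between, this, Finset.card_union_of_disjoint, Finset.card_union_of_disjoint, between,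
    Finset.filter_eq', Finset.filter_eq']
  · congr 2 <;> split_ifs <;> simp
  · rw [Finset.disjoint_filter]; intro x _ h1 h2; omega
  · rw [Finset.disjoint_left]
    intro x hx hx'
    simp only [Finset.mem_union, Finset.mem_filter] at hx hx'
    omega

theorem edgeOp_apply {a b : ℕ} (h : a < b) (α : Fock R) (S : Finset ℕ) :
    edgeOp R a b α S =
      (if 2 * a ∈ S ∧ 2 * a + 1 ∈ S then α ((S.erase (2 * a)).erase (2 * a + 1)) else 0) +
      (if 2 * b ∈ S ∧ 2 * b + 1 ∈ S then α ((S.erase (2 * b)).erase (2 * b + 1)) else 0) -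
      (if (2 * a ∈ S ∧ 2 * a + 1 ∈ S) ∧ (2 * b ∈ S ∧ 2 * b + 1 ∈ S) then
        α ((((S.erase (2 * a)).erase (2 * a + 1)).erase (2 * b)).erase (2 * b + 1)) else 0) -
      (if 2 * a ∈ S ∧ 2 * b + 1 ∈ S then
        (-1) ^ ((if 2 * a + 1 ∈ S then 1 else 0) + (if 2 * b ∈ S then 1 else 0) +
          between S (2 * a + 1) (2 * b)) * α ((S.erase (2 * a)).erase (2 * b + 1)) else 0) +
      (if 2 * a + 1 ∈ S ∧ 2 * b ∈ S then
        (-1) ^ between S (2 * a + 1) (2 * b) * α ((S.erase (2 * a + 1)).erase (2 * b)) else 0) := by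
  simp only [edgeOp, LinearMap.sub_apply, Module.End.mul_apply, map_sub, Pi.sub_apply]
  rw [create_create_apply_of_lt (by omega : 2 * a < 2 * a + 1),
    create_create_apply_of_lt (by omega : 2 * b < 2 * b + 1),
    create_create_apply_of_lt (by omega : 2 * a < 2 * b + 1),
    create_create_apply_of_gt (by omega : 2 * a + 1 < 2 * b),
    create_create_apply_of_lt (by omega : 2 * a < 2 * a + 1),
    create_create_apply_of_lt (by omega : 2 * b < 2 * b + 1), between_succ, between_succ,
    between_succ, between_outer _ h]
  have m1 : ∀ T : Finset ℕ, (2 * b ∈ (T.erase (2 * a)).erase (2 * a + 1)) ↔ 2 * b ∈ T := by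
    intro T; simp only [Finset.mem_erase]; constructor
    · exact fun h => h.2.2
    · exact fun h => ⟨by omega, by omega, h⟩
  have m2 : ∀ T : Finset ℕ, (2 * b + 1 ∈ (T.erase (2 * a)).erase (2 * a + 1)) ↔ 2 * b + 1 ∈ T := by
    intro T; simp only [Finset.mem_erase]; constructor
    · exact fun h => h.2.2
    · exact fun h => ⟨by omega, by omega, h⟩
  simp only [m1, m2, pow_zero, one_mul, neg_mul]
  by_cases h1 : 2 * a ∈ S <;> by_cases h2 : 2 * a + 1 ∈ S <;> by_cases h3 : 2 * b ∈ S <;>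
    by_cases h4 : 2 * b + 1 ∈ S <;>
    simp only [h1, h2, h3, h4, and_true, and_false, if_true, if_false] <;> ring

/-! ### Supports of vectors -/

/-- The vector `α` only involves vertices in `B`. -/
def SupportedOn (B : Finset ℕ) (α : Fock R) : Prop := ∀ S, α S ≠ 0 → ∀ p ∈ S, p / 2 ∈ B

theorem SupportedOn.create {B : Finset ℕ} {α : Fock R} (h : SupportedOn B α) {p : ℕ}
    (hp : p / 2 ∈ B) : SupportedOn B (create R p α) := by
  intro S hS r hr
  rw [create_apply] at hS
  by_cases hrp : r = p
  · exact hrp ▸ hp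
  · split_ifs at hS with h1
    · exact h _ (right_ne_zero_of_mul hS) r (Finset.mem_erase.mpr ⟨hrp, hr⟩)
    · exact absurd rfl hS

theorem SupportedOn.add {B : Finset ℕ} {α β : Fock R} (h : SupportedOn B α)
    (h' : SupportedOn B β) : SupportedOn B (α + β) := by
  intro S hS
  by_cases h0 : α S = 0
  · exact h' S fun h1 => hS (by simp [h0, h1])
  · exact h S h0

theorem SupportedOn.sub {B : Finset ℕ} {α β : Fock R} (h : SupportedOn B α)
    (h' : SupportedOn B β) : SupportedOn B (α - β) := by
  intro S hS
  by_cases h0 : α S = 0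
  · exact h' S fun h1 => hS (by simp [h0, h1])
  · exact h S h0

theorem SupportedOn.edgeOp {B : Finset ℕ} {α : Fock R} (h : SupportedOn B α) {a b : ℕ}
    (ha : a ∈ B) (hb : b ∈ B) : SupportedOn B (edgeOp R a b α) := by
  have ha0 : 2 * a / 2 ∈ B := by rwa [show 2 * a / 2 = a by omega]
  have ha1 : (2 * a + 1) / 2 ∈ B := by rwa [show (2 * a + 1) / 2 = a by omega]
  have hb0 : 2 * b / 2 ∈ B := by rwa [show 2 * b / 2 = b by omega]
  have hb1 : (2 * b + 1) / 2 ∈ B := by rwa [show (2 * b + 1) / 2 = b by omega]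
  simp only [ForestCounting.edgeOp, LinearMap.sub_apply, Module.End.mul_apply, map_sub]
  exact ((((h.create ha1).create ha0).sub ((h.create ha1).create hb0)).sub
    (((h.create hb1).create ha0).sub ((h.create hb1).create hb0))).sub
    ((((h.create hb1).create hb0).create ha1).create ha0)

theorem SupportedOn.forget {B : Finset ℕ} {α : Fock R} (h : SupportedOn B α) (v : ℕ) :
    SupportedOn B (forget R v α) := by
  intro S hS p hp
  rw [forget_apply] at hS
  split_ifs at hS with h1
  · exact absurd rfl hS
  · by_cases h0 : α S = 0
    · exact h (insert (2 * v) (insert (2 * v + 1) S)) (fun h2 => hS (by simp [h0, h2])) p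
        (by simp [hp])
    · exact h S h0 p hp

theorem freeOf_forget (v : ℕ) (α : Fock R) : FreeOf v (forget R v α) := by
  intro S hS
  rw [forget_apply, if_pos hS]

theorem FreeOf.forget {u : ℕ} {α : Fock R} (h : FreeOf u α) (v : ℕ) :
    FreeOf u (forget R v α) := by
  intro S hS
  rw [forget_apply, h S hS, h (insert _ _) (by simp only [Finset.mem_insert]; tauto)]
  simp

end Explicit

/-! ### Numerical form of the operators modulo `N` -/

/-- A sign without negative numbers: the expression is 1 for even `k` and `N - 1`, which is -1
modulo `N`, for odd `k`. -/
theorem neg_one_pow_cast {N : ℕ} (hN : 2 ≤ N) (k : ℕ) :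
    ((1 + k % 2 * (N - 2) : ℕ) : ZMod N) = (-1) ^ k := by
  rcases Nat.mod_two_eq_zero_or_one k with h | h
  · rw [h, Even.neg_one_pow (Nat.even_iff.mpr h)]; simp
  · rw [h, Odd.neg_one_pow (Nat.odd_iff.mpr h)]
    push_cast [Nat.cast_sub hN]
    simp
    ring

/-- The new value of the cell `m` when the edge `{a, b}` with `pa = 4 ^ a` and `pb = 4 ^ b` is
processed. -/
def edgeValue (N pa pb par : ℕ) (cell : ℕ → ℕ) (m : ℕ) : ℕ :=
  (cell m + m / pa % 2 * (m / (2 * pa) % 2) * cell (m - 3 * pa) +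
    m / pb % 2 * (m / (2 * pb) % 2) * cell (m - 3 * pb) +
    (N - 1) * (m / pa % 2 * (m / (2 * pa) % 2) * (m / pb % 2 * (m / (2 * pb) % 2)) *
      cell (m - 3 * pa - 3 * pb)) +
    (1 + (1 + (m / (2 * pa) % 2 + m / pb % 2 + par)) % 2 * (N - 2)) *
      (m / pa % 2 * (m / (2 * pb) % 2) * cell (m - pa - 2 * pb)) +
    (1 + par % 2 * (N - 2)) *
      (m / (2 * pa) % 2 * (m / pb % 2) * cell (m - 2 * pa - pb))) % N

/-- Binary digits serve as indicators. If a mode is absent, the truncated subtraction may address a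
meaningless cell, but the digit multiplies it by zero. The extra `1 +` inside the first parity is
the minus sign of that mixed term. -/
theorem edgeValue_eq {N : ℕ} (hN : 2 ≤ N) {cell : ℕ → ℕ} {α : Fock (ZMod N)}
    (h : ∀ S, (cell (enc S) : ZMod N) = α S) {a b : ℕ} (hab : a < b) (S : Finset ℕ) {par : ℕ}
    (hpar : par = between S (2 * a + 1) (2 * b) % 2) :
    (edgeValue N (4 ^ a) (4 ^ b) par cell (enc S) : ZMod N) = (α + edgeOp (ZMod N) a b α) S := by
  have e0 : ∀ v, 4 ^ v = 2 ^ (2 * v) := fun v => by rw [pow_mul]; norm_num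
  have e1 : ∀ v, 2 * 4 ^ v = 2 ^ (2 * v + 1) := fun v => by rw [e0, pow_succ]; ring
  have e3 : ∀ v m, m - 3 * 4 ^ v = m - 2 ^ (2 * v) - 2 ^ (2 * v + 1) := fun v m => by
    rw [← e1, ← e0]; omega
  have hs := neg_one_pow_cast hN par
  have hs' := fun x y : ℕ => neg_one_pow_cast hN (1 + (x + y + par))
  have hpp : ((-1) ^ par : ZMod N) = (-1) ^ between S (2 * a + 1) (2 * b) := by
    rw [hpar, ← neg_one_pow_eq_pow_mod_two]
  have c1 : 2 * a ∈ S → 2 * a + 1 ∈ S → (cell (enc S - 3 * 4 ^ a) : ZMod N) =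
      α ((S.erase (2 * a)).erase (2 * a + 1)) := by
    intro h1 h2
    rw [← h, enc_erase (by simp [h2]), enc_erase h1, e3]
  have c2 : 2 * b ∈ S → 2 * b + 1 ∈ S → (cell (enc S - 3 * 4 ^ b) : ZMod N) =
      α ((S.erase (2 * b)).erase (2 * b + 1)) := by
    intro h1 h2
    rw [← h, enc_erase (by simp [h2]), enc_erase h1, e3]
  have c3 : 2 * a ∈ S → 2 * a + 1 ∈ S → 2 * b ∈ S → 2 * b + 1 ∈ S →
      (cell (enc S - 3 * 4 ^ a - 3 * 4 ^ b) : ZMod N) =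
      α ((((S.erase (2 * a)).erase (2 * a + 1)).erase (2 * b)).erase (2 * b + 1)) := by
    intro h1 h2 h3 h4
    rw [← h, enc_erase, enc_erase, enc_erase, enc_erase h1, e3, e3] <;>
      simp only [Finset.mem_erase]
    · exact ⟨by omega, h2⟩
    · exact ⟨by omega, by omega, h3⟩
    · exact ⟨by omega, by omega, by omega, h4⟩
  have c4 : 2 * a ∈ S → 2 * b + 1 ∈ S → (cell (enc S - 4 ^ a - 2 * 4 ^ b) : ZMod N) =
      α ((S.erase (2 * a)).erase (2 * b + 1)) := by
    intro h1 h2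
    rw [← h, enc_erase (by simp only [Finset.mem_erase]; exact ⟨by omega, h2⟩), enc_erase h1,
      e0 a, e1]
  have c5 : 2 * a + 1 ∈ S → 2 * b ∈ S → (cell (enc S - 2 * 4 ^ a - 4 ^ b) : ZMod N) =
      α ((S.erase (2 * a + 1)).erase (2 * b)) := by
    intro h1 h2
    rw [← h, enc_erase (by simp only [Finset.mem_erase]; exact ⟨by omega, h2⟩), enc_erase h1,
      e0 b, e1]
  rw [Pi.add_apply, edgeOp_apply hab, edgeValue, ZMod.natCast_mod, Nat.cast_add, Nat.cast_add,
    Nat.cast_add, Nat.cast_add, Nat.cast_add, h]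
  rw [Nat.cast_mul (1 + par % 2 * (N - 2)), hs, Nat.cast_mul (1 + _ % 2 * (N - 2)), hs',
    Nat.cast_mul (N - 1), Nat.cast_sub (by omega)]
  have b0 : ∀ v, enc S / 4 ^ v % 2 = if 2 * v ∈ S then 1 else 0 := fun v => by
    rw [e0, enc_div_mod_two]
  have b1 : ∀ v, enc S / (2 * 4 ^ v) % 2 = if 2 * v + 1 ∈ S then 1 else 0 := fun v => by
    rw [e1, enc_div_mod_two]
  simp only [b0, b1]
  have hN0 : ((N : ℕ) : ZMod N) - ((1 : ℕ) : ZMod N) = -1 := by simp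
  rw [hN0]
  simp only [pow_add, hpp]
  by_cases h1 : 2 * a ∈ S <;> by_cases h2 : 2 * a + 1 ∈ S <;> by_cases h3 : 2 * b ∈ S <;>
    by_cases h4 : 2 * b + 1 ∈ S <;> simp [h1, h2, h3, h4, c1, c2, c3, c4, c5] <;> ring

/-- The new value of the cell `m` when the vertex `v` with `pa = 4 ^ v` is integrated out. -/
def forgetValue (N pa : ℕ) (cell : ℕ → ℕ) (m : ℕ) : ℕ :=
  ((1 - m / pa % 2) * (1 - m / (2 * pa) % 2) * (cell m + cell (m + 3 * pa))) % N

theorem forgetValue_eq {N : ℕ} {cell : ℕ → ℕ} {α : Fock (ZMod N)}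
    (h : ∀ S, (cell (enc S) : ZMod N) = α S) (v : ℕ) (S : Finset ℕ) :
    (forgetValue N (4 ^ v) cell (enc S) : ZMod N) = forget (ZMod N) v α S := by
  have e0 : 4 ^ v = 2 ^ (2 * v) := by rw [pow_mul]; norm_num
  have e1 : 2 * 4 ^ v = 2 ^ (2 * v + 1) := by rw [e0, pow_succ]; ring
  rw [forgetValue, ZMod.natCast_mod, forget_apply, e1, e0, enc_div_mod_two, enc_div_mod_two]
  by_cases h1 : 2 * v ∈ S <;> by_cases h2 : 2 * v + 1 ∈ S <;> simp [h1, h2]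
  rw [h, ← h (insert _ _), enc_insert (by simp [h1]), enc_insert h2, ← e1, ← e0]
  congr 3
  ring

theorem edgeValue_lt {N : ℕ} (hN : 0 < N) (pa pb par : ℕ) (cell : ℕ → ℕ) (m : ℕ) :
    edgeValue N pa pb par cell m < N := Nat.mod_lt _ hN

theorem forgetValue_lt {N : ℕ} (hN : 0 < N) (pa : ℕ) (cell : ℕ → ℕ) (m : ℕ) :
    forgetValue N pa cell m < N := Nat.mod_lt _ hN

end ForestCounting
namespace ForestCounting

/-! ### Building blocks of the program -/

instance : Append Cmd := ⟨Cmd.seq⟩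

theorem Ok.append {W : ℕ} {p p' : Cmd} {σ : PState} {T T' : ℕ} {Q : PState → Prop}
    (h : Ok W p σ T fun τ => Ok W p' τ T' Q) : Ok W (p ++ p') σ (T + T') Q := h.seq

theorem Cmd.writes_append (p p' : Cmd) : (p ++ p').writes = p.writes ++ p'.writes := rfl

/-- Set `x` to the power of `k` with exponent `y`. -/
def powCmd (x y : Var) (k : ℕ) : Cmd :=
  .assign x 1 ++ .loop y (.assign x (.lit k * x))

theorem powCmd_ok {W : ℕ} {σ : PState} {x y : Var} {k m : ℕ} (hxy : x ≠ y) (hk : 1 ≤ k)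
    (hm : σ.reg y = m) (hW : k ^ m < 2 ^ W) :
    Ok W (powCmd x y k) σ (2 + 2 * m) fun τ =>
      τ.reg x = k ^ m ∧ τ.mem = σ.mem ∧ ∀ u, u ≠ x → u ≠ y → τ.reg u = σ.reg u := by
  have h1 : 1 ≤ k ^ m := Nat.one_le_pow _ _ hk
  refine Ok.mono (T := 1 + (1 + 2 * m)) (Ok.append (Ok.assign (by simp only [Expr.eval_ofNat]; omega) ?_))
    (by omega) fun _ => id
  simp only [Expr.eval_ofNat]
  have hy : (σ.set x 1).reg y = m := by simp [hxy.symm, hm]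
  refine Ok.loop (T := 1) (fun j τ => τ.reg x = k ^ (m - j) ∧ τ.mem = σ.mem) ?_ ?_ ?_ ?_
  · rw [hy]; simp
  · rintro j hj τ ⟨h2, h3⟩ -
    rw [hy] at hj
    have e : (Expr.lit k * (x : Expr)).eval (τ.set y j) = k ^ (m - j) := by
      change k * (τ.set y j).reg x = _
      simp only [PState.set_reg, if_neg hxy, h2]
      rw [show m - j = m - (j + 1) + 1 by omega, pow_succ, mul_comm]
    refine Ok.assign ?_ ?_
    · rw [e]
      exact lt_of_le_of_lt (Nat.pow_le_pow_right hk (by omega)) hW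
    · rw [e]; simp [h3]
  · rw [hy]; omega
  · rintro τ ⟨h2, h3⟩ h4
    refine ⟨h2, h3, fun u hu hu' => ?_⟩
    rw [h4 u (by simp [Cmd.writes, hu, hu'])]
    simp [hu]

/-- The bag at the current address is the set `B`. -/
def BagAt (B : Finset ℕ) (σ : PState) : Prop :=
  ∀ w < σ.reg .n, σ.mem (σ.reg .bag + w) = if w ∈ B then 1 else 0

open Var ForestCounting.Expr in
/-- Spread the digits of `c` over the positions in the current bag. -/
def decodeCmd : Cmd :=
  .assign s 0 ++ (.assign z c ++ (.assign w n ++ .loop w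
    (.assign bit (load (bag + w)) ++ (.assign s (4 * s + bit * (z % 4)) ++
      .assign z (z / (1 + 3 * bit))))))

/-- The downward loop follows the recursion of `spread`. The divisor `1 + 3 * bit` is 4 or 1, so a
digit is consumed exactly at the vertices of the bag. -/
theorem decodeCmd_ok {W : ℕ} {σ : PState} {B : Finset ℕ} {n : ℕ} (hn : σ.reg .n = n)
    (hB : BagAt B σ) (hnW : n < 2 ^ W) (hW : 4 ^ n ≤ 2 ^ W) (hc : σ.reg .c < 4 ^ n) :
    Ok W decodeCmd σ (4 + 4 * n) fun τ =>
      τ.reg .s = spread B n 0 (σ.reg .c) ∧ τ.mem = σ.mem ∧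
        ∀ y, y ∉ [Var.s, .z, .w, .bit] → τ.reg y = σ.reg y := by
  have hlt := spread_lt B n 0 (σ.reg .c)
  have hpos : 0 < 4 ^ n := by positivity
  refine Ok.frame (T := 1 + (1 + (1 + (1 + 4 * n))))
    (Q := fun τ => τ.reg .s = spread B n 0 (σ.reg .c) ∧ τ.mem = σ.mem) ?_ ?_ |>.mono (by omega)
      fun _ => id
  · refine Ok.append (Ok.assign (by simp) ?_)
    refine Ok.append (Ok.assign (by simp; omega) ?_)
    refine Ok.append (Ok.assign (by simp [hn]; omega) ?_)
    refine Ok.loop (T := 3) (fun j τ => spread B j (τ.reg .s) (τ.reg .z) = spread B n 0 (σ.reg .c) ∧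
      τ.reg .z ≤ σ.reg .c ∧ τ.mem = σ.mem) ?_ ?_ ?_ ?_
    · simp [hn]
    · rintro j hj τ ⟨h1, h2, h3⟩ h4
      simp [hn] at hj
      have e1 : τ.reg .bag = σ.reg .bag := by rw [h4 _ (by decide)]; simp
      have hbit := hB j (by omega)
      have h5 := le_spread B (j + 1) (τ.reg .s) (τ.reg .z)
      refine Ok.mono (T := 1 + (1 + 1)) ?_ (by omega) fun _ => id
      refine Ok.append (Ok.assign ?_ ?_)
      · simp [e1, h3, hbit]
        split_ifs <;> omega
      refine Ok.append (Ok.assign ?_ ?_)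
      · simp [e1, h3, hbit]
        rw [spread] at h1
        split_ifs at h1 ⊢
        · have := le_spread B j (4 * τ.reg .s + τ.reg .z % 4) (τ.reg .z / 4)
          simp; omega
        · have := le_spread B j (4 * τ.reg .s) (τ.reg .z)
          simp; omega
      refine Ok.assign ?_ ?_
      · refine lt_of_le_of_lt (?_ : _ ≤ τ.reg .z) (by omega)
        simp only [Expr.eval_div, Expr.eval_var, PState.set_reg]
        exact Nat.div_le_self _ _
      · simp [e1, h3, hbit]
        rw [spread] at h1
        split_ifs at h1 ⊢
        · simp; exact ⟨h1, by omega⟩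
        · simp; exact ⟨h1, by omega⟩
    · simp [hn]; omega
    · rintro τ ⟨h1, h2, h3⟩ h4
      exact ⟨h1, h3⟩
  · rintro τ ⟨h1, h2⟩ h3
    refine ⟨h1, h2, fun y hy => h3 y ?_⟩
    simp at hy
    simp [decodeCmd, Cmd.writes_append, Cmd.writes, hy]

theorem between_succ_right (S : Finset ℕ) {p q : ℕ} (h : p < q) :
    between S p (q + 1) = between S p q + if q ∈ S then 1 else 0 := by
  have : S.filter (fun r => p < r ∧ r < q + 1) =
      (S.filter fun r => p < r ∧ r < q) ∪ S.filter (· = q) := by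
    ext x
    simp only [Finset.mem_filter, Finset.mem_union]
    constructor
    · rintro ⟨h1, h2, h3⟩
      by_cases hx : x = q
      · exact .inr ⟨h1, hx⟩
      · exact .inl ⟨h1, h2, by omega⟩
    · rintro (⟨h1, h2, h3⟩ | ⟨h1, rfl⟩)
      · exact ⟨h1, h2, by omega⟩
      · exact ⟨h1, h, by omega⟩
  rw [between, this, Finset.card_union_of_disjoint, between, Finset.filter_eq']
  · split_ifs <;> simp
  · rw [Finset.disjoint_filter]; intro x _ h1 h2; omega

open Var ForestCounting.Expr in
/-- Compute the parity of the number of modes between the vertices `a` and `b`. -/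
def parityCmd : Cmd :=
  .assign par 0 ++ (.assign t (4 * pa) ++ (.assign r (2 * (b - 1 - a)) ++ .loop r
    (.assign par ((par + s / t) % 2) ++ .assign t (2 * t))))

/-- There are `2 * (b - 1 - a)` modes strictly between `2 * a + 1` and `2 * b`, and `4 * pa` is the
place value of the first. With `j` iterations left, the next mode is `2 * b - j`. -/
theorem parityCmd_ok {W : ℕ} {σ : PState} {S : Finset ℕ} {a b : ℕ} (ha : σ.reg .a = a)
    (hb : σ.reg .b = b) (hab : a < b) (hpa : σ.reg .pa = 4 ^ a) (hs : σ.reg .s = enc S)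
    (hW : 4 ^ (b + 1) ≤ 2 ^ W) :
    Ok W parityCmd σ (4 + 6 * b) fun τ =>
      τ.reg .par = between S (2 * a + 1) (2 * b) % 2 ∧ τ.mem = σ.mem ∧
        ∀ y, y ∉ [Var.par, .t, .r] → τ.reg y = σ.reg y := by
  have hb2 : 2 * b < 2 ^ (2 * b) := Nat.lt_two_pow_self
  have h4 : ∀ v, 4 ^ v = 2 ^ (2 * v) := fun v => by rw [pow_mul]; norm_num
  rw [h4] at hW
  have hbW : 2 ^ (2 * b) < 2 ^ W :=
    lt_of_lt_of_le (Nat.pow_lt_pow_right (by simp) (by omega)) hW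
  have hlt : ∀ k, k ≤ 2 * b → 2 ^ k < 2 ^ W := fun k hk =>
    lt_of_le_of_lt (Nat.pow_le_pow_right (by simp) hk) hbW
  have e0 : 4 * 4 ^ a = 2 ^ (2 * a + 2) := by rw [h4, pow_succ, pow_succ]; ring
  have h1W : 1 < 2 ^ W := hlt 0 (by simp)
  refine Ok.frame (T := 1 + (1 + (1 + (1 + 6 * b))))
    (Q := fun τ => τ.reg .par = between S (2 * a + 1) (2 * b) % 2 ∧ τ.mem = σ.mem) ?_ ?_
      |>.mono (by omega) fun _ => id
  · refine Ok.append (Ok.assign (by simp) ?_)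
    refine Ok.append (Ok.assign (by simp [hpa, e0]; exact hlt _ (by omega)) ?_)
    refine Ok.append (Ok.assign (by simp [ha, hb]; omega) ?_)
    refine Ok.loop (T := 2) (fun j τ =>
      τ.reg .par = between S (2 * a + 1) (2 * b - j) % 2 ∧ τ.reg .t = 2 ^ (2 * b - j) ∧
        τ.mem = σ.mem) ?_ ?_ ?_ ?_
    · simp [ha, hb, hpa, e0, show 2 * b - 2 * (b - 1 - a) = 2 * a + 2 by omega]
      rw [show 2 * a + 2 = (2 * a + 1) + 1 by rfl, between_succ]
    · rintro j hj τ ⟨h1, h2, h3⟩ h5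
      simp [ha, hb] at hj
      have hs' : τ.reg .s = enc S := by rw [h5 _ (by decide)]; simp [hs]
      refine Ok.mono (T := 1 + 1) ?_ (by omega) fun _ => id
      refine Ok.append (Ok.assign ?_ ?_)
      · simp only [Expr.eval_mod, Expr.eval_ofNat]
        omega
      have e1 : 2 * 2 ^ (2 * b - (j + 1)) = 2 ^ (2 * b - j) := by
        rw [← pow_succ', show 2 * b - (j + 1) + 1 = 2 * b - j by omega]
      refine Ok.assign ?_ ?_
      · simp [h2, e1]
        exact hlt _ (by omega)
      · simp [h1, h2, h3, hs', e1]
        have := enc_div_mod_two S (2 * b - (j + 1))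
        rw [show 2 * b - j = 2 * b - (j + 1) + 1 by omega, between_succ_right _ (by omega),
          ← this]
        omega
    · simp [ha, hb]; omega
    · rintro τ ⟨h1, h2, h3⟩ -
      exact ⟨h1, h3⟩
  · rintro τ ⟨h1, h2⟩ h3
    refine ⟨h1, h2, fun y hy => h3 y ?_⟩
    simp at hy
    simp [parityCmd, Cmd.writes_append, Cmd.writes, hy]

open Var ForestCounting.Expr in
/-- The cell of the state array with index `e`. -/
def cellExpr (e : Expr) : Expr := load (st + 2 * e)

open Var ForestCounting.Expr in
/-- Compute the new value of the cell `s` for the edge `{a, b}`. -/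
def edgeCmd : Cmd :=
  parityCmd ++ .store (st + 2 * s + 1)
    ((cellExpr s + s / pa % 2 * (s / (2 * pa) % 2) * cellExpr (s - 3 * pa) +
      s / pb % 2 * (s / (2 * pb) % 2) * cellExpr (s - 3 * pb) +
      (N - 1) * (s / pa % 2 * (s / (2 * pa) % 2) * (s / pb % 2 * (s / (2 * pb) % 2)) *
        cellExpr (s - 3 * pa - 3 * pb)) +
      (1 + (1 + (s / (2 * pa) % 2 + s / pb % 2 + par)) % 2 * (N - 2)) *
        (s / pa % 2 * (s / (2 * pb) % 2) * cellExpr (s - pa - 2 * pb)) +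
      (1 + par % 2 * (N - 2)) *
        (s / (2 * pa) % 2 * (s / pb % 2) * cellExpr (s - 2 * pa - pb))) % N)

open Var ForestCounting.Expr in
/-- Compute the new value of the cell `s` when a vertex is integrated out. -/
def forgetCmd : Cmd :=
  .store (st + 2 * s + 1)
    (((1 - s / pa % 2) * (1 - s / (2 * pa) % 2) * (cellExpr s + cellExpr (s + 3 * pa))) % N)

open Var ForestCounting.Expr in
/-- Replace the state array: the command `p` computes the new values of its cells into the odd
cells, which are then copied to the even cells. -/
def passCmd (p : Cmd) : Cmd :=
  .assign c (q * flag) ++ (.loop c (decodeCmd ++ p) ++ (.assign c (q * flag) ++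
    .loop c (decodeCmd ++ .store (st + 2 * s) (load (st + 2 * s + 1)))))

/-- The variables used by a pass over the state array. -/
abbrev passVars : List Var := [.c, .s, .z, .w, .bit, .par, .t, .r]

/-- A new coefficient depends on several old ones, so the first sweep writes only odd cells and
leaves the old values intact for `p`; the second copies them over. With `flag = 0` both sweeps are
empty, which replaces a conditional command. -/
theorem passCmd_ok {W : ℕ} {p : Cmd} {σ : PState} {B : Finset ℕ} {F : ℕ → ℕ} {n st K T : ℕ}
    (hp : ∀ y ∈ p.writes, y ∈ [Var.par, .t, .r]) (hn : σ.reg .n = n) (hst : σ.reg .st = st)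
    (hB : BagAt B σ) (hbag : σ.reg .bag + n ≤ st) (hK : σ.reg .q * σ.reg .flag = K)
    (hK4 : K ≤ 4 ^ n) (hnW : n < 2 ^ W) (hW : 4 ^ n < 2 ^ W) (hF : ∀ m, F m < 2 ^ W)
    (hval : ∀ τ, (∀ y, y ∉ passVars → τ.reg y = σ.reg y) →
      (∀ m, τ.mem (st + 2 * m) = σ.mem (st + 2 * m)) → τ.reg .s < 4 ^ n →
      Ok W p τ T fun τ' => τ'.mem = Function.update τ.mem (st + 2 * τ.reg .s + 1) (F (τ.reg .s))) :
    Ok W (passCmd p) σ (4 + K * (11 + 8 * n + T)) fun τ =>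
      (∀ j < st, τ.mem j = σ.mem j) ∧
      (∀ m, τ.mem (st + 2 * m) =
        if ∃ k < K, m = spread B n 0 k then F m else σ.mem (st + 2 * m)) ∧
      ∀ y, y ∉ passVars → τ.reg y = σ.reg y := by
  have hw : ∀ y, y ∉ passVars → y ∉ (passCmd p).writes := by
    intro y hy h
    apply hy
    simp only [passCmd, decodeCmd, Cmd.writes_append, Cmd.writes, List.mem_append, List.mem_cons,
      List.not_mem_nil, or_false] at h
    have := hp y
    simp only [List.mem_cons, List.not_mem_nil, or_false] at this ⊢
    tauto
  have hwl1 : ∀ y, y ∉ passVars → y ∉ .c :: (decodeCmd ++ p).writes := by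
    intro y hy h
    apply hy
    simp only [decodeCmd, Cmd.writes_append, Cmd.writes, List.mem_append, List.mem_cons,
      List.not_mem_nil, or_false] at h
    have := hp y
    simp only [List.mem_cons, List.not_mem_nil, or_false] at this ⊢
    tauto
  have hlt : ∀ k, spread B n 0 k < 4 ^ n := fun k => by simpa using spread_lt B n 0 k
  refine Ok.frame (T := 1 + ((1 + K * (1 + ((4 + 4 * n) + T))) +
      (1 + (1 + K * (1 + ((4 + 4 * n) + 1))))))
    (Q := fun τ => (∀ j < st, τ.mem j = σ.mem j) ∧
      (∀ m, τ.mem (st + 2 * m) =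
        if ∃ k < K, m = spread B n 0 k then F m else σ.mem (st + 2 * m))) ?_ ?_
      |>.mono (by ring_nf; omega) fun _ => id
  swap
  · rintro τ ⟨h1, h2⟩ h3
    exact ⟨h1, h2, fun y hy => h3 y (hw y hy)⟩
  refine Ok.append (Ok.assign (by simp [hK]; omega) ?_)
  simp only [Expr.eval_mul, Expr.eval_var, hK]
  refine Ok.append ?_
  refine Ok.loop (T := (4 + 4 * n) + T) (fun j τ => (∀ j < st, τ.mem j = σ.mem j) ∧
    (∀ m, τ.mem (st + 2 * m) = σ.mem (st + 2 * m)) ∧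
    ∀ k < K, j ≤ k → τ.mem (st + 2 * spread B n 0 k + 1) = F (spread B n 0 k)) ?_ ?_ ?_ ?_
  · refine ⟨by simp, by simp, ?_⟩
    intro k hk hk'
    simp at hk'
    omega
  · rintro j hj τ ⟨h1, h2, h3⟩ h4
    simp at hj
    have hreg : ∀ y, y ∉ passVars → τ.reg y = σ.reg y := by
      intro y hy
      rw [h4 y (hwl1 y hy)]
      have : y ≠ .c := by rintro rfl; simp at hy
      simp [this]
    have hBτ : BagAt B (τ.set .c j) := by
      intro w hw
      simp [hreg .n (by decide), hn] at hw
      simp only [PState.set_reg, PState.set_mem, if_neg (by decide : ¬ (Var.bag = Var.c)),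
        hreg .bag (by decide)]
      rw [h1 _ (by omega)]
      exact hB w (by omega)
    refine Ok.append ((decodeCmd_ok (n := n) (by simp [hreg .n (by decide), hn]) hBτ hnW hW.le
      (by simp; omega)).mono le_rfl ?_)
    rintro τ1 ⟨h5, h6, h7⟩
    simp at h5
    have hreg1 : ∀ y, y ∉ passVars → τ1.reg y = σ.reg y := by
      intro y hy
      rw [h7 y (by simp at hy ⊢; tauto), ← hreg y hy]
      have : y ≠ .c := by rintro rfl; simp at hy
      simp [this]
    refine (hval τ1 hreg1 (by simpa [h6] using h2) (by rw [h5]; exact hlt _)).mono le_rfl ?_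
    intro τ2 h8
    rw [h8, h5, h6]
    refine ⟨fun i hi => ?_, fun m => ?_, fun k hk hjk => ?_⟩
    · rw [Function.update_of_ne (by omega)]; exact h1 i hi
    · rw [Function.update_of_ne (by omega)]; exact h2 m
    -- No injectivity of the enumeration is needed: an index met twice receives the same value,
    -- since `F` depends on the index alone.
    · by_cases he : spread B n 0 k = spread B n 0 j
      · rw [he]; simp
      · rw [Function.update_of_ne (by omega)]
        refine h3 k hk ?_
        by_contra hlt'
        have : k = j := by omega
        exact he (by rw [this])
  · simp
  rintro τ ⟨h1, h2, h3⟩ h4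
  have hreg : ∀ y, y ∉ passVars → τ.reg y = σ.reg y := by
    intro y hy
    rw [h4 y (hwl1 y hy)]
    have : y ≠ .c := by rintro rfl; simp at hy
    simp [this]
  have hKτ : τ.reg .q * τ.reg .flag = K := by
    rw [hreg .q (by decide), hreg .flag (by decide), hK]
  refine Ok.append (Ok.assign (by simp [hKτ]; omega) ?_)
  simp only [Expr.eval_mul, Expr.eval_var, hKτ]
  refine Ok.loop (T := (4 + 4 * n) + 1) (fun j υ => (∀ j < st, υ.mem j = σ.mem j) ∧
    (∀ k < K, υ.mem (st + 2 * spread B n 0 k + 1) = F (spread B n 0 k)) ∧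
    ∀ m, υ.mem (st + 2 * m) =
      if ∃ k < K, j ≤ k ∧ m = spread B n 0 k then F m else σ.mem (st + 2 * m)) ?_ ?_ ?_ ?_
  · refine ⟨by simpa using h1, by simpa using h3, ?_⟩
    intro m
    rw [if_neg]
    · exact h2 m
    · rintro ⟨k, hk, hk', -⟩
      simp at hk'
      omega
  · rintro j hj υ ⟨g1, g2, g3⟩ g4
    simp at hj
    have hregυ : ∀ y, y ∉ passVars → υ.reg y = σ.reg y := by
      intro y hy
      rw [g4 y, ← hreg y hy]
      · have : y ≠ .c := by rintro rfl; simp at hy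
        simp [this]
      · intro h
        apply hy
        simp only [decodeCmd, Cmd.writes_append, Cmd.writes, List.mem_append, List.mem_cons,
          List.not_mem_nil, or_false] at h
        simp only [List.mem_cons, List.not_mem_nil, or_false]
        tauto
    have hBυ : BagAt B (υ.set .c j) := by
      intro w hw
      simp [hregυ .n (by decide), hn] at hw
      simp only [PState.set_reg, PState.set_mem, if_neg (by decide : ¬ (Var.bag = Var.c)),
        hregυ .bag (by decide)]
      rw [g1 _ (by omega)]
      exact hB w (by omega)
    refine Ok.append ((decodeCmd_ok (n := n) (by simp [hregυ .n (by decide), hn]) hBυ hnW hW.le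
      (by simp; omega)).mono le_rfl ?_)
    rintro τ1 ⟨h5, h6, h7⟩
    simp at h5
    have hst1 : τ1.reg .st = st := by
      rw [h7 _ (by decide)]; simp [hregυ .st (by decide), hst]
    have hm1 : τ1.mem = υ.mem := h6
    have hev : (Expr.load (.var .st + 2 * .var .s + 1)).eval τ1 = F (spread B n 0 j) := by
      simp [hst1, h5, hm1, g2 j hj]
    refine Ok.store (by rw [hev]; exact hF _) ?_
    rw [hev]
    simp only [Expr.eval_add, Expr.eval_mul, Expr.eval_var, Expr.eval_ofNat, hst1, h5]
    refine ⟨fun i hi => ?_, fun k hk => ?_, fun m => ?_⟩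
    · rw [PState.write_mem, if_neg (by omega), hm1]; exact g1 i hi
    · rw [PState.write_mem, if_neg (by omega), hm1]; exact g2 k hk
    · rw [PState.write_mem]
      by_cases hm : m = spread B n 0 j
      · rw [if_pos (by omega), if_pos ⟨j, hj, le_rfl, hm⟩, hm]
      · rw [if_neg (by omega), hm1, g3 m]
        refine if_congr ⟨?_, ?_⟩ rfl rfl
        · rintro ⟨k, hk, hjk, hk'⟩
          exact ⟨k, hk, by omega, hk'⟩
        · rintro ⟨k, hk, hjk, hk'⟩
          refine ⟨k, hk, ?_, hk'⟩
          by_contra hlt'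
          have : k = j := by omega
          exact hm (by rw [hk', this])
  · simp
  · rintro υ ⟨g1, g2, g3⟩ -
    refine ⟨g1, fun m => ?_⟩
    rw [g3 m]
    simp

open Var ForestCounting.Expr in
/-- Compute the number of states of the current bag. -/
def countCmd : Cmd :=
  .assign q 1 ++ (.assign w n ++ .loop w (.assign q (q * (1 + 3 * load (bag + w)))))

theorem countCmd_ok {W : ℕ} {σ : PState} {B : Finset ℕ} {n : ℕ} (hn : σ.reg .n = n)
    (hB : BagAt B σ) (hBn : ∀ v ∈ B, v < n) (hnW : n < 2 ^ W) (hW : 4 ^ n < 2 ^ W) :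
    Ok W countCmd σ (3 + 2 * n) fun τ =>
      τ.reg .q = 4 ^ B.card ∧ τ.mem = σ.mem ∧
        ∀ y, y ∉ [Var.q, .w] → τ.reg y = σ.reg y := by
  have hcard : ∀ j, (B.filter (j ≤ ·)).card ≤ n := fun j => by
    calc _ ≤ (Finset.range n).card := Finset.card_le_card fun v hv => by
          simpa using hBn v (Finset.mem_filter.mp hv).1
      _ = n := by simp
  have hle : ∀ j, 4 ^ (B.filter (j ≤ ·)).card < 2 ^ W := fun j =>
    lt_of_le_of_lt (Nat.pow_le_pow_right (by simp) (hcard j)) hW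
  refine Ok.frame (T := 1 + (1 + (1 + 2 * n)))
    (Q := fun τ => τ.reg .q = 4 ^ B.card ∧ τ.mem = σ.mem) ?_ ?_ |>.mono (by omega) fun _ => id
  · have h0 := hW.trans_le' (Nat.one_le_pow n 4 (by simp))
    refine Ok.append (Ok.assign (by simpa using h0) ?_)
    refine Ok.append (Ok.assign (by simp [hn, hnW]) ?_)
    refine Ok.loop (T := 1) (fun j τ => τ.reg .q = 4 ^ (B.filter (j ≤ ·)).card ∧ τ.mem = σ.mem)
      ?_ ?_ ?_ ?_
    · have : B.filter (n ≤ ·) = ∅ := Finset.filter_eq_empty_iff.mpr fun v hv => by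
        have := hBn v hv; omega
      simp [hn, this]
    · rintro j hj τ ⟨h1, h2⟩ h3
      simp [hn] at hj
      have e1 : τ.reg .bag = σ.reg .bag := by rw [h3 _ (by decide)]; simp
      have e2 : (Expr.var .q * (1 + 3 * Expr.load (.var .bag + .var .w))).eval (τ.set .w j) =
          4 ^ (B.filter (j ≤ ·)).card := by
        simp [h1, h2, e1, hB j (by omega)]
        by_cases hjB : j ∈ B
        · have : B.filter (j ≤ ·) = insert j (B.filter (j + 1 ≤ ·)) := by
            ext x
            simp only [Finset.mem_filter, Finset.mem_insert]
            constructor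
            · rintro ⟨h4, h5⟩
              by_cases hx : x = j
              · exact .inl hx
              · exact .inr ⟨h4, by omega⟩
            · rintro (rfl | ⟨h4, h5⟩)
              · exact ⟨hjB, le_rfl⟩
              · exact ⟨h4, by omega⟩
          rw [this, Finset.card_insert_of_notMem (by simp), pow_succ]
          simp [hjB]
        · have : B.filter (j ≤ ·) = B.filter (j + 1 ≤ ·) := by
            ext x
            simp only [Finset.mem_filter]
            refine and_congr_right fun hx => ⟨fun h4 => ?_, fun h4 => by omega⟩
            exact lt_of_le_of_ne h4 (by rintro rfl; exact hjB hx)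
          rw [this]; simp [hjB]
      refine Ok.assign ?_ ?_
      · rw [e2]; exact hle j
      · rw [e2]; simp [h2]
    · simp [hn]; omega
    · rintro τ ⟨h1, h2⟩ -
      exact ⟨by simpa using h1, h2⟩
  · rintro τ ⟨h1, h2⟩ h3
    refine ⟨h1, h2, fun y hy => h3 y ?_⟩
    simp at hy
    simp [countCmd, Cmd.writes_append, Cmd.writes, hy]

end ForestCounting
namespace ForestCounting

/-! ### The invariant of the main loop -/

open Var ForestCounting.Expr in
/-- Process the edge `{a, b}` if it lies in the current bag. -/
def edgeBody : Cmd :=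
  .assign flag (load (bag + a) * load (bag + b) * load (2 + a * n + b)) ++
    (.store (2 + a * n + b) (load (2 + a * n + b) - flag) ++
      (.assign t a ++ (powCmd pa t 4 ++ (.assign t b ++ (powCmd pb t 4 ++ passCmd edgeCmd)))))

open Var ForestCounting.Expr in
/-- Integrate out the vertex `v` if it lies in the current bag, but not in the next one. -/
def forgetBody : Cmd :=
  .assign flag (load (bag + v) * (1 - i * load (bag + v - n))) ++
    (.assign t v ++ (powCmd pa t 4 ++ passCmd forgetCmd))

section Invariant

variable {n : ℕ} {G : SimpleGraph (Fin n)}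

/-- The bags of a path decomposition as sets of natural numbers. -/
def PathDecomposition.bagSet (D : PathDecomposition G) (i : ℕ) : Finset ℕ :=
  if h : i < D.length then (D.bag ⟨i, h⟩).map Fin.valEmbedding else ∅

theorem PathDecomposition.lt_of_mem_bagSet {D : PathDecomposition G} {i v : ℕ}
    (h : v ∈ D.bagSet i) : v < n := by
  rw [bagSet] at h
  split_ifs at h
  · obtain ⟨w, -, rfl⟩ := Finset.mem_map.mp h
    exact w.2
  · simp at h

theorem PathDecomposition.mem_bagSet {D : PathDecomposition G} (i : Fin D.length) (v : Fin n) :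
    (v : ℕ) ∈ D.bagSet i ↔ v ∈ D.bag i := by
  rw [bagSet, dif_pos i.2, Finset.mem_map]
  constructor
  · rintro ⟨w, hw, h⟩
    rwa [← Fin.ext (a := w) (b := v) h]
  · exact fun h => ⟨v, h, rfl⟩

theorem PathDecomposition.card_bagSet_le (D : PathDecomposition G) (i : ℕ) :
    (D.bagSet i).card ≤ D.width + 1 := by
  rw [bagSet]
  split_ifs with h
  · rw [Finset.card_map, width]
    have := Finset.le_sup (f := fun i => (D.bag i).card) (Finset.mem_univ ⟨i, h⟩)
    omega
  · simp

/-! ### Memory layout, word length and invariant -/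

/-- The first address of the state array. -/
abbrev arrayStart (n L : ℕ) : ℕ := 2 + n * n + L * n

/-- The modulus of the computation. -/
abbrev modulus (n : ℕ) : ℕ := 2 ^ (n * n + 1)

theorem two_le_modulus (n : ℕ) : 2 ≤ modulus n := by
  rw [modulus, pow_succ]
  have : 1 ≤ 2 ^ (n * n) := Nat.one_le_two_pow
  omega

/-- The word length `W` is sufficient. -/
structure Fits (n L W : ℕ) : Prop where
  states : 4 ^ (n + 1) ≤ 2 ^ W
  modulus_lt : modulus n < 2 ^ W
  arrayStart_lt : arrayStart n L < 2 ^ W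
  length_lt : L < 2 ^ W

theorem Fits.pow_lt {n L W : ℕ} (h : Fits n L W) {a : ℕ} (ha : a ≤ n) : 4 ^ a < 2 ^ W := by
  refine lt_of_lt_of_le ?_ h.states
  exact Nat.pow_lt_pow_right (by simp) (by omega)

theorem Fits.lt {n L W : ℕ} (h : Fits n L W) {a : ℕ} (ha : a ≤ n) : a < 2 ^ W :=
  (Nat.lt_pow_self (by simp)).trans (h.pow_lt ha)

/-- The state of the machine represents the vector `α`, the edges `E` still have to be processed,
and processing them would yield the number of forests. -/
structure Inv (D : PathDecomposition G) (E : Finset (Sym2 (Fin n))) (α : Fock (ZMod (modulus n)))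
    (σ : PState) : Prop where
  reg_n : σ.reg .n = n
  reg_st : σ.reg .st = arrayStart n D.length
  reg_N : σ.reg .N = modulus n
  bags : ∀ i < D.length, ∀ v < n,
    σ.mem (2 + n * n + i * n + v) = if v ∈ D.bagSet i then 1 else 0
  adj : ∀ a b : Fin n, a < b → σ.mem (2 + a * n + b) = if s(a, b) ∈ E then 1 else 0
  rep : ∀ S, (σ.mem (arrayStart n D.length + 2 * enc S) : ZMod (modulus n)) = α S
  small : ∀ m, σ.mem (arrayStart n D.length + 2 * m) < modulus n
  total : integral n (edgesProd (ZMod (modulus n)) E α) = numForests G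

variable {D : PathDecomposition G} {E : Finset (Sym2 (Fin n))} {α : Fock (ZMod (modulus n))}
  {σ τ : PState}

theorem Inv.congr (h : Inv D E α σ) (hn : τ.reg .n = σ.reg .n) (hst : τ.reg .st = σ.reg .st)
    (hN : τ.reg .N = σ.reg .N) (hmem : τ.mem = σ.mem) : Inv D E α τ where
  reg_n := hn.trans h.reg_n
  reg_st := hst.trans h.reg_st
  reg_N := hN.trans h.reg_N
  bags := by rw [hmem]; exact h.bags
  adj := by rw [hmem]; exact h.adj
  rep := by rw [hmem]; exact h.rep
  small := by rw [hmem]; exact h.small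
  total := h.total

theorem row_add_lt {n L i v : ℕ} (hi : i < L) (hv : v < n) : i * n + v < L * n := by
  calc i * n + v < (i + 1) * n := by rw [add_mul]; omega
    _ ≤ L * n := Nat.mul_le_mul_right _ hi

/-- A pass over the states of a bag turns a representation of one vector into one of another. -/
theorem rep_of_pass {N : ℕ} {B : Finset ℕ} (hB : ∀ v ∈ B, v < n) {α β : Fock (ZMod N)}
    (hα : SupportedOn B α) (hβ : SupportedOn B β) {old new F : ℕ → ℕ}
    (hold : ∀ S, (old (enc S) : ZMod N) = α S) (hF : ∀ S, (F (enc S) : ZMod N) = β S)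
    (hnew : ∀ m, new m = if ∃ k < 4 ^ B.card, m = spread B n 0 k then F m else old m)
    (S : Finset ℕ) : (new (enc S) : ZMod N) = β S := by
  rw [hnew]
  split_ifs with h
  · exact hF S
  -- An index that is not visited encodes a set with a mode outside the bag, where the old and the
  -- new coefficient both vanish.
  · have hS : ¬ ∀ p ∈ S, p / 2 ∈ B := by
      intro hS
      obtain ⟨z, hz, hs⟩ := exists_spread_eq B n fun p hp => ⟨hS p hp, hB _ (hS p hp)⟩
      rw [Finset.filter_true_of_mem hB] at hz
      exact h ⟨z, hz, by simpa using (hs 0).symm⟩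
    rw [hold]
    have h1 : α S = 0 := by by_contra h0; exact hS (hα S h0)
    have h2 : β S = 0 := by by_contra h0; exact hS (hβ S h0)
    rw [h1, h2]

theorem edgeCmd_ok {W L a b st : ℕ} {S : Finset ℕ} (hW : Fits n L W) (ha : τ.reg .a = a)
    (hb : τ.reg .b = b) (hab : a < b) (hbn : b < n) (hpa : τ.reg .pa = 4 ^ a)
    (hpb : τ.reg .pb = 4 ^ b) (hN : τ.reg .N = modulus n) (hst : τ.reg .st = st)
    (hS : τ.reg .s = enc S) :
    Ok W edgeCmd τ (5 + 6 * n) fun τ' => τ'.mem = Function.update τ.mem (st + 2 * enc S + 1)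
      (edgeValue (modulus n) (4 ^ a) (4 ^ b) (between S (2 * a + 1) (2 * b) % 2)
        (fun m => τ.mem (st + 2 * m)) (enc S)) := by
  refine Ok.mono (T := (4 + 6 * b) + 1) (Ok.append ((parityCmd_ok ha hb hab hpa hS
    ((Nat.pow_le_pow_right (by simp) (by omega)).trans hW.states)).mono le_rfl ?_)) (by omega)
    fun _ => id
  rintro τ' ⟨h1, h2, h3⟩
  have e : ∀ e f : Expr, e.eval τ' = st + 2 * enc S + 1 →
      f.eval τ' = edgeValue (modulus n) (4 ^ a) (4 ^ b) (between S (2 * a + 1) (2 * b) % 2)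
        (fun m => τ.mem (st + 2 * m)) (enc S) → Ok W (.store e f) τ' 1 fun τ'' =>
      τ''.mem = Function.update τ.mem (st + 2 * enc S + 1)
      (edgeValue (modulus n) (4 ^ a) (4 ^ b) (between S (2 * a + 1) (2 * b) % 2)
        (fun m => τ.mem (st + 2 * m)) (enc S)) := by
    intro e f he hf
    refine Ok.store ?_ ?_
    · rw [hf]
      exact (edgeValue_lt (by have := two_le_modulus n; omega) _ _ _ _ _).trans hW.modulus_lt
    · rw [he, hf, ← h2]; rfl
  have r1 := h3 .st (by decide)
  have r2 := h3 .s (by decide)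
  have r3 := h3 .pa (by decide)
  have r4 := h3 .pb (by decide)
  have r5 := h3 .N (by decide)
  refine e _ _ ?_ ?_
  · simp [r1, r2, hst, hS]
  · simp only [Expr.eval_mod, Expr.eval_add, Expr.eval_mul, Expr.eval_sub, Expr.eval_div,
      Expr.eval_var, Expr.eval_ofNat, cellExpr, Expr.eval_load, r1, r2, r3, r4, r5, h1, h2, hst, hS,
      hpa, hpb, hN, edgeValue]

/-- The flag is the product of three indicators: both ends lie in the bag and the edge is still
present. Subtracting it from the matrix entry deletes the edge, so an edge inside several bags is
applied only once. -/
theorem edgeBody_ok {W i a b : ℕ} (hW : Fits n D.length W) (hI : Inv D E α σ)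
    (hi : i < D.length) (hbag : σ.reg .bag = 2 + n * n + i * n)
    (hq : σ.reg .q = 4 ^ (D.bagSet i).card) (hα : SupportedOn (D.bagSet i) α)
    (ha : σ.reg .a = a) (hb : σ.reg .b = b) (hab : a < b) (hbn : b < n) :
    Ok W edgeBody σ (4 ^ (D.bagSet i).card * (28 + 18 * n)) fun τ =>
      ∃ E' α', Inv D E' α' τ ∧ SupportedOn (D.bagSet i) α' ∧ E' ⊆ E ∧
        (a ∈ D.bagSet i → b ∈ D.bagSet i → s(⟨a, hab.trans hbn⟩, ⟨b, hbn⟩) ∉ E') := by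
  classical
  set B := D.bagSet i with hBdef
  set e : Sym2 (Fin n) := s(⟨a, hab.trans hbn⟩, ⟨b, hbn⟩) with he
  have han : a < n := hab.trans hbn
  have hQ : 1 ≤ 4 ^ B.card := Nat.one_le_pow _ _ (by simp)
  have hBn : ∀ v ∈ B, v < n := fun v hv => PathDecomposition.lt_of_mem_bagSet hv
  have hBcard : B.card ≤ n := by
    calc B.card ≤ (Finset.range n).card := Finset.card_le_card fun v hv => by simpa using hBn v hv
      _ = n := by simp
  obtain ⟨f, hf, hf1, hfv⟩ : ∃ f, f ≤ 1 ∧ (f = 1 ↔ a ∈ B ∧ b ∈ B ∧ e ∈ E) ∧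
      (if a ∈ B then 1 else 0) * (if b ∈ B then 1 else 0) * (if e ∈ E then 1 else 0) = f := by
    by_cases h1 : a ∈ B <;> by_cases h2 : b ∈ B <;> by_cases h3 : e ∈ E <;> simp [h1, h2, h3]
  have hadj := hI.adj ⟨a, han⟩ ⟨b, hbn⟩ hab
  have hba := hI.bags i hi a han
  have hbb := hI.bags i hi b hbn
  have h1W : 1 < 2 ^ W := hW.pow_lt (Nat.zero_le n)
  have haddr : 2 + a * n + b < 2 + n * n := by have := row_add_lt han hbn; omega
  refine Ok.mono (T := 1 + (1 + (1 + ((2 + 2 * a) + (1 + ((2 + 2 * b) +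
    (4 + 4 ^ B.card * f * (11 + 8 * n + (5 + 6 * n))))))))) ?_ ?_ fun _ => id
  swap
  · have : 4 ^ B.card * f ≤ 4 ^ B.card := by simpa using Nat.mul_le_mul_left (4 ^ B.card) hf
    calc _ ≤ (12 + 4 * n) + 4 ^ B.card * f * (11 + 8 * n + (5 + 6 * n)) := by omega
      _ ≤ 4 ^ B.card * (12 + 4 * n) + 4 ^ B.card * (11 + 8 * n + (5 + 6 * n)) :=
        add_le_add (Nat.le_mul_of_pos_left _ hQ) (Nat.mul_le_mul_right _ this)
      _ = _ := by ring
  have ev1 : (Expr.load (.var .bag + .var .a) * Expr.load (.var .bag + .var .b) *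
      Expr.load (2 + .var .a * .var .n + .var .b)).eval σ = f := by
    simp only [Expr.eval_mul, Expr.eval_load, Expr.eval_add, Expr.eval_var, Expr.eval_ofNat, hbag,
      ha, hb, hI.reg_n, hba, hbb]
    rw [hadj]
    exact hfv
  refine Ok.append (Ok.assign (by rw [ev1]; omega) ?_)
  rw [ev1]
  have ev2 : (Expr.load (2 + .var .a * .var .n + .var .b) - .var .flag).eval (σ.set .flag f) =
      (if e ∈ E then 1 else 0) - f := by
    simp only [Expr.eval_sub, Expr.eval_mul, Expr.eval_load, Expr.eval_add, Expr.eval_var,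
      Expr.eval_ofNat, PState.set_reg, PState.set_mem, ha, hb, hI.reg_n]
    simp only [reduceCtorEq, if_false, if_true]
    rw [hadj]
  have ev3 : (2 + .var .a * .var .n + .var .b : Expr).eval (σ.set .flag f) = 2 + a * n + b := by
    simp [ha, hb, hI.reg_n]
  refine Ok.append (Ok.store (by rw [ev2]; split_ifs <;> omega) ?_)
  rw [ev2, ev3]
  set x := (if e ∈ E then 1 else 0) - f with hx
  refine Ok.append (Ok.assign (by simp [ha]; exact hW.lt (by omega)) ?_)
  refine Ok.append ((powCmd_ok (m := a) (by decide) (by simp) (by simp [ha])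
    (hW.pow_lt han.le)).mono le_rfl ?_)
  rintro τ1 ⟨p1, p2, p3⟩
  have hb1 : τ1.reg .b = b := by rw [p3 _ (by decide) (by decide)]; simp [hb]
  refine Ok.append (Ok.assign (by simp [hb1]; exact hW.lt (by omega)) ?_)
  refine Ok.append ((powCmd_ok (m := b) (by decide) (by simp) (by simp [hb1])
    (hW.pow_lt hbn.le)).mono le_rfl ?_)
  rintro τ2 ⟨p4, p5, p6⟩
  have hreg : ∀ y, y ∉ [Var.flag, .t, .pa, .pb] → τ2.reg y = σ.reg y := by
    intro y hy
    simp only [List.mem_cons, List.not_mem_nil, or_false, not_or] at hy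
    rw [p6 y (by tauto) (by tauto), PState.set_reg, if_neg (by tauto), p3 y (by tauto) (by tauto)]
    simp [hy]
  have hpa : τ2.reg .pa = 4 ^ a := by
    rw [p6 _ (by decide) (by decide)]; simp [p1]
  have hfl : τ2.reg .flag = f := by
    rw [p6 _ (by decide) (by decide), PState.set_reg, if_neg (by decide),
      p3 _ (by decide) (by decide)]
    simp
  have hmem : ∀ j, τ2.mem j = if j = 2 + a * n + b then x else σ.mem j := by
    intro j
    rw [p5, PState.set_mem, p2]
    simp
  set st := arrayStart n D.length with hst
  have hst2 : 2 + n * n ≤ st := by simp [hst, arrayStart]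
  have hcell : ∀ m, τ2.mem (st + 2 * m) = σ.mem (st + 2 * m) := by
    intro m
    rw [hmem, if_neg (by omega)]
  have hbags : ∀ i < D.length, ∀ v < n,
      τ2.mem (2 + n * n + i * n + v) = if v ∈ D.bagSet i then 1 else 0 := by
    intro i hi v hv
    rw [hmem, if_neg (by omega), hI.bags i hi v hv]
  have hNpos : 0 < modulus n := by have := two_le_modulus n; omega
  -- The new value has to be a function of the index, so the set of modes that determines the sign
  -- is recovered from its binary digits.
  refine (passCmd_ok (n := n) (st := st) (B := B) (K := 4 ^ B.card * f) (T := 5 + 6 * n)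
    (F := fun m => edgeValue (modulus n) (4 ^ a) (4 ^ b)
      (between (Finset.equivBitIndices m) (2 * a + 1) (2 * b) % 2) (fun m => σ.mem (st + 2 * m)) m)
    ?_ ?_ ?_ ?_ ?_ ?_ ?_ ?_ ?_ ?_ ?_).mono le_rfl ?_
  · simp [edgeCmd, parityCmd, Cmd.writes_append, Cmd.writes]
  · rw [hreg _ (by decide), hI.reg_n]
  · rw [hreg _ (by decide), hI.reg_st]
  · intro w hw
    rw [hreg _ (by decide), hI.reg_n] at hw
    rw [hreg _ (by decide), hbag, hbags i hi w hw]
  · rw [hreg _ (by decide), hbag, hst, arrayStart]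
    have : (i + 1) * n ≤ D.length * n := Nat.mul_le_mul_right _ hi
    rw [add_mul] at this
    omega
  · rw [hreg _ (by decide), hq, hfl]
  · calc 4 ^ B.card * f ≤ 4 ^ B.card * 1 := Nat.mul_le_mul_left _ hf
      _ ≤ 4 ^ n := by rw [mul_one]; exact Nat.pow_le_pow_right (by simp) hBcard
  · exact hW.lt le_rfl
  · exact hW.pow_lt le_rfl
  · exact fun m => (edgeValue_lt hNpos _ _ _ _ _).trans hW.modulus_lt
  · intro τ h1 h2 h3
    have hs : τ.reg .s = enc (Finset.equivBitIndices (τ.reg .s)) :=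
      (Finset.equivBitIndices.symm_apply_apply (τ.reg .s)).symm
    have := edgeCmd_ok (τ := τ) (st := st) (a := a) (b := b) hW
      (by rw [h1 _ (by decide), hreg _ (by decide), ha])
      (by rw [h1 _ (by decide), hreg _ (by decide), hb]) hab hbn
      (by rw [h1 _ (by decide), hpa])
      (by rw [h1 _ (by decide), p4])
      (by rw [h1 _ (by decide), hreg _ (by decide), hI.reg_N])
      (by rw [h1 _ (by decide), hreg _ (by decide), hI.reg_st]) hs
    rw [← hs] at this
    refine this.mono le_rfl fun τ' h4 => ?_
    rw [h4]
    congr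
    ext m
    rw [h2, hcell]
  · rintro τ ⟨h1, h2, h3⟩
    have hadj' : ∀ E' : Finset (Sym2 (Fin n)), (∀ e', e' ≠ e → (e' ∈ E' ↔ e' ∈ E)) →
        (x = if e ∈ E' then 1 else 0) →
        ∀ a b : Fin n, a < b → τ.mem (2 + a * n + b) = if s(a, b) ∈ E' then 1 else 0 := by
      intro E' hE' hxE a' b' hab'
      have := row_add_lt a'.2 b'.2
      rw [h1 _ (by omega), hmem]
      by_cases hbb' : (b' : ℕ) = b
      · by_cases haa' : (a' : ℕ) = a
        · rw [if_pos (by rw [hbb', haa']), hxE]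
          have : s(a', b') = e := Sym2.eq_iff.mpr (.inl ⟨Fin.ext haa', Fin.ext hbb'⟩)
          rw [this]
        · rw [if_neg, hI.adj a' b' hab']
          · refine if_congr (hE' _ ?_).symm rfl rfl
            rw [he, Ne, Sym2.eq_iff]
            simp only [Fin.ext_iff]
            have : (a' : ℕ) < b' := hab'
            omega
          · intro h
            have : (a' : ℕ) * n = a * n := by omega
            exact haa' (Nat.eq_of_mul_eq_mul_right (by omega) this)
      · rw [if_neg, hI.adj a' b' hab']
        · refine if_congr (hE' _ ?_).symm rfl rfl
          rw [he, Ne, Sym2.eq_iff]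
          simp only [Fin.ext_iff]
          have : (a' : ℕ) < b' := hab'
          omega
        · intro h
          -- Reduction modulo `n` recovers the column, so distinct entries have distinct addresses.
          have h1 : ((a' : ℕ) * n + b') % n = (a * n + b) % n := by congr 1; omega
          rw [Nat.mul_add_mod', Nat.mul_add_mod', Nat.mod_eq_of_lt b'.2, Nat.mod_eq_of_lt hbn] at h1
          exact hbb' h1
    have hbags' : ∀ i < D.length, ∀ v < n,
        τ.mem (2 + n * n + i * n + v) = if v ∈ D.bagSet i then 1 else 0 := by
      intro i hi v hv
      have := row_add_lt hi hv
      rw [h1 _ (by simp only [hst, arrayStart]; omega), hbags i hi v hv]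
    have hregs : ∀ y, y ∉ passVars → y ∉ [Var.flag, .t, .pa, .pb] → τ.reg y = σ.reg y :=
      fun y hy hy' => by rw [h3 y hy, hreg y hy']
    have hsmall : ∀ m, τ.mem (st + 2 * m) < modulus n := by
      intro m
      rw [h2]
      split_ifs
      · exact edgeValue_lt hNpos _ _ _ _ _
      · rw [hcell]; exact hI.small m
    by_cases hf' : f = 1
    · obtain ⟨haB, hbB, heE⟩ := hf1.mp hf'
      have hα' : SupportedOn B (α + edgeOp (ZMod (modulus n)) a b α) := hα.add (hα.edgeOp haB hbB)
      refine ⟨E.erase e, α + edgeOp _ a b α, ⟨?_, ?_, ?_, hbags', ?_, ?_, hsmall, ?_⟩, hα',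
        Finset.erase_subset _ _, fun _ _ => by simp⟩
      · rw [hregs _ (by decide) (by decide), hI.reg_n]
      · rw [hregs _ (by decide) (by decide), hI.reg_st]
      · rw [hregs _ (by decide) (by decide), hI.reg_N]
      · refine hadj' _ (fun e' he' => by simp [he']) ?_
        simp [hx, heE, hf']
      · refine rep_of_pass (old := fun m => σ.mem (st + 2 * m))
          (new := fun m => τ.mem (st + 2 * m)) hBn hα hα' hI.rep
          (F := fun m => edgeValue (modulus n) (4 ^ a) (4 ^ b)
            (between (Finset.equivBitIndices m) (2 * a + 1) (2 * b) % 2)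
            (fun m => σ.mem (st + 2 * m)) m) ?_ ?_
        · intro S
          refine edgeValue_eq (two_le_modulus n) hI.rep hab S ?_
          rw [show Finset.equivBitIndices (enc S) = S from Finset.equivBitIndices.apply_symm_apply S]
        · intro m
          simp only [h2, hf', mul_one, hcell]
      · have := hI.total
        rw [← Finset.insert_erase heE, edgesProd_insert (Finset.notMem_erase _ _)] at this
        exact this
    · have hf0 : f = 0 := by omega
      refine ⟨E, α, ⟨?_, ?_, ?_, hbags', ?_, ?_, hsmall, hI.total⟩, hα, subset_rfl, ?_⟩
      · rw [hregs _ (by decide) (by decide), hI.reg_n]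
      · rw [hregs _ (by decide) (by decide), hI.reg_st]
      · rw [hregs _ (by decide) (by decide), hI.reg_N]
      · refine hadj' _ (fun e' he' => Iff.rfl) ?_
        simp [hx, hf0]
      · intro S
        rw [h2, hf0, mul_zero, if_neg (by simp), hcell, hI.rep]
      · exact fun h4 h5 h6 => hf' (hf1.mpr ⟨h4, h5, h6⟩)

/-- The vertex `v` is last seen in the bag `i`, where bags are visited in decreasing order. -/
def PathDecomposition.LastSeen (D : PathDecomposition G) (i v : ℕ) : Prop :=
  v ∈ D.bagSet i ∧ (i = 0 ∨ v ∉ D.bagSet (i - 1))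

/-- Bag `i - 1` is stored `n` cells before bag `i`. The truncated factor `1 - i * load …` is 1 at `i
= 0` whatever is loaded; for positive `i` it is 0 exactly when `v` occurs in the next bag. -/
theorem forgetBody_ok {W i v : ℕ} (hW : Fits n D.length W) (hI : Inv D E α σ)
    (hi : i < D.length) (hri : σ.reg .i = i) (hbag : σ.reg .bag = 2 + n * n + i * n)
    (hq : σ.reg .q = 4 ^ (D.bagSet i).card) (hα : SupportedOn (D.bagSet i) α)
    (hv : σ.reg .v = v) (hvn : v < n)
    (hfree : D.LastSeen i v → ∀ e ∈ E, (⟨v, hvn⟩ : Fin n) ∉ e) :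
    Ok W forgetBody σ (4 ^ (D.bagSet i).card * (20 + 10 * n)) fun τ =>
      ∃ α', Inv D E α' τ ∧ SupportedOn (D.bagSet i) α' ∧ (∀ u, FreeOf u α → FreeOf u α') ∧
        (D.LastSeen i v → FreeOf v α') := by
  classical
  set B := D.bagSet i with hBdef
  have hQ : 1 ≤ 4 ^ B.card := Nat.one_le_pow _ _ (by simp)
  have hBn : ∀ v ∈ B, v < n := fun v hv => PathDecomposition.lt_of_mem_bagSet hv
  have hBcard : B.card ≤ n := by
    calc B.card ≤ (Finset.range n).card := Finset.card_le_card fun v hv => by simpa using hBn v hv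
      _ = n := by simp
  have hbv := hI.bags i hi v hvn
  have h1W : 1 < 2 ^ W := hW.pow_lt (Nat.zero_le n)
  obtain ⟨f, hf, hf1, ev1⟩ : ∃ f, f ≤ 1 ∧ (f = 1 ↔ D.LastSeen i v) ∧
      (Expr.load (.var .bag + .var .v) * (1 - .var .i * Expr.load (.var .bag + .var .v - .var .n))
        : Expr).eval σ = f := by
    simp only [Expr.eval_mul, Expr.eval_load, Expr.eval_add, Expr.eval_sub, Expr.eval_var,
      Expr.eval_ofNat, hbag, hv, hri, hI.reg_n, hbv, PathDecomposition.LastSeen, ← hBdef]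
    rcases Nat.eq_zero_or_pos i with h0 | h0
    · by_cases h1 : v ∈ B <;> simp [h0, h1]
    · obtain ⟨j, rfl⟩ := Nat.exists_eq_add_of_le' h0
      have := hI.bags j (by omega) v hvn
      rw [show 2 + n * n + (j + 1) * n + v - n = 2 + n * n + j * n + v by rw [add_mul]; omega, this]
      by_cases h1 : v ∈ B <;> by_cases h2 : v ∈ D.bagSet j <;> simp [h1, h2]
  refine Ok.mono (T := 1 + (1 + ((2 + 2 * v) +
    (4 + 4 ^ B.card * f * (11 + 8 * n + 1))))) ?_ ?_ fun _ => id
  swap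
  · have : 4 ^ B.card * f ≤ 4 ^ B.card := by simpa using Nat.mul_le_mul_left (4 ^ B.card) hf
    calc _ ≤ (8 + 2 * n) + 4 ^ B.card * f * (11 + 8 * n + 1) := by omega
      _ ≤ 4 ^ B.card * (8 + 2 * n) + 4 ^ B.card * (11 + 8 * n + 1) :=
        add_le_add (Nat.le_mul_of_pos_left _ hQ) (Nat.mul_le_mul_right _ this)
      _ = _ := by ring
  refine Ok.append (Ok.assign (by rw [ev1]; omega) ?_)
  rw [ev1]
  refine Ok.append (Ok.assign (by simp [hv]; exact hW.lt hvn.le) ?_)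
  refine Ok.append ((powCmd_ok (m := v) (by decide) (by simp) (by simp [hv])
    (hW.pow_lt hvn.le)).mono le_rfl ?_)
  rintro τ2 ⟨p1, p2, p3⟩
  have hreg : ∀ y, y ∉ [Var.flag, .t, .pa] → τ2.reg y = σ.reg y := by
    intro y hy
    simp only [List.mem_cons, List.not_mem_nil, or_false, not_or] at hy
    rw [p3 y (by tauto) (by tauto)]
    simp [hy]
  have hfl : τ2.reg .flag = f := by
    rw [p3 _ (by decide) (by decide)]; simp
  have hmem : τ2.mem = σ.mem := p2
  set st := arrayStart n D.length with hst
  have hst2 : 2 + n * n ≤ st := by simp [hst, arrayStart]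
  have hNpos : 0 < modulus n := by have := two_le_modulus n; omega
  refine (passCmd_ok (n := n) (st := st) (B := B) (K := 4 ^ B.card * f) (T := 1)
    (F := fun m => forgetValue (modulus n) (4 ^ v) (fun m => σ.mem (st + 2 * m)) m)
    ?_ ?_ ?_ ?_ ?_ ?_ ?_ ?_ ?_ ?_ ?_).mono le_rfl ?_
  · simp [forgetCmd, Cmd.writes]
  · rw [hreg _ (by decide), hI.reg_n]
  · rw [hreg _ (by decide), hI.reg_st]
  · intro w hw
    rw [hreg _ (by decide), hI.reg_n] at hw
    rw [hreg _ (by decide), hbag, hmem, hI.bags i hi w hw]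
  · rw [hreg _ (by decide), hbag, hst, arrayStart]
    have : (i + 1) * n ≤ D.length * n := Nat.mul_le_mul_right _ hi
    rw [add_mul] at this
    omega
  · rw [hreg _ (by decide), hq, hfl]
  · calc 4 ^ B.card * f ≤ 4 ^ B.card * 1 := Nat.mul_le_mul_left _ hf
      _ ≤ 4 ^ n := by rw [mul_one]; exact Nat.pow_le_pow_right (by simp) hBcard
  · exact hW.lt le_rfl
  · exact hW.pow_lt le_rfl
  · exact fun m => (forgetValue_lt hNpos _ _ _).trans hW.modulus_lt
  · intro τ h1 h2 h3
    have r1 : τ.reg .st = st := by rw [h1 _ (by decide), hreg _ (by decide), hI.reg_st]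
    have r2 : τ.reg .pa = 4 ^ v := by rw [h1 _ (by decide), p1]
    have r3 : τ.reg .N = modulus n := by rw [h1 _ (by decide), hreg _ (by decide), hI.reg_N]
    have hev : ((((1 - .var .s / .var .pa % 2) * (1 - .var .s / (2 * .var .pa) % 2) *
        (cellExpr (.var .s) + cellExpr (.var .s + 3 * .var .pa))) % .var .N) : Expr).eval τ =
        forgetValue (modulus n) (4 ^ v) (fun m => σ.mem (st + 2 * m)) (τ.reg .s) := by
      simp only [Expr.eval_mod, Expr.eval_add, Expr.eval_mul, Expr.eval_sub, Expr.eval_div,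
        Expr.eval_var, Expr.eval_ofNat, cellExpr, Expr.eval_load, r1, r2, r3, h2, hmem, forgetValue]
    refine Ok.store ?_ ?_
    · rw [hev]; exact (forgetValue_lt hNpos _ _ _).trans hW.modulus_lt
    · rw [hev]
      simp [PState.write, r1]
  · rintro τ ⟨h1, h2, h3⟩
    rw [hmem] at h1 h2
    have hbags' : ∀ i < D.length, ∀ v < n,
        τ.mem (2 + n * n + i * n + v) = if v ∈ D.bagSet i then 1 else 0 := by
      intro i hi v hv
      have := row_add_lt hi hv
      rw [h1 _ (by simp only [hst, arrayStart]; omega), hI.bags i hi v hv]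
    have hadj' : ∀ a b : Fin n, a < b → τ.mem (2 + a * n + b) = if s(a, b) ∈ E then 1 else 0 := by
      intro a b hab
      have := row_add_lt a.2 b.2
      rw [h1 _ (by omega), hI.adj a b hab]
    have hregs : ∀ y, y ∉ passVars → y ∉ [Var.flag, .t, .pa] → τ.reg y = σ.reg y :=
      fun y hy hy' => by rw [h3 y hy, hreg y hy']
    have hsmall : ∀ m, τ.mem (st + 2 * m) < modulus n := by
      intro m
      rw [h2]
      split_ifs
      · exact forgetValue_lt hNpos _ _ _
      · exact hI.small m
    have r1 := (hregs .n (by decide) (by decide)).trans hI.reg_n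
    have r2 := (hregs .st (by decide) (by decide)).trans hI.reg_st
    have r3 := (hregs .N (by decide) (by decide)).trans hI.reg_N
    by_cases hf' : f = 1
    · have hls := hf1.mp hf'
      refine ⟨forget _ v α, ⟨r1, r2, r3, hbags', hadj', ?_, hsmall, ?_⟩, hα.forget v,
        fun u hu => hu.forget v, fun _ => freeOf_forget v α⟩
      · refine rep_of_pass (old := fun m => σ.mem (st + 2 * m))
          (new := fun m => τ.mem (st + 2 * m)) hBn hα (hα.forget v) hI.rep
          (F := fun m => forgetValue (modulus n) (4 ^ v) (fun m => σ.mem (st + 2 * m)) m)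
          (fun S => forgetValue_eq hI.rep v S) ?_
        intro m
        simp only [h2, hf', mul_one]
      · exact (edgesProd_forget (w := ⟨v, hvn⟩) (hfree hls) α).trans hI.total
    · have hf0 : f = 0 := by omega
      refine ⟨α, ⟨r1, r2, r3, hbags', hadj', ?_, hsmall, hI.total⟩, hα, fun _ h => h,
        fun h => absurd (hf1.mpr h) hf'⟩
      intro S
      rw [h2, hf0, mul_zero, if_neg (by simp), hI.rep]

end Invariant

end ForestCounting
namespace ForestCounting

/-! ### The main program -/

open Var ForestCounting.Expr in
/-- Process all edges in the current bag. -/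
def edgesCmd : Cmd :=
  .assign b n ++ .loop b (.assign a b ++ .loop a edgeBody)

open Var ForestCounting.Expr in
/-- Integrate out the vertices that are not in the next bag. -/
def forgetsCmd : Cmd :=
  .assign v n ++ .loop v forgetBody

open Var ForestCounting.Expr in
/-- Process one bag. -/
def bagCmd : Cmd :=
  .assign bag (2 + n * n + i * n) ++ (countCmd ++ (edgesCmd ++ forgetsCmd))

open Var ForestCounting.Expr in
/-- Count the forests of a graph with a path decomposition. -/
def forestCmd : Cmd :=
  .assign n (load 0) ++ (.assign L (load 1) ++ (.assign st (2 + n * n + L * n) ++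
    (.assign t (n * n + 1) ++ (powCmd N t 2 ++ (.store st 1 ++ (.assign i L ++
      (.loop i bagCmd ++ .assign out (load st))))))))

theorem Cmd.wellFormed_append (p p' : Cmd) :
    (p ++ p').WellFormed ↔ p.WellFormed ∧ p'.WellFormed := Iff.rfl

theorem forestCmd_wellFormed : forestCmd.WellFormed := by
  simp [forestCmd, bagCmd, countCmd, edgesCmd, forgetsCmd, edgeBody, forgetBody, powCmd, passCmd,
    decodeCmd, parityCmd, edgeCmd, forgetCmd, Cmd.wellFormed_append, Cmd.writes_append,
    Cmd.WellFormed, Cmd.writes]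

section Main

variable {n : ℕ} {G : SimpleGraph (Fin n)} {D : PathDecomposition G} {E : Finset (Sym2 (Fin n))}
  {α : Fock (ZMod (modulus n))} {σ : PState}

theorem Inv.set (h : Inv D E α σ) {x : Var} (hx : x ∉ [Var.n, .st, .N]) (k : ℕ) :
    Inv D E α (σ.set x k) := by
  simp only [List.mem_cons, List.not_mem_nil, or_false, not_or] at hx
  exact h.congr (by simp [Ne.symm hx.1]) (by simp [Ne.symm hx.2.1]) (by simp [Ne.symm hx.2.2]) rfl

/-- The outer invariant says that no edge inside the bag with larger end at least `j` remains; the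
inner one handles the smaller ends for that row. -/
theorem edgesCmd_ok {W i : ℕ} (hW : Fits n D.length W) (hI : Inv D E α σ)
    (hi : i < D.length) (hbag : σ.reg .bag = 2 + n * n + i * n)
    (hq : σ.reg .q = 4 ^ (D.bagSet i).card) (hα : SupportedOn (D.bagSet i) α) :
    Ok W edgesCmd σ (2 + n * (3 + n * (1 + 4 ^ (D.bagSet i).card * (28 + 18 * n)))) fun τ =>
      ∃ E' α', Inv D E' α' τ ∧ SupportedOn (D.bagSet i) α' ∧ E' ⊆ E ∧
        ∀ a b : Fin n, a < b → (a : ℕ) ∈ D.bagSet i → (b : ℕ) ∈ D.bagSet i → s(a, b) ∉ E' := by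
  set T := 4 ^ (D.bagSet i).card * (28 + 18 * n)
  refine Ok.mono (T := 1 + (1 + n * (1 + (2 + n * (1 + T))))) (Ok.append (Ok.assign
    (by simp [hI.reg_n]; exact hW.lt le_rfl) ?_)) (by ring_nf; omega) fun _ => id
  simp only [Expr.eval_var, hI.reg_n]
  refine Ok.loop (T := 2 + n * (1 + T)) (fun j τ => ∃ E' α', Inv D E' α' τ ∧
    SupportedOn (D.bagSet i) α' ∧ E' ⊆ E ∧ ∀ a b : Fin n, a < b → j ≤ (b : ℕ) →
      (a : ℕ) ∈ D.bagSet i → (b : ℕ) ∈ D.bagSet i → s(a, b) ∉ E') ?_ ?_ ?_ ?_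
  · refine ⟨E, α, hI.set (by decide) _, hα, subset_rfl, fun a b _ hb => ?_⟩
    simp at hb
    omega
  · rintro j hj τ ⟨E1, α1, hI1, hα1, hE1, hd1⟩ hr
    simp at hj
    refine Ok.mono (T := 1 + (1 + j * (1 + T))) (Ok.append (Ok.assign
      (by simp; exact hW.lt hj.le) ?_)) ?_ fun _ => id
    swap
    · have : j * (1 + T) ≤ n * (1 + T) := Nat.mul_le_mul_right _ hj.le
      omega
    simp only [Expr.eval_var, PState.set_reg, if_true]
    refine Ok.loop (T := T) (fun k τ => ∃ E' α', Inv D E' α' τ ∧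
      SupportedOn (D.bagSet i) α' ∧ E' ⊆ E1 ∧ ∀ a b : Fin n, a < b → (b : ℕ) = j → k ≤ (a : ℕ) →
        (a : ℕ) ∈ D.bagSet i → (b : ℕ) ∈ D.bagSet i → s(a, b) ∉ E') ?_ ?_ ?_ ?_
    · refine ⟨E1, α1, (hI1.set (by decide) _).set (by decide) _, hα1, subset_rfl, ?_⟩
      intro a b hab hb ha
      simp at ha
      have : (a : ℕ) < b := hab
      omega
    · rintro k hk υ ⟨E2, α2, hI2, hα2, hE2, hd2⟩ hr2
      simp at hk
      have r1 : υ.reg .bag = 2 + n * n + i * n := by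
        rw [hr2 _ (by decide)]; simp; rw [hr _ (by decide)]; simp [hbag]
      have r2 : υ.reg .q = 4 ^ (D.bagSet i).card := by
        rw [hr2 _ (by decide)]; simp; rw [hr _ (by decide)]; simp [hq]
      have r3 : υ.reg .b = j := by
        rw [hr2 _ (by decide)]; simp
      refine (edgeBody_ok (a := k) (b := j) hW (hI2.set (by decide) _) hi (by simp [r1])
        (by simp [r2]) hα2 (by simp) (by simp [r3]) hk hj).mono le_rfl ?_
      rintro υ' ⟨E3, α3, hI3, hα3, hE3, hd3⟩
      refine ⟨E3, α3, hI3, hα3, hE3.trans hE2, ?_⟩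
      intro a b hab hb ha haB hbB
      by_cases hak : (a : ℕ) = k
      · have ea : a = ⟨k, hk.trans hj⟩ := Fin.ext hak
        have eb : b = ⟨j, hj⟩ := Fin.ext hb
        rw [ea, eb]
        exact hd3 (hak ▸ haB) (hb ▸ hbB)
      · exact fun h => hd2 a b hab hb (by omega) haB hbB (hE3 h)
    · simp
    · rintro υ ⟨E2, α2, hI2, hα2, hE2, hd2⟩ -
      refine ⟨E2, α2, hI2, hα2, hE2.trans hE1, ?_⟩
      intro a b hab hb haB hbB
      by_cases hbj : (b : ℕ) = j
      · exact hd2 a b hab hbj (Nat.zero_le _) haB hbB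
      · exact fun h => hd1 a b hab (by omega) haB hbB (hE2 h)
  · simp
  · rintro τ ⟨E1, α1, hI1, hα1, hE1, hd1⟩ -
    exact ⟨E1, α1, hI1, hα1, hE1, fun a b hab => hd1 a b hab (Nat.zero_le _)⟩

/-- A vertex that survives lies in this bag and was not last seen there, hence lies in the next one.
Vertices new in the next bag have no modes in the vector yet, so they need no work. -/
theorem forgetsCmd_ok {W i : ℕ} (hW : Fits n D.length W) (hI : Inv D E α σ)
    (hi : i < D.length) (hri : σ.reg .i = i) (hbag : σ.reg .bag = 2 + n * n + i * n)
    (hq : σ.reg .q = 4 ^ (D.bagSet i).card) (hα : SupportedOn (D.bagSet i) α)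
    (hfree : ∀ v : Fin n, D.LastSeen i v → ∀ e ∈ E, v ∉ e) :
    Ok W forgetsCmd σ (2 + n * (1 + 4 ^ (D.bagSet i).card * (20 + 10 * n))) fun τ =>
      ∃ α', Inv D E α' τ ∧ SupportedOn (if i = 0 then ∅ else D.bagSet (i - 1)) α' := by
  set T := 4 ^ (D.bagSet i).card * (20 + 10 * n)
  refine Ok.mono (T := 1 + (1 + n * (1 + T))) (Ok.append (Ok.assign
    (by simp [hI.reg_n]; exact hW.lt le_rfl) ?_)) (by omega) fun _ => id
  simp only [Expr.eval_var, hI.reg_n]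
  refine Ok.loop (T := T) (fun j τ => ∃ α', Inv D E α' τ ∧
    SupportedOn (D.bagSet i) α' ∧ ∀ u, j ≤ u → D.LastSeen i u → FreeOf u α') ?_ ?_ ?_ ?_
  · refine ⟨α, hI.set (by decide) _, hα, fun u hu hl => ?_⟩
    simp at hu
    have := PathDecomposition.lt_of_mem_bagSet hl.1
    omega
  · rintro j hj τ ⟨α1, hI1, hα1, hd1⟩ hr
    simp at hj
    refine (forgetBody_ok (v := j) hW (hI1.set (by decide) _) hi
      (by simp; rw [hr _ (by decide)]; simp [hri])
      (by simp; rw [hr _ (by decide)]; simp [hbag])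
      (by simp; rw [hr _ (by decide)]; simp [hq]) hα1 (by simp) hj (hfree ⟨j, hj⟩)).mono le_rfl ?_
    rintro τ' ⟨α2, hI2, hα2, hp, hf⟩
    refine ⟨α2, hI2, hα2, fun u hu hl => ?_⟩
    by_cases huj : u = j
    · exact huj ▸ hf (huj ▸ hl)
    · exact hp u (hd1 u (by omega) hl)
  · simp
  · rintro τ ⟨α1, hI1, hα1, hd1⟩ -
    refine ⟨α1, hI1, fun S hS p hp => ?_⟩
    have hpB := hα1 S hS p hp
    have hl : ¬ D.LastSeen i (p / 2) := by
      intro hl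
      refine hS (hd1 _ (Nat.zero_le _) hl S ?_)
      rcases Nat.mod_two_eq_zero_or_one p with h | h
      · left; rwa [show 2 * (p / 2) = p by omega]
      · right; rwa [show 2 * (p / 2) + 1 = p by omega]
    have : ¬ (i = 0 ∨ p / 2 ∉ D.bagSet (i - 1)) := fun h => hl ⟨hpB, h⟩
    push Not at this
    rw [if_neg this.1]
    exact this.2

/-- The time spent on one bag with at most `k` vertices. -/
abbrev bagTime (n Q : ℕ) : ℕ :=
  1 + ((3 + 2 * n) + ((2 + n * (3 + n * (1 + Q * (28 + 18 * n)))) +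
    (2 + n * (1 + Q * (20 + 10 * n)))))

/-- Invariant over the bags: no remaining edge has both ends in a bag already visited. With the
interval property, this makes it safe to integrate out the vertices last seen here. -/
theorem bagCmd_ok {W i : ℕ} (hW : Fits n D.length W) (hI : Inv D E α σ)
    (hi : i < D.length) (hri : σ.reg .i = i) (hα : SupportedOn (D.bagSet i) α)
    (hE : ∀ e ∈ E, e ∈ G.edgeSet)
    (hd : ∀ a b : Fin n, s(a, b) ∈ E → ∀ k, i + 1 ≤ k → (a : ℕ) ∈ D.bagSet k →
      (b : ℕ) ∉ D.bagSet k) :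
    Ok W bagCmd σ (bagTime n (4 ^ (D.width + 1))) fun τ =>
      ∃ E' α', Inv D E' α' τ ∧ SupportedOn (if i = 0 then ∅ else D.bagSet (i - 1)) α' ∧
        (∀ e ∈ E', e ∈ G.edgeSet) ∧
        ∀ a b : Fin n, s(a, b) ∈ E' → ∀ k, i ≤ k → (a : ℕ) ∈ D.bagSet k →
          (b : ℕ) ∉ D.bagSet k := by
  have hQ : 4 ^ (D.bagSet i).card ≤ 4 ^ (D.width + 1) :=
    Nat.pow_le_pow_right (by simp) (D.card_bagSet_le i)
  refine Ok.mono (T := bagTime n (4 ^ (D.bagSet i).card)) ?_ (by unfold bagTime; gcongr)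
    fun _ => id
  have ev : (2 + .var .n * .var .n + .var .i * .var .n : Expr).eval σ = 2 + n * n + i * n := by
    simp [hI.reg_n, hri]
  refine Ok.append (Ok.assign ?_ ?_)
  · rw [ev]
    refine lt_of_le_of_lt ?_ hW.arrayStart_lt
    have : i * n ≤ D.length * n := Nat.mul_le_mul_right _ hi.le
    simp only [arrayStart]
    omega
  rw [ev]
  refine Ok.append ((countCmd_ok (B := D.bagSet i) (n := n) (by simp [hI.reg_n]) ?_
    (fun v => PathDecomposition.lt_of_mem_bagSet) (hW.lt le_rfl) (hW.pow_lt le_rfl)).mono le_rfl ?_)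
  · intro w hw
    simp [hI.reg_n] at hw
    simpa using hI.bags i hi w hw
  rintro τ1 ⟨q1, m1, r1⟩
  have hI1 : Inv D E α τ1 := hI.congr (by rw [r1 _ (by decide)]; simp)
    (by rw [r1 _ (by decide)]; simp) (by rw [r1 _ (by decide)]; simp) m1
  have hb1 : τ1.reg .bag = 2 + n * n + i * n := by rw [r1 _ (by decide)]; simp
  have hi1 : τ1.reg .i = i := by rw [r1 _ (by decide)]; simp [hri]
  refine Ok.append ((edgesCmd_ok hW hI1 hi hb1 q1 hα).frame ?_)
  rintro τ2 ⟨E2, α2, hI2, hα2, hE2, hd2⟩ r2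
  have hnew : ∀ a b : Fin n, s(a, b) ∈ E2 → ∀ k, i ≤ k → (a : ℕ) ∈ D.bagSet k →
      (b : ℕ) ∉ D.bagSet k := by
    intro a b hab k hk ha hb
    by_cases hki : k = i
    · subst hki
      have hne : a ≠ b := (hE _ (hE2 hab) : G.Adj a b).ne
      rcases lt_or_gt_of_ne hne with h | h
      · exact hd2 a b h ha hb hab
      · exact hd2 b a h hb ha (by rwa [Sym2.eq_swap])
    · exact hd a b (hE2 hab) k (by omega) ha hb
  refine (forgetsCmd_ok hW hI2 hi (by rw [r2 _ (by decide), hi1])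
    (by rw [r2 _ (by decide), hb1]) (by rw [r2 _ (by decide), q1]) hα2 ?_).mono le_rfl ?_
  · intro v hv e he hve
    obtain ⟨w, rfl⟩ := Sym2.mem_iff_exists.mp hve
    obtain ⟨k, hvk, hwk⟩ := D.edge_covered v w (hE _ (hE2 he))
    by_cases hk : i ≤ k
    · exact hnew v w he k hk ((D.mem_bagSet k v).mpr hvk) ((D.mem_bagSet k w).mpr hwk)
    -- The edge lies in an unvisited bag `k < i`, so its end `v` belongs to bags `k` and `i`, hence
    -- to bag `i - 1`, contrary to being last seen.
    · rcases hv.2 with h | h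
      · omega
      · refine h ((D.mem_bagSet ⟨i - 1, by omega⟩ v).mpr (D.interval v k _ ⟨i, hi⟩ ?_ ?_ hvk
          ((D.mem_bagSet ⟨i, hi⟩ v).mp hv.1)))
        · rw [Fin.le_def]; simp only; omega
        · rw [Fin.le_def]; simp only; omega
  · rintro τ3 ⟨α3, hI3, hα3⟩
    exact ⟨E2, α3, hI3, hα3, fun e he => hE e (hE2 he), hnew⟩

/-- There are at most `n * n` unordered pairs, hence at most `2 ^ (n * n)` edge sets. So the count
can be recovered from its residue. -/
theorem numForests_lt (G : SimpleGraph (Fin n)) : numForests G < modulus n := by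
  have h : Fintype.card (Sym2 (Fin n)) ≤ n * n := by
    have := Fintype.card_le_of_surjective (fun p : Fin n × Fin n => s(p.1, p.2))
      fun e => by induction e with | h a b => exact ⟨(a, b), rfl⟩
    simpa using this
  calc numForests G ≤ (Set.univ : Set (Set (Sym2 (Fin n)))).ncard :=
        Set.ncard_le_ncard (Set.subset_univ _)
    _ = 2 ^ Fintype.card (Sym2 (Fin n)) := by
        rw [Set.ncard_univ, Nat.card_eq_fintype_card, Fintype.card_set]
    _ ≤ 2 ^ (n * n) := Nat.pow_le_pow_right (by simp) h
    _ < _ := Nat.pow_lt_pow_right (by simp) (by simp)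

/-! ### The input word -/

theorem getElem?_flatMap {β γ : Type*} (l : List β) (f : β → List γ) {m : ℕ}
    (hf : ∀ x, (f x).length = m) {i v : ℕ} (hv : v < m) :
    (l.flatMap f)[i * m + v]? = (l[i]?).bind fun x => (f x)[v]? := by
  induction l generalizing i with
  | nil => simp
  | cons x l ih =>
    rw [List.flatMap_cons]
    cases i with
    | zero => rw [List.getElem?_append_left (by rw [hf]; omega)]; simp
    | succ i =>
      have e : (i + 1) * m + v = m + (i * m + v) := by ring
      rw [e, List.getElem?_append_right (by rw [hf]; omega), hf, Nat.add_sub_cancel_left, ih]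
      simp

theorem length_flatMap_const {β γ : Type*} (l : List β) (f : β → List γ) {m : ℕ}
    (hf : ∀ x, (f x).length = m) : (l.flatMap f).length = l.length * m := by
  induction l with
  | nil => simp
  | cons x l ih => rw [List.flatMap_cons, List.length_append, ih, hf, List.length_cons]; ring

/-- The initial memory. -/
noncomputable abbrev inputMem (D : PathDecomposition G) (j : ℕ) : ℕ := (encodeInput G D).getD j 0

theorem length_encodeInput (D : PathDecomposition G) :
    (encodeInput G D).length = arrayStart n D.length := by
  rw [encodeInput, List.length_append, List.length_append, length_flatMap_const _ _ (m := n),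
    length_flatMap_const _ _ (m := n)]
  · simp
  · simp
  · simp

theorem inputMem_zero (D : PathDecomposition G) : inputMem D 0 = n := by
  simp [inputMem, encodeInput]

theorem inputMem_one (D : PathDecomposition G) : inputMem D 1 = D.length := by
  simp [inputMem, encodeInput]

theorem inputMem_adj [DecidableRel G.Adj] (D : PathDecomposition G) (u v : Fin n) :
    inputMem D (2 + u * n + v) = if G.Adj u v then 1 else 0 := by
  have := row_add_lt u.2 v.2
  rw [inputMem, encodeInput, List.append_assoc, List.getD_eq_getElem?_getD,
    List.getElem?_append_right (by simp; omega), List.getElem?_append_left]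
  · rw [show 2 + (u : ℕ) * n + v - [n, D.length].length = u * n + v by simp; omega,
      getElem?_flatMap _ _ (by simp) v.2]
    simp
  · rw [length_flatMap_const _ _ (m := n) (by simp)]
    simp
    omega

theorem inputMem_bag (D : PathDecomposition G) {i v : ℕ} (hi : i < D.length) (hv : v < n) :
    inputMem D (2 + n * n + i * n + v) = if v ∈ D.bagSet i then 1 else 0 := by
  classical
  rw [inputMem, encodeInput, List.getD_eq_getElem?_getD, List.getElem?_append_right,
    List.length_append, length_flatMap_const _ _ (m := n) (by simp)]
  · rw [show 2 + n * n + i * n + v - ([n, D.length].length + (List.finRange n).length * n) =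
      i * n + v by simp; omega, getElem?_flatMap _ _ (by simp) hv]
    have := D.mem_bagSet ⟨i, hi⟩ ⟨v, hv⟩
    simp only at this
    simp [hi, hv, this]
  · rw [List.length_append, length_flatMap_const _ _ (m := n) (by simp)]
    simp
    omega

theorem inputMem_of_le (D : PathDecomposition G) {j : ℕ} (h : arrayStart n D.length ≤ j) :
    inputMem D j = 0 := by
  rw [inputMem, List.getD_eq_default]
  rwa [length_encodeInput]

theorem fits (n L : ℕ) : Fits n L (n * n + 2 * n + L + 4) where
  states := by
    rw [show 4 ^ (n + 1) = 2 ^ (2 * (n + 1)) by rw [pow_mul]; norm_num]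
    exact Nat.pow_le_pow_right (by simp) (by nlinarith [Nat.zero_le (n * n)])
  modulus_lt := Nat.pow_lt_pow_right (by simp) (by omega)
  arrayStart_lt := by
    have h1 : n * n < 2 ^ (n * n) := Nat.lt_two_pow_self
    have h2 : L * n ≤ 2 ^ (L + n) := by
      rw [pow_add]
      exact Nat.mul_le_mul Nat.lt_two_pow_self.le Nat.lt_two_pow_self.le
    have h3 : 2 ^ (n * n) ≤ 2 ^ (n * n + 2 * n + L) := Nat.pow_le_pow_right (by simp) (by omega)
    have h4 : 2 ^ (L + n) ≤ 2 ^ (n * n + 2 * n + L) :=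
      Nat.pow_le_pow_right (by simp) (by nlinarith [Nat.zero_le (n * n)])
    -- The factor 16 absorbs the constant 2 and the sum of the two powers.
    rw [pow_add 2 _ 4]
    simp only [arrayStart]
    omega
  length_lt := Nat.lt_two_pow_self.trans_le (Nat.pow_le_pow_right (by simp) (by omega))

theorem encodeInput_lt {W : ℕ} (hW : Fits n D.length W) : ∀ k ∈ encodeInput G D, k < 2 ^ W := by
  classical
  have h1 : 1 < 2 ^ W := hW.pow_lt (Nat.zero_le n)
  intro k hk
  simp only [encodeInput, List.mem_append, List.mem_cons, List.not_mem_nil, or_false,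
    List.mem_flatMap, List.mem_map, List.mem_finRange, true_and] at hk
  rcases hk with ((rfl | rfl) | ⟨u, v, rfl⟩) | ⟨u, v, rfl⟩
  · exact hW.lt le_rfl
  · exact hW.length_lt
  · split_ifs <;> omega
  · split_ifs <;> omega

theorem supportedOn_vacuum {R : Type*} [CommRing R] (B : Finset ℕ) :
    SupportedOn B (vacuum R) := by
  intro S hS p hp
  by_cases h : S = ∅
  · simp [h] at hp
  · simp [vacuum, h] at hS

/-! ### Correctness and running time of the whole program -/

/-- The time of the main program. -/
abbrev forestTime (n L Q : ℕ) : ℕ :=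
  1 + (1 + (1 + (1 + ((2 + 2 * (n * n + 1)) + (1 + (1 + ((1 + L * (1 + bagTime n Q)) + 1)))))))

/-- With `j` bags left, the vector is supported on bag `j - 1`, and no remaining edge lies inside a
bag of index at least `j`. At `j = 0` no edges and no modes are left, so the coefficient at `∅` is
the whole integral. -/
theorem forestCmd_ok (D : PathDecomposition G) {W : ℕ} (hW : Fits n D.length W) :
    Ok W forestCmd ⟨fun _ => 0, inputMem D⟩ (forestTime n D.length (4 ^ (D.width + 1))) fun τ =>
      τ.reg .out = numForests G := by
  classical
  have hst : 2 + n * n ≤ arrayStart n D.length := by simp [arrayStart]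
  have h1W : 1 < 2 ^ W := hW.pow_lt (Nat.zero_le n)
  have e0 : (Expr.load 0).eval ⟨fun _ => 0, inputMem D⟩ = n := inputMem_zero D
  refine Ok.append (Ok.assign (by rw [e0]; exact hW.lt le_rfl) ?_)
  rw [e0]
  set σ0 : PState := ⟨fun _ => 0, inputMem D⟩ with hσ0
  have e1 : (Expr.load 1).eval (σ0.set .n n) = D.length := inputMem_one D
  refine Ok.append (Ok.assign (by rw [e1]; exact hW.length_lt) ?_)
  rw [e1]
  have e2 : (2 + .var .n * .var .n + .var .L * .var .n : Expr).eval
      ((σ0.set .n n).set .L D.length) = arrayStart n D.length := by simp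
  refine Ok.append (Ok.assign (by rw [e2]; exact hW.arrayStart_lt) ?_)
  rw [e2]
  refine Ok.append (Ok.assign ?_ ?_)
  · simp
    have := hW.arrayStart_lt
    omega
  refine Ok.append ((powCmd_ok (m := n * n + 1) (by decide) (by simp) (by simp)
    hW.modulus_lt).mono le_rfl ?_)
  rintro τ1 ⟨p1, p2, p3⟩
  have rn : τ1.reg .n = n := by rw [p3 _ (by decide) (by decide)]; simp
  have rL : τ1.reg .L = D.length := by rw [p3 _ (by decide) (by decide)]; simp
  have rst : τ1.reg .st = arrayStart n D.length := by
    rw [p3 _ (by decide) (by decide)]; simp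
  have hm : τ1.mem = inputMem D := p2
  refine Ok.append (Ok.store (by simpa using h1W) ?_)
  simp only [Expr.eval_var, Expr.eval_ofNat, rst]
  have hmem : ∀ j, (τ1.write (arrayStart n D.length) 1).mem j =
      if j = arrayStart n D.length then 1 else inputMem D j := by
    intro j
    rw [PState.write_mem, hm]
  have hI : Inv D G.edgeFinset (vacuum _) (τ1.write (arrayStart n D.length) 1) := by
    refine ⟨rn, rst, p1, ?_, ?_, ?_, ?_, integral_edgesProd G⟩
    · intro i hi v hv
      have := row_add_lt hi hv
      rw [hmem, if_neg (by simp only [arrayStart]; omega), inputMem_bag D hi hv]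
    · intro a b hab
      have := row_add_lt a.2 b.2
      rw [hmem, if_neg (by omega), inputMem_adj]
      simp
    · intro S
      rw [hmem, vacuum]
      by_cases hS : S = ∅
      · simp [hS, enc]
      -- The memory beyond the input is zero, so the single stored 1 already represents the vacuum
      -- vector.
      · have : enc S ≠ 0 := fun h => hS (enc_injective (h.trans (by simp [enc])))
        rw [if_neg (by omega), inputMem_of_le D (by omega), if_neg hS]
        simp
    · intro m
      have := two_le_modulus n
      rw [hmem]
      split_ifs
      · omega
      · rw [inputMem_of_le D (by omega)]; omega
  refine Ok.append (Ok.assign (by simp [rL]; exact hW.length_lt) ?_)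
  simp only [Expr.eval_var, PState.write_reg, rL]
  refine Ok.append (Ok.loop (T := bagTime n (4 ^ (D.width + 1))) (fun j τ => ∃ E α, Inv D E α τ ∧
    SupportedOn (if j = 0 then ∅ else D.bagSet (j - 1)) α ∧ (∀ e ∈ E, e ∈ G.edgeSet) ∧
    ∀ a b : Fin n, s(a, b) ∈ E → ∀ k, j ≤ k → (a : ℕ) ∈ D.bagSet k → (b : ℕ) ∉ D.bagSet k)
    ?_ ?_ ?_ ?_)
  · refine ⟨_, _, hI.set (by decide) _, supportedOn_vacuum _, by simp, ?_⟩
    intro a b _ k hk ha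
    simp at hk
    rw [PathDecomposition.bagSet, dif_neg (by omega)] at ha
    simp at ha
  · rintro j hj τ ⟨E, α, hI, hα, hE, hd⟩ -
    simp at hj
    exact bagCmd_ok hW (hI.set (by decide) _) hj (by simp) (by simpa using hα) hE hd
  · simp
  · rintro τ ⟨E, α, hI, hα, hE, hd⟩ -
    have hE0 : E = ∅ := by
      rw [Finset.eq_empty_iff_forall_notMem]
      intro e he
      induction e with
      | h a b =>
        obtain ⟨k, ha, hb⟩ := D.edge_covered a b (hE _ he)
        exact hd a b he k (Nat.zero_le _) ((D.mem_bagSet k a).mpr ha) ((D.mem_bagSet k b).mpr hb)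
    have hα0 : ∀ S, S ≠ ∅ → α S = 0 := by
      intro S hS
      obtain ⟨p, hp⟩ := Finset.nonempty_iff_ne_empty.mpr hS
      by_contra h
      simpa using hα S h p hp
    have htot := hI.total
    have hrep := hI.rep ∅
    have hsm := hI.small 0
    simp only [hE0, edgesProd, Finset.prod_empty, OneMemClass.coe_one, Module.End.one_apply,
      integral_of_support hα0] at htot
    rw [htot] at hrep
    simp only [enc, Finset.sum_empty, mul_zero, add_zero] at hrep hsm
    -- The cell and the count are both below the modulus, so their congruence is an equality.
    rw [ZMod.natCast_eq_natCast_iff', Nat.mod_eq_of_lt hsm, Nat.mod_eq_of_lt (numForests_lt G)]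
      at hrep
    have ev : (Expr.load (.var .st)).eval τ = numForests G := by simp [hI.reg_st, hrep]
    refine Ok.assign ?_ ?_
    · rw [ev]; exact (numForests_lt G).trans hW.modulus_lt
    · rw [ev]; simp

/-- The leading term comes from L bags, n² pairs of vertices, Q states and O(n) commands per state.
-/
theorem forestTime_le {n L Q m : ℕ} (hn : n ≤ m) (hL : L ≤ m) (hm : 1 ≤ m) (hQ : 1 ≤ Q) :
    forestTime n L Q ≤ 200 * Q * m ^ 4 := by
  calc forestTime n L Q ≤ forestTime m m Q := by unfold forestTime bagTime; gcongr
    _ ≤ _ := by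
      -- After shifting both variables by one, the inequality holds coefficient by coefficient.
      obtain ⟨m, rfl⟩ := Nat.exists_eq_add_of_le' hm
      obtain ⟨Q, rfl⟩ := Nat.exists_eq_add_of_le' hQ
      unfold forestTime bagTime
      ring_nf
      omega

end Main

end ForestCounting

theorem mainTheorem5 :
    ∃ (P : ForestCounting.Program) (C k : ℕ),
      ∀ (n : ℕ) (G : SimpleGraph (Fin n)) (D : ForestCounting.PathDecomposition G),
        ∃ t : ℕ,
          P.Computes (ForestCounting.encodeInput G D) (ForestCounting.numForests G) t ∧
            t ≤ C * 4 ^ D.width * (n + D.length) ^ k := by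
  open ForestCounting in
  -- With m = n + L, the word length contributes `9 * m ^ 2`, the number of commands `200 * m ^ 4`,
  -- and the last factor 4 turns `4 ^ (width + 1)` into `4 ^ width`.
  refine ⟨forestCmd.compile, forestCmd.weight * 9 * 200 * 4, 6, fun n G D => ?_⟩
  have hW := fits n D.length
  have hok := forestCmd_ok D hW
  obtain ⟨t, hc, ht⟩ := forestCmd.compile_computes forestCmd_wellFormed (encodeInput_lt hW) hok.safe
  have hpost := hok.post
  refine ⟨t, hpost ▸ hc, ?_⟩
  have hm : 1 ≤ n + D.length := le_add_left D.length_pos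
  generalize hM : n + D.length = m at hm
  have hsteps := hok.steps_le.trans (forestTime_le (m := m) (by omega) (by omega) hm
    (Nat.one_le_pow _ _ (by simp)))
  have hW9 : n * n + 2 * n + D.length + 4 + 1 ≤ 9 * m ^ 2 := by
    calc n * n + 2 * n + D.length + 4 + 1 ≤ m * m + 2 * m + m + 4 + 1 := by gcongr <;> omega
      _ ≤ 9 * m ^ 2 := by nlinarith
  calc t ≤ _ := ht
    _ ≤ forestCmd.weight * (9 * m ^ 2) * (200 * 4 ^ (D.width + 1) * m ^ 4) := by gcongr
    _ = _ := by ring
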